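/- **Setting.** Let $d,T\ge 1$, $\mathcal B^d(r)=\{x\in\mathbb R^d:\|x\|_2\le r\}$ and $\Theta=\mathcal B^d(S)$. Let $m:\mathbb R\to\mathbb R$ be three times differentiable and convex, $\mu=m'$, $\dot\mu=m''$, $\ddot\mu=m'''$. Let $\tau_1,\dots,\tau_T$ be fixed in advance with $g(\tau_t)>0$, and suppose that $m$ is the log-partition function of the generalized linear model: for all $x,\theta\in\mathbb R^d$ and $t\le T$, $\exp\big((r\langle x,\theta\rangle-m(\langle x,\theta\rangle))/g(\tau_t)\big)\,d\nu_{\tau_t}(r)$ is a probability measure, denoted $GLM(\cdot\mid x,\tau_t;\theta)$, where $\nu_{\tau}$ is the base measure. Let $\theta_\star\in\Theta$ be unknown. In round $t=1,\dots,T$ the learner receives an arm set $\mathcal X_t\subseteq\mathcal B^d(1)$ (possibly random and adversarial), picks $x_t\in\mathcal X_t$; a reward $r_t$ is drawn, conditionally on everything that happened up to the choice of $x_t$, from $GLM(\cdot\mid x_t,\tau_t;\theta_\star)$; an adaptive adversary, having seen $x_t,r_t$, chooses $c_t\in\mathbb R$, and the learner observes $\tilde r_t=r_t+c_t$ and $\tau_t$.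 The total corruption satisfies $\sum_{t\le T}|c_t|\le C$ almost surely, with $C\ge 0$ known. Assume $\dot\mu(\langle x,\theta\rangle)\le L_\mu$ and $|\ddot\mu(\langle x,\theta\rangle)|\le R_s\,\dot\mu(\langle x,\theta\rangle)$ for all $x\in\bigcup_{t\le T}\mathcal X_t$, $\theta\in\Theta$, where $L_\mu>0$, $R_s\ge 0$, $S>0$, and that $\kappa:=\big(\inf_{x\in\bigcup_t\mathcal X_t,\ \theta\in\Theta}\dot\mu(\langle x,\theta\rangle)\big)^{-1}$ is finite. Assume optimal arms $x_{t,\star}\in\operatorname{argmax}_{x\in\mathcal X_t}\mu(\langle x,\theta_\star\rangle)$ exist, and put $\dot\mu_{t,\star}=\dot\mu(\langle x_{t,\star},\theta_\star\rangle)$, $g_{\max}=\max_{t\le T}g(\tau_t)$, $g_{\min}=\min_{t\le T}g(\tau_t)$ and $$\mathrm{Reg}(T)=\sum_{t=1}^T\mu(\langle x_{t,\star},\theta_\star\rangle)-\sum_{t=1}^T\mu(\langle x_t,\theta_\star\rangle).$$ **Algorithm HCW-GLB-OMD** with $\delta\in(0,1)$, $\alpha>0$, $\eta=1+R_sS$ and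 $\lambda=\max\{14d\eta R_s^2,\ 36\eta^2\alpha^2R_s^2S^2L_\mu^2,\ d/(4S^2)\}$. Write $\|x\|_A=\sqrt{x^\top Ax}$. Start with $\theta_1\in\Theta$, $H_1=\lambda I_d$. In round $t$, let $$\beta_t(\delta)=\Big(2\eta\log\tfrac1\delta+d(6\eta^2+\eta)\log\Big(1+\sum_{s<t}\tfrac{L_\mu}{\lambda g(\tau_s)}\Big)+4\lambda S^2\Big)^{1/2},$$ $$\mathcal C_t(\delta)=\{\theta\in\Theta:\|\theta-\theta_t\|_{H_t}\le\beta_t(\delta)+2\eta\alpha C\};$$ play $x_t$ from a maximizer $(x_t,\tilde\theta_t)$ of $\langle x,\theta\rangle$ over $\mathcal X_t\times\mathcal C_t(\delta)$ (assumed to exist); with $w_t=\min\{1,\alpha g(\tau_t)/\|x_t\|_{H_t^{-1}}\}$ ($w_t=1$ if $x_t=0$) and $\tilde\ell_t(\theta)=w_t\big(m(\langle x_t,\theta\rangle)-\tilde r_t\langle x_t,\theta\rangle\big)/g(\tau_t)$, let $$\theta_{t+1}=\operatorname*{argmin}_{\theta\in\Theta}\Big[\langle\nabla\tilde\ell_t(\theta_t),\theta-\theta_t\rangle+\tfrac12\|\theta-\theta_t\|^2_{\nabla^2\tilde\ell_t(\theta_t)}+\tfrac1{2\eta}\|\theta-\theta_t\|^2_{H_t}\Big],\qquad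 H_{t+1}=H_t+\nabla^2\tilde\ell_t(\theta_{t+1}).$$ **Theorem.** There is an absolute $k\in\mathbb N$ such that, for all $S,L_\mu,g_0,a,b>0$ and $R_s\ge 0$, there is a constant $K>0$ depending only on these six numbers with the following property. In every instance as above with $g_{\min}\ge g_0$ (any $d,T,C$, any $\delta\in(0,1)$, any model), if $a\sqrt d/(C\vee 1)\le\alpha\le b\sqrt d/(C\vee 1)$, then with probability at least $1-\delta$ HCW-GLB-OMD satisfies $$\mathrm{Reg}(T)\le K\,\big(1+\log\tfrac T\delta\big)^{k}\Big(d\sqrt{\textstyle\sum_{t=1}^T g(\tau_t)\dot\mu_{t,\star}}+(d^2g_{\max}+dC)\,\kappa\Big).$$ -/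

import Mathlib

open MeasureTheory

noncomputable section

namespace HCW

/-- The space `ℝ^d` with its Euclidean norm and inner product. -/
abbrev Vec (d : ℕ) : Type := EuclideanSpace ℝ (Fin d)

/-- The closed Euclidean ball `B^d(S)`; it is also the parameter set `Θ` of the learner. -/
def ball (d : ℕ) (S : ℝ) : Set (Vec d) := Metric.closedBall 0 S

/-- The (inverse) link function `μ = m'`. -/
def link (m : ℝ → ℝ) : ℝ → ℝ := deriv m

/-- The slope `μ̇ = m''` of the link function. -/
def slope (m : ℝ → ℝ) : ℝ → ℝ := deriv (link m)

/-- The Mahalanobis norm `‖x‖_A = √(xᵀ A x)`. -/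
def mnorm {d : ℕ} (A : Vec d →L[ℝ] Vec d) (x : Vec d) : ℝ := √(inner ℝ x (A x))

/-- The Hessian `∇² f (θ)`, as a linear operator. -/
def hessian {d : ℕ} (f : Vec d → ℝ) (θ : Vec d) : Vec d →L[ℝ] Vec d :=
  fderiv ℝ (gradient f) θ

/-! ### Generalized linear bandit with time-varying dispersion -/

/-- The data of a generalized linear model: log-partition function `m`, dispersion function `g`,
base measures `ν` (the base measure may depend on the dispersion parameter, as for Gaussian
rewards), the dispersion parameters `τ` fixed in advance, and the true parameter `θ⋆`. -/
structure GLM (d : ℕ) where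
  m : ℝ → ℝ
  g : ℝ → ℝ
  ν : ℝ → Measure ℝ
  τ : ℕ → ℝ
  θstar : Vec d

namespace GLM

variable {d : ℕ}

/-- The dispersion `g(τ_t)` of round `t`. -/
def disp (M : GLM d) (t : ℕ) : ℝ := M.g (M.τ t)

/-- The law with density `r ↦ exp ((r ⟨x, θ⟩ - m ⟨x, θ⟩) / g(τ))` with respect to `ν_τ`. -/
def law (M : GLM d) (τ : ℝ) (θ x : Vec d) : Measure ℝ :=
  (M.ν τ).withDensity fun r =>
    ENNReal.ofReal (Real.exp ((r * inner ℝ x θ - M.m (inner ℝ x θ)) / M.g τ))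

/-- Standing assumptions on the model over the horizon `T`: `m` is three times differentiable and
convex and is the log-partition function (that is, the laws are normalized for all parameters),
dispersions are positive, and `θ⋆ ∈ B^d(S)`. -/
structure Valid (M : GLM d) (S : ℝ) (T : ℕ) : Prop where
  diff_m : Differentiable ℝ M.m
  diff_link : Differentiable ℝ (link M.m)
  diff_slope : Differentiable ℝ (slope M.m)
  convex : ConvexOn ℝ Set.univ M.m
  disp_pos : ∀ t ∈ Set.Icc 1 T, 0 < M.disp t
  normalized : ∀ t ∈ Set.Icc 1 T, ∀ θ x : Vec d, IsProbabilityMeasure (M.law (M.τ t) θ x)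
  θstar_mem : M.θstar ∈ ball d S

/-- `g_max = max_{t ∈ [T]} g(τ_t)`. -/
def gmax (M : GLM d) (T : ℕ) : ℝ := sSup (M.disp '' Set.Icc 1 T)

/-- The set of slopes `μ̇(⟨x, θ⟩)` with `x ∈ X_1 ∪ ⋯ ∪ X_T` and `θ ∈ B^d(S)`. -/
def slopes (M : GLM d) (S : ℝ) (T : ℕ) (X : ℕ → Set (Vec d)) : Set ℝ :=
  {s | ∃ t ∈ Set.Icc 1 T, ∃ x ∈ X t, ∃ θ ∈ ball d S, s = slope M.m (inner ℝ x θ)}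

/-- `κ = (min_{x, θ} μ̇(⟨x, θ⟩))⁻¹`, over `x ∈ X_1 ∪ ⋯ ∪ X_T` and `θ ∈ B^d(S)`. -/
def kappa (M : GLM d) (S : ℝ) (T : ℕ) (X : ℕ → Set (Vec d)) : ℝ :=
  (sInf (M.slopes S T X))⁻¹

/-- Assumptions on the arm sets and the link function over the arm sets: arms lie in the unit
ball, the slope is at most `L`, the link is `R`-self-concordant, and the slope is bounded away
from zero (`κ` is finite). -/
structure ValidArms (M : GLM d) (S L R : ℝ) (T : ℕ) (X : ℕ → Set (Vec d)) : Prop where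
  arms : ∀ t ∈ Set.Icc 1 T, X t ⊆ ball d 1
  slope_le : ∀ t ∈ Set.Icc 1 T, ∀ x ∈ X t, ∀ θ ∈ ball d S, slope M.m (inner ℝ x θ) ≤ L
  self_concordant : ∀ t ∈ Set.Icc 1 T, ∀ x ∈ X t, ∀ θ ∈ ball d S,
    |deriv (slope M.m) (inner ℝ x θ)| ≤ R * slope M.m (inner ℝ x θ)
  curvature_pos : 0 < sInf (M.slopes S T X)

/-- `xs t` is an optimal arm of round `t` for the true parameter, for every `t ∈ [T]`. -/
def IsOptimal (M : GLM d) (T : ℕ) (X : ℕ → Set (Vec d)) (xs : ℕ → Vec d) : Prop :=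
  ∀ t ∈ Set.Icc 1 T, xs t ∈ X t ∧
    IsMaxOn (fun y => link M.m (inner ℝ y M.θstar)) (X t) (xs t)

/-- The cumulative pseudo-regret of the arms `x` against the optimal arms `xs`. -/
def regret (M : GLM d) (T : ℕ) (xs x : ℕ → Vec d) : ℝ :=
  ∑ t ∈ Finset.Icc 1 T, link M.m (inner ℝ (xs t) M.θstar)
    - ∑ t ∈ Finset.Icc 1 T, link M.m (inner ℝ (x t) M.θstar)

end GLM

/-! ### The algorithm -/

/-- Inputs of the learner: bound `S` on the parameter, Lipschitz constant `L`, self-concordance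
constant `R`, confidence level `δ`, weight threshold `α`, and corruption budget `C`. -/
structure Params where
  S : ℝ
  L : ℝ
  R : ℝ
  δ : ℝ
  α : ℝ
  C : ℝ

namespace Params

/-- The step size `η = 1 + R S`. -/
def η (p : Params) : ℝ := 1 + p.R * p.S

/-- The regularization parameter `λ`. -/
def lam (p : Params) (d : ℕ) : ℝ :=
  max (max (14 * d * p.η * p.R ^ 2) (36 * p.η ^ 2 * p.α ^ 2 * p.R ^ 2 * p.S ^ 2 * p.L ^ 2))
    (d / (4 * p.S ^ 2))

/-- The radius `β_t(δ)`, where `γ s` is the dispersion of round `s`. -/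
def β (p : Params) (d : ℕ) (γ : ℕ → ℝ) (t : ℕ) : ℝ :=
  √(2 * p.η * Real.log (1 / p.δ)
    + d * (6 * p.η ^ 2 + p.η) * Real.log (1 + ∑ s ∈ Finset.Ico 1 t, p.L / (p.lam d * γ s))
    + 4 * p.lam d * p.S ^ 2)

/-- The confidence set `C_t(δ)` around `θt`, in the norm of `Ht`. -/
def confSet (p : Params) {d : ℕ} (γ : ℕ → ℝ) (t : ℕ) (θt : Vec d) (Ht : Vec d →L[ℝ] Vec d) :
    Set (Vec d) :=
  {θ | θ ∈ ball d p.S ∧ mnorm Ht (θ - θt) ≤ p.β d γ t + 2 * p.η * p.α * p.C}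

end Params

/-- The confidence weight `min {1, α g / ‖x‖_{H⁻¹}}`, equal to `1` if `‖x‖_{H⁻¹} = 0`. -/
def weight {d : ℕ} (α g : ℝ) (H : Vec d →L[ℝ] Vec d) (x : Vec d) : ℝ :=
  if mnorm H.inverse x = 0 then 1 else min 1 (α * g / mnorm H.inverse x)

/-- The weighted negative log-likelihood `w (m ⟨x, θ⟩ - r ⟨x, θ⟩) / g`. -/
def loss {d : ℕ} (m : ℝ → ℝ) (g w : ℝ) (x : Vec d) (r : ℝ) (θ : Vec d) : ℝ :=
  w * (m (inner ℝ x θ) - r * inner ℝ x θ) / g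

/-- The objective minimized over `Θ` in the online mirror descent step. -/
def omdObjective {d : ℕ} (η : ℝ) (f : Vec d → ℝ) (H : Vec d →L[ℝ] Vec d) (θt θ : Vec d) : ℝ :=
  inner ℝ (gradient f θt) (θ - θt) + 1 / 2 * mnorm (hessian f θt) (θ - θt) ^ 2
    + 1 / (2 * η) * mnorm H (θ - θt) ^ 2

/-- The loss `ℓ̃_t` of round `t` formed from the arm `x`, the observed reward `r` and `H = H_t`. -/
def roundLoss {d : ℕ} (M : GLM d) (p : Params) (t : ℕ) (H : Vec d →L[ℝ] Vec d) (x : Vec d)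
    (r : ℝ) : Vec d → ℝ :=
  loss M.m (M.disp t) (weight p.α (M.disp t) H x) x r

/-- The arms `x t`, estimators `θ t` and matrices `H t` are produced by `HCW-GLB-OMD` on the arm
sets `X t` and the observed (corrupted) rewards `rt t`, over the rounds `1, …, T`. -/
structure IsRun {d : ℕ} (M : GLM d) (p : Params) (T : ℕ) (X : ℕ → Set (Vec d))
    (x : ℕ → Vec d) (rt : ℕ → ℝ) (θ : ℕ → Vec d) (H : ℕ → Vec d →L[ℝ] Vec d) : Prop where
  init_θ : θ 1 ∈ ball d p.S
  init_H : H 1 = p.lam d • ContinuousLinearMap.id ℝ (Vec d)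
  select : ∀ t ∈ Set.Icc 1 T, x t ∈ X t ∧ ∃ ϑ ∈ p.confSet M.disp t (θ t) (H t),
    ∀ y ∈ X t, ∀ φ ∈ p.confSet M.disp t (θ t) (H t), inner ℝ y φ ≤ inner ℝ (x t) ϑ
  update_θ : ∀ t ∈ Set.Icc 1 T, θ (t + 1) ∈ ball d p.S ∧
    IsMinOn (omdObjective p.η (roundLoss M p t (H t) (x t) (rt t)) (H t) (θ t)) (ball d p.S)
      (θ (t + 1))
  update_H : ∀ t ∈ Set.Icc 1 T,
    H (t + 1) = H t + hessian (roundLoss M p t (H t) (x t) (rt t)) (θ (t + 1))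

/-! ### The stochastic environment with an adaptive corrupting adversary -/

/-- `𝓖 t` is the information available when the reward of round `t` is drawn: it contains
everything up to the choice of the arm `x t` (and possibly private randomness of the players).
Given `𝓖 t`, the true reward `r t` follows the generalized linear model. The corruption `c t` may
depend on everything up to and including `x t` and `r t`, and the total corruption is at most
`C`. -/
structure IsEnvironment {d : ℕ} {Ω : Type*} {mΩ : MeasurableSpace Ω} (M : GLM d)
    (P : Measure Ω) (𝓖 : Filtration ℕ mΩ) (T : ℕ) (C : ℝ)
    (x θ : ℕ → Ω → Vec d) (r c : ℕ → Ω → ℝ) : Prop where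
  meas_x : ∀ t ∈ Set.Icc 1 T, Measurable[𝓖 t] (x t)
  meas_θ : ∀ t ∈ Set.Icc 1 (T + 1), Measurable[𝓖 t] (θ t)
  meas_r : ∀ t ∈ Set.Icc 1 T, Measurable[𝓖 (t + 1)] (r t)
  meas_c : ∀ t ∈ Set.Icc 1 T, Measurable[𝓖 (t + 1)] (c t)
  reward_law : ∀ t ∈ Set.Icc 1 T, ∀ B : Set ℝ, MeasurableSet B →
    P[(r t ⁻¹' B).indicator (fun _ => (1 : ℝ)) | 𝓖 t]
      =ᵐ[P] fun ω => (M.law (M.τ t) M.θstar (x t ω)).real B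
  budget : ∀ᵐ ω ∂P, ∑ t ∈ Finset.Icc 1 T, |c t ω| ≤ C

end HCW

end

noncomputable section

open ProbabilityTheory

namespace HCW

/-! ### Elementary inequalities for the exponential function -/

lemma two_mul_mul_exp_sub_one_le {k v : ℝ} (hk : 0 ≤ k) :
    2 * k * (Real.exp (v - k) - 1) ≤ Real.exp v - 1 - v := by
  rcases le_or_gt v k with h | h
  · have h1 : Real.exp (v - k) ≤ 1 := Real.exp_le_one_iff.2 (by linarith)
    nlinarith [Real.add_one_le_exp v]
  · set s := v - k with hs
    have hv : v = s + k := by rw [hs]; ring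
    have hs0 : 0 < s := by rw [hs]; linarith
    have h1 : 1 + k + k ^ 2 / 2 ≤ Real.exp k := Real.quadratic_le_exp_of_nonneg hk
    have hE := Real.exp_pos s
    have h2 : Real.exp v = Real.exp s * Real.exp k := by rw [hv, Real.exp_add]
    have h3 : s < Real.sinh s := Real.self_lt_sinh_iff.2 hs0
    rw [Real.sinh_eq] at h3
    have hI : Real.exp (-s) * Real.exp s = 1 := by rw [← Real.exp_add]; simp
    have h4 : Real.exp s * (1 + k + k ^ 2 / 2) ≤ Real.exp v := by
      rw [h2]; exact mul_le_mul_of_nonneg_left h1 hE.le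
    rw [hv] at h4 ⊢
    have h5 : 0 ≤ Real.exp s * (k - 1 + Real.exp (-s)) ^ 2 := by positivity
    have h6 : Real.exp s * (k - 1 + Real.exp (-s)) ^ 2
        = Real.exp s * (k - 1) ^ 2 + 2 * (k - 1) + Real.exp (-s) := by
      have : Real.exp s * (k - 1 + Real.exp (-s)) ^ 2
        = Real.exp s * (k - 1) ^ 2 + 2 * (k - 1) * (Real.exp (-s) * Real.exp s)
          + Real.exp (-s) * (Real.exp (-s) * Real.exp s) := by ring
      rw [this, hI]; ring
    nlinarith

lemma exp_mul_sub_le {t v : ℝ} (ht0 : 0 ≤ t) (ht1 : t ≤ 1) (hv : 0 ≤ v) :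
    Real.exp (t * v) - 1 - t * v ≤ t ^ 2 * (Real.exp v - 1 - v) := by
  let f : ℝ → ℝ := fun v => t ^ 2 * (Real.exp v - 1 - v) - (Real.exp (t * v) - 1 - t * v)
  have hf : ∀ v, HasDerivAt f (t ^ 2 * (Real.exp v - 1) - (Real.exp (t * v) * t - t)) v := by
    intro v
    have h1 : HasDerivAt (fun v => t * v) t v := by simpa using (hasDerivAt_id v).const_mul t
    exact ((((Real.hasDerivAt_exp v).sub_const 1).sub (hasDerivAt_id v)).const_mul (t ^ 2)).sub
      ((h1.exp.sub_const 1).sub h1)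
  have hmono : MonotoneOn f (Set.Ici 0) := by
    apply monotoneOn_of_deriv_nonneg (convex_Ici 0)
    · exact fun v _ => (hf v).continuousAt.continuousWithinAt
    · exact fun v _ => (hf v).differentiableAt.differentiableWithinAt
    · intro v hv
      rw [(hf v).deriv]
      have h2 := convexOn_exp.2 (Set.mem_univ 0) (Set.mem_univ v) (by linarith : 0 ≤ 1 - t) ht0
        (by ring)
      simp only [smul_eq_mul, mul_zero, zero_add, Real.exp_zero] at h2
      nlinarith
  have := hmono (Set.mem_Ici.2 le_rfl) (Set.mem_Ici.2 hv) hv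
  simp only [f, mul_zero, Real.exp_zero] at this
  linarith

/-- The exponential of a parabola is dominated, uniformly on `[0, U]`, by its exponential
remainder at the endpoint. -/
lemma exp_mul_sub_sq_le {u U x : ℝ} (hu : 0 ≤ u) (huU : u ≤ U) (hU : 0 < U) :
    Real.exp (u * x - u ^ 2) ≤ 1 + (Real.exp (U * x) - 1 - U * x) / (2 * U ^ 2) := by
  have hrem : 0 ≤ Real.exp (U * x) - 1 - U * x := by linarith [Real.add_one_le_exp (U * x)]
  rcases le_or_gt x 0 with hx | hx
  · have : Real.exp (u * x - u ^ 2) ≤ 1 := Real.exp_le_one_iff.2 (by nlinarith)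
    have : 0 ≤ (Real.exp (U * x) - 1 - U * x) / (2 * U ^ 2) := by positivity
    linarith
  rcases hu.eq_or_lt with rfl | hu
  · have : 0 ≤ (Real.exp (U * x) - 1 - U * x) / (2 * U ^ 2) := by positivity
    simpa using this
  have h1 := two_mul_mul_exp_sub_one_le (k := u ^ 2) (v := u * x) (by positivity)
  have h2 := exp_mul_sub_le (t := u / U) (v := U * x) (by positivity)
    ((div_le_one hU).2 huU) (by positivity)
  have h3 : u / U * (U * x) = u * x := by field_simp
  rw [h3] at h2
  have h4 : 2 * u ^ 2 * (Real.exp (u * x - u ^ 2) - 1)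
      ≤ (u / U) ^ 2 * (Real.exp (U * x) - 1 - U * x) := h1.trans h2
  have h5 : (u / U) ^ 2 * (Real.exp (U * x) - 1 - U * x)
      = 2 * u ^ 2 * ((Real.exp (U * x) - 1 - U * x) / (2 * U ^ 2)) := by
    field_simp
  rw [h5] at h4
  have := le_of_mul_le_mul_left h4 (by positivity)
  linarith

/-! ### Random variables with a given centred cumulant generating function -/

variable {Ω : Type*} {mΩ : MeasurableSpace Ω}

/-- `X` is a centred random variable whose cumulant generating function is `b`, with derivatives
`b₁` and `b₂`. -/
structure HasCGF (p : Measure Ω) (X : Ω → ℝ) (b b₁ b₂ : ℝ → ℝ) : Prop where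
  meas : Measurable X
  integrable : ∀ u, Integrable (fun ω => Real.exp (u * X ω)) p
  integral_exp : ∀ u, ∫ ω, Real.exp (u * X ω) ∂p = Real.exp (b u)
  hasDerivAt : ∀ u, HasDerivAt b (b₁ u) u
  hasDerivAt₁ : ∀ u, HasDerivAt b₁ (b₂ u) u
  centred : b₁ 0 = 0

namespace HasCGF

variable {p : Measure Ω} {X : Ω → ℝ} {b b₁ b₂ : ℝ → ℝ}

lemma integrableExpSet_eq (h : HasCGF p X b b₁ b₂) : integrableExpSet X p = Set.univ :=
  Set.eq_univ_of_forall h.integrable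

lemma mem_interior (h : HasCGF p X b b₁ b₂) (v : ℝ) : v ∈ interior (integrableExpSet X p) := by
  rw [h.integrableExpSet_eq]; simp

lemma cgf_eq (h : HasCGF p X b b₁ b₂) : cgf X p = b := by
  funext u
  rw [cgf, mgf, h.integral_exp, Real.log_exp]

lemma zero [IsProbabilityMeasure p] (h : HasCGF p X b b₁ b₂) : b 0 = 0 := by
  rw [← h.cgf_eq]; simp

lemma deriv_eq (h : HasCGF p X b b₁ b₂) : deriv b = b₁ := funext fun u => (h.hasDerivAt u).deriv

lemma deriv₁_eq (h : HasCGF p X b b₁ b₂) : deriv b₁ = b₂ :=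
  funext fun u => (h.hasDerivAt₁ u).deriv

lemma continuous (h : HasCGF p X b b₁ b₂) : Continuous b :=
  continuous_iff_continuousAt.2 fun u => (h.hasDerivAt u).continuousAt

lemma continuous₁ (h : HasCGF p X b b₁ b₂) : Continuous b₁ :=
  continuous_iff_continuousAt.2 fun u => (h.hasDerivAt₁ u).continuousAt

lemma integrable_self (h : HasCGF p X b b₁ b₂) : Integrable X p := by
  simpa using integrable_pow_mul_exp_of_mem_interior_integrableExpSet (h.mem_interior 0) 1

lemma integral_eq_zero [IsProbabilityMeasure p] (h : HasCGF p X b b₁ b₂) : ∫ ω, X ω ∂p = 0 := by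
  have := deriv_cgf_zero (h.mem_interior 0)
  rw [h.cgf_eq, h.deriv_eq, h.centred] at this
  simpa using this.symm

lemma integrable_pow_mul (h : HasCGF p X b b₁ b₂) (v : ℝ) (k : ℕ) :
    Integrable (fun ω => X ω ^ k * Real.exp (v * X ω)) p :=
  integrable_pow_mul_exp_of_mem_interior_integrableExpSet (h.mem_interior v) k

lemma integral_mul_exp (h : HasCGF p X b b₁ b₂) (v : ℝ) :
    ∫ ω, X ω * Real.exp (v * X ω) ∂p = b₁ v * Real.exp (b v) := by
  have := deriv_cgf (h.mem_interior v)
  rw [h.cgf_eq, h.deriv_eq, mgf, h.integral_exp] at this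
  rw [this, div_mul_cancel₀ _ (Real.exp_pos _).ne']

lemma integral_sq_mul_exp (h : HasCGF p X b b₁ b₂) (v : ℝ) :
    ∫ ω, X ω ^ 2 * Real.exp (v * X ω) ∂p = (b₂ v + b₁ v ^ 2) * Real.exp (b v) := by
  have := iteratedDeriv_two_cgf (h.mem_interior v)
  rw [h.cgf_eq, iteratedDeriv_succ, iteratedDeriv_one, h.deriv_eq, h.deriv₁_eq, mgf,
    h.integral_exp] at this
  rw [this, sub_add_cancel, div_mul_cancel₀ _ (Real.exp_pos _).ne']

/-- The second moment of the tilted variable about an arbitrary point. -/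
lemma lintegral_sq_mul_exp (h : HasCGF p X b b₁ b₂) (v s : ℝ) :
    ∫⁻ ω, ENNReal.ofReal ((X ω - b₁ v + s) ^ 2 * Real.exp (v * X ω - b v)) ∂p
      = ENNReal.ofReal (b₂ v + s ^ 2) := by
  have e : (fun ω => (X ω - b₁ v + s) ^ 2 * Real.exp (v * X ω - b v)) = fun ω =>
      Real.exp (-b v) * (X ω ^ 2 * Real.exp (v * X ω)
        + (2 * (s - b₁ v)) * (X ω ^ 1 * Real.exp (v * X ω))
        + (s - b₁ v) ^ 2 * Real.exp (v * X ω)) := by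
    funext ω
    rw [sub_eq_add_neg (v * X ω), Real.exp_add]; ring
  have i0 := h.integrable v
  have i1 := h.integrable_pow_mul v 1
  have i2 := h.integrable_pow_mul v 2
  have i3 : Integrable (fun ω => X ω ^ 2 * Real.exp (v * X ω)
        + (2 * (s - b₁ v)) * (X ω ^ 1 * Real.exp (v * X ω))) p := i2.add (i1.const_mul _)
  rw [← ofReal_integral_eq_lintegral_ofReal]
  · congr 1
    rw [e, integral_const_mul, integral_add i3 (i0.const_mul _), integral_add i2 (i1.const_mul _),
      integral_const_mul, integral_const_mul, h.integral_exp, h.integral_sq_mul_exp]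
    simp only [pow_one]
    rw [h.integral_mul_exp]
    have : Real.exp (-b v) * Real.exp (b v) = 1 := by rw [← Real.exp_add]; simp
    linear_combination (b₂ v + s ^ 2) * this
  · rw [e]
    exact (i3.add (i0.const_mul _)).const_mul _
  · exact Filter.Eventually.of_forall fun ω => by positivity

end HasCGF

lemma ofReal_integral_le_lintegral_ofReal {α : Type*} {mα : MeasurableSpace α} {μ : Measure α}
    (f : α → ℝ) : ENNReal.ofReal (∫ a, f a ∂μ) ≤ ∫⁻ a, ENNReal.ofReal (f a) ∂μ := by
  by_cases hf : Integrable f μ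
  · apply ENNReal.ofReal_le_of_le_toReal
    rw [integral_eq_lintegral_pos_part_sub_lintegral_neg_part hf]
    exact sub_le_self _ ENNReal.toReal_nonneg
  · simp [integral_undef hf]

namespace HasCGF

variable {Ω : Type*} {mΩ : MeasurableSpace Ω}
variable {p : Measure Ω} {X : Ω → ℝ} {b b₁ b₂ : ℝ → ℝ}

/-- The positive part of the derivative of `v ↦ exp (v X - b v - v² + τ v)`, bounded through
`y ≤ (y + t)² / (4 t)`. -/
def slopeBound (X : Ω → ℝ) (b b₁ t : ℝ → ℝ) (τ : ℝ) (ω : Ω) (v : ℝ) : ℝ :=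
  (X ω - b₁ v + (t v - (2 * v - τ))) ^ 2 / (4 * t v) *
    Real.exp (v * X ω - b v - v ^ 2 + τ * v)

/-- The increment of `v ↦ exp (v X - b v - v² + τ v)` on `[u₀, U]` is dominated by the integral
of a bound for its derivative. -/
lemma ofReal_exp_le_add_lintegral (h : HasCGF p X b b₁ b₂) {t : ℝ → ℝ}
    {τ u₀ U u : ℝ} (hpos : ∀ v ∈ Set.Icc u₀ U, 0 < t v) (hu₀ : u₀ ≤ u) (hu : u ≤ U) (ω : Ω) :
    ENNReal.ofReal (Real.exp (u * X ω - b u - u ^ 2 + τ * u))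
      ≤ ENNReal.ofReal (Real.exp (u₀ * X ω - b u₀ - u₀ ^ 2 + τ * u₀))
        + ∫⁻ v in Set.Icc u₀ U, ENNReal.ofReal (slopeBound X b b₁ t τ ω v) := by
  have hc := h.continuous
  have hc₁ := h.continuous₁
  set φ : ℝ → ℝ := fun v => Real.exp (v * X ω - b v - v ^ 2 + τ * v) with hφ
  have hd : ∀ v, HasDerivAt φ (φ v * (X ω - b₁ v - 2 * v + τ)) v := by
    intro v
    have h1 : HasDerivAt (fun v => v * X ω - b v - v ^ 2 + τ * v)
        (X ω - b₁ v - 2 * v + τ) v := by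
      have : HasDerivAt (fun v => v * X ω - b v - v ^ 2 + τ * v) _ v := ((((hasDerivAt_id v).mul_const (X ω)).sub (h.hasDerivAt v)).sub
        (hasDerivAt_pow 2 v)).add ((hasDerivAt_id v).const_mul τ)
      convert! this using 1
      simp
    exact h1.exp
  have hφc : Continuous φ := by rw [hφ]; fun_prop
  have hint : IntervalIntegrable (fun v => φ v * (X ω - b₁ v - 2 * v + τ)) volume u₀ u := by
    apply Continuous.intervalIntegrable
    fun_prop
  have hftc : ∫ v in u₀..u, φ v * (X ω - b₁ v - 2 * v + τ) = φ u - φ u₀ :=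
    intervalIntegral.integral_eq_sub_of_hasDerivAt (fun v _ => hd v) hint
  have hsub : ENNReal.ofReal (φ u - φ u₀)
      ≤ ∫⁻ v in Set.Icc u₀ U, ENNReal.ofReal (slopeBound X b b₁ t τ ω v) := by
    rw [← hftc, intervalIntegral.integral_of_le hu₀]
    calc ENNReal.ofReal (∫ v in Set.Ioc u₀ u, φ v * (X ω - b₁ v - 2 * v + τ))
        ≤ ∫⁻ v in Set.Ioc u₀ u, ENNReal.ofReal (φ v * (X ω - b₁ v - 2 * v + τ)) :=
          ofReal_integral_le_lintegral_ofReal _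
      _ ≤ ∫⁻ v in Set.Ioc u₀ u, ENNReal.ofReal (slopeBound X b b₁ t τ ω v) := by
          apply setLIntegral_mono' measurableSet_Ioc
          intro v hv
          apply ENNReal.ofReal_le_ofReal
          have htv := hpos v ⟨hv.1.le, hv.2.trans hu⟩
          rw [mul_comm]
          apply mul_le_mul_of_nonneg_right _ (Real.exp_pos _).le
          rw [le_div_iff₀ (by positivity)]
          nlinarith [sq_nonneg (X ω - b₁ v - (2 * v - τ) - t v)]
      _ ≤ _ := lintegral_mono_set (Set.Ioc_subset_Icc_self.trans (Set.Icc_subset_Icc_right hu))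
  calc ENNReal.ofReal (φ u) = ENNReal.ofReal (φ u₀ + (φ u - φ u₀)) := by congr 1; ring
    _ ≤ ENNReal.ofReal (φ u₀) + ENNReal.ofReal (φ u - φ u₀) := ENNReal.ofReal_add_le
    _ ≤ _ := by gcongr

lemma measurable_slopeBound (h : HasCGF p X b b₁ b₂) {t : ℝ → ℝ} (ht : Continuous t) (τ : ℝ) :
    Measurable (fun z : Ω × ℝ => ENNReal.ofReal (slopeBound X b b₁ t τ z.1 z.2)) := by
  have hc := h.continuous.measurable
  have hc₁ := h.continuous₁.measurable
  have hX := h.meas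
  have ht := ht.measurable
  unfold slopeBound
  fun_prop

lemma lintegral_slopeBound [SFinite p] (h : HasCGF p X b b₁ b₂) {t : ℝ → ℝ} (ht : Continuous t)
    {τ u₀ U : ℝ} (hpos : ∀ v ∈ Set.Icc u₀ U, 0 < t v) :
    ∫⁻ ω, (∫⁻ v in Set.Icc u₀ U, ENNReal.ofReal (slopeBound X b b₁ t τ ω v)) ∂p
      = ∫⁻ v in Set.Icc u₀ U, ENNReal.ofReal ((b₂ v + (t v - (2 * v - τ)) ^ 2) / (4 * t v)
          * Real.exp (-v ^ 2 + τ * v)) := by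
  rw [lintegral_lintegral_swap]
  · apply setLIntegral_congr_fun measurableSet_Icc
    intro v hv
    have htv := hpos v hv
    set c : ℝ := Real.exp (-v ^ 2 + τ * v) / (4 * t v) with hcdef
    have hcnn : 0 ≤ c := by positivity
    have e : ∀ ω, ENNReal.ofReal (slopeBound X b b₁ t τ ω v) = ENNReal.ofReal c *
        ENNReal.ofReal ((X ω - b₁ v + (t v - (2 * v - τ))) ^ 2 * Real.exp (v * X ω - b v)) := by
      intro ω
      rw [← ENNReal.ofReal_mul hcnn, slopeBound, hcdef]
      congr 1
      have : v * X ω - b v - v ^ 2 + τ * v = (v * X ω - b v) + (-v ^ 2 + τ * v) := by ring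
      rw [this, Real.exp_add]
      field_simp
    simp only [e]
    rw [lintegral_const_mul' _ _ ENNReal.ofReal_ne_top, h.lintegral_sq_mul_exp,
      ← ENNReal.ofReal_mul hcnn]
    congr 1
    rw [hcdef]
    field_simp
  · exact (h.measurable_slopeBound ht τ).aemeasurable

end HasCGF

lemma nonneg_of_deriv_nonneg {f f' : ℝ → ℝ} {U : ℝ} (hf : ∀ v, HasDerivAt f (f' v) v)
    (h0 : f 0 = 0) (h : ∀ v ∈ Set.Icc 0 U, 0 ≤ f' v) : ∀ v ∈ Set.Icc 0 U, 0 ≤ f v := by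
  intro v hv
  have hmono : MonotoneOn f (Set.Icc 0 U) := by
    apply monotoneOn_of_deriv_nonneg (convex_Icc 0 U)
    · exact fun v _ => (hf v).continuousAt.continuousWithinAt
    · exact fun v _ => (hf v).differentiableAt.differentiableWithinAt
    · intro v hv
      rw [(hf v).deriv]
      exact h v (interior_subset hv)
  have := hmono ⟨le_rfl, hv.1.trans hv.2⟩ hv hv.1
  rwa [h0] at this

namespace HasCGF

variable {Ω : Type*} {mΩ : MeasurableSpace Ω}
variable {p : Measure Ω} [IsProbabilityMeasure p] {X : Ω → ℝ} {b b₁ b₂ : ℝ → ℝ}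

lemma nonneg (h : HasCGF p X b b₁ b₂) {U : ℝ} (hb : ∀ v ∈ Set.Icc 0 U, 0 ≤ b₂ v) :
    ∀ v ∈ Set.Icc 0 U, 0 ≤ b v :=
  nonneg_of_deriv_nonneg h.hasDerivAt h.zero (nonneg_of_deriv_nonneg h.hasDerivAt₁ h.centred hb)

lemma le_sq (h : HasCGF p X b b₁ b₂) {n a U : ℝ} (hn : 0 ≤ n) (ha' : a ≤ 0.463)
    (hU : U ≤ 1) (hb : ∀ v ∈ Set.Icc 0 U, b₂ v ≤ n * Real.exp (a * v)) :
    ∀ v ∈ Set.Icc 0 U, b v ≤ 0.6 * n * v ^ 2 := by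
  have hexp : ∀ v ∈ Set.Icc (0 : ℝ) 1, Real.exp (a * v) ≤ 1 + 0.6 * v := by
    intro v hv
    have h2 := convexOn_exp.2 (Set.mem_univ 0) (Set.mem_univ 0.463) (by linarith [hv.2] : 0 ≤ 1 - v)
      hv.1 (by ring)
    simp only [smul_eq_mul, mul_zero, zero_add, Real.exp_zero] at h2
    have h3 : Real.exp 0.463 ≤ 1.6 := by
      have := Real.exp_bound' (x := 0.463) (by norm_num) (by norm_num) (n := 4) (by norm_num)
      refine this.trans ?_
      simp only [Finset.sum_range_succ, Nat.factorial]
      norm_num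
    have h4 : Real.exp (a * v) ≤ Real.exp (v * 0.463) :=
      Real.exp_le_exp.2 (by nlinarith [hv.1])
    nlinarith [hv.1]
  intro v hv
  have h1 : ∀ v ∈ Set.Icc 0 U, 0 ≤ n * (v + 0.3 * v ^ 2) - b₁ v := by
    apply nonneg_of_deriv_nonneg (f' := fun v => n * (1 + 0.6 * v) - b₂ v)
    · intro v
      have h1 : HasDerivAt (fun v : ℝ => n * (v + 0.3 * v ^ 2)) _ v :=
        ((hasDerivAt_id v).add ((hasDerivAt_pow 2 v).const_mul 0.3)).const_mul n
      have h2 : HasDerivAt (fun v => n * (v + 0.3 * v ^ 2) - b₁ v) _ v := h1.sub (h.hasDerivAt₁ v)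
      convert! h2 using 1
      norm_num; left; ring
    · simp [h.centred]
    · intro v hv
      have := hb v hv
      have := hexp v ⟨hv.1, hv.2.trans hU⟩
      nlinarith
  have h2 : ∀ v ∈ Set.Icc 0 U, 0 ≤ n * (v ^ 2 / 2 + 0.1 * v ^ 3) - b v := by
    apply nonneg_of_deriv_nonneg (f' := fun v => n * (v + 0.3 * v ^ 2) - b₁ v)
    · intro v
      have h1 : HasDerivAt (fun v : ℝ => n * (v ^ 2 / 2 + 0.1 * v ^ 3)) _ v :=
        (((hasDerivAt_pow 2 v).div_const 2).add ((hasDerivAt_pow 3 v).const_mul 0.1)).const_mul n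
      have h2 : HasDerivAt (fun v => n * (v ^ 2 / 2 + 0.1 * v ^ 3) - b v) _ v :=
        h1.sub (h.hasDerivAt v)
      convert! h2 using 1
      norm_num; left; ring
    · simp [h.zero]
    · exact h1
  have h3 := h2 v hv
  have h4 : v ^ 3 ≤ v ^ 2 := by
    have : v ^ 3 = v ^ 2 * v := by ring
    nlinarith [hv.1, hv.2, sq_nonneg v]
  nlinarith

/-- The exponential remainder at the endpoint, which dominates the likelihood ratio on `[0, U]`. -/
def endpointBound (X : Ω → ℝ) (τ U : ℝ) (ω : Ω) : ℝ :=
  (Real.exp (U * (X ω + τ)) - 1 - U * (X ω + τ)) / (2 * U ^ 2)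

lemma exp_le_one_add_endpointBound (h : HasCGF p X b b₁ b₂) {τ U u : ℝ} (hU : 0 < U)
    (hu : u ∈ Set.Icc 0 U) (hb : ∀ v ∈ Set.Icc 0 U, 0 ≤ b₂ v) (ω : Ω) :
    Real.exp (u * X ω - b u - u ^ 2 + τ * u) ≤ 1 + endpointBound X τ U ω := by
  refine le_trans ?_ (exp_mul_sub_sq_le hu.1 hu.2 hU)
  have := h.nonneg hb u hu
  exact Real.exp_le_exp.2 (by linarith)

lemma lintegral_endpointBound_le (h : HasCGF p X b b₁ b₂) {n τ U : ℝ} (hn : 0 ≤ n)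
    (hτ : 0 ≤ τ) (hU : 0 < U) (hU1 : U ≤ 1) (hb : b U ≤ 0.6 * n * U ^ 2) :
    ∫⁻ ω, ENNReal.ofReal (endpointBound X τ U ω) ∂p
      ≤ ENNReal.ofReal ((Real.exp (τ + 0.6 * n) - 1 - τ) / 2) := by
  have hi1 : Integrable (fun ω => Real.exp (U * (X ω + τ))) p := by
    have : (fun ω => Real.exp (U * (X ω + τ)))
        = fun ω => Real.exp (U * X ω) * Real.exp (U * τ) := by
      funext ω; rw [mul_add, Real.exp_add]
    rw [this]; exact (h.integrable U).mul_const _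
  have hi2 : Integrable (fun ω => U * (X ω + τ)) p :=
    (h.integrable_self.add (integrable_const τ)).const_mul U
  have hi3 : Integrable (fun ω => Real.exp (U * (X ω + τ)) - 1) p :=
    hi1.sub (integrable_const 1)
  have hI : ∫ ω, endpointBound X τ U ω ∂p
      = (Real.exp (U * τ + b U) - 1 - U * τ) / (2 * U ^ 2) := by
    unfold endpointBound
    rw [integral_div, integral_sub hi3 hi2,
      integral_sub hi1 (integrable_const 1), integral_const_mul,
      integral_add h.integrable_self (integrable_const τ), h.integral_eq_zero]
    have : ∫ ω, Real.exp (U * (X ω + τ)) ∂p = Real.exp (U * τ + b U) := by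
      rw [Real.exp_add, ← h.integral_exp, ← integral_const_mul]
      congr 1; funext ω; rw [mul_add, Real.exp_add, mul_comm]
    rw [this]; simp
  rw [← ofReal_integral_eq_lintegral_ofReal, hI]
  · apply ENNReal.ofReal_le_ofReal
    have h1 : Real.exp (U * τ + b U) ≤ Real.exp (U * (τ + 0.6 * n * U)) :=
      Real.exp_le_exp.2 (by linarith)
    have h2 := exp_mul_sub_le hU.le hU1 (v := τ + 0.6 * n * U) (by positivity)
    have h3 : Real.exp (τ + 0.6 * n * U) ≤ Real.exp (τ + 0.6 * n) - 0.6 * n * (1 - U) := by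
      have e : Real.exp (τ + 0.6 * n)
          = Real.exp (τ + 0.6 * n * U) * Real.exp (0.6 * n * (1 - U)) := by
        rw [← Real.exp_add]; congr 1; ring
      rw [e]
      have h4 := Real.add_one_le_exp (0.6 * n * (1 - U))
      have h5 : 1 ≤ Real.exp (τ + 0.6 * n * U) := Real.one_le_exp (by positivity)
      have h6 : 0 ≤ 0.6 * n * (1 - U) := by
        have : 0 ≤ 1 - U := by linarith
        positivity
      nlinarith
    rw [div_le_div_iff₀ (by positivity) (by norm_num)]
    have h7 : 0 < U ^ 2 := by positivity
    nlinarith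
  · exact (hi3.sub hi2).div_const _
  · exact Filter.Eventually.of_forall fun ω => div_nonneg
      (by linarith [Real.add_one_le_exp (U * (X ω + τ))]) (by positivity)

/-- Domination of the likelihood ratio when its variance `n` is small compared with the quadratic
penalty. -/
lemma exists_dominating_of_small (h : HasCGF p X b b₁ b₂) {n a τ U : ℝ} (hn : 0 ≤ n)
    (ha : 0 ≤ a) (ha' : a ≤ 0.463) (hτ : 0 ≤ τ) (haτ : a + τ < 2) (hU : 0 ≤ U)
    (hb0 : ∀ v ∈ Set.Icc 0 U, 0 ≤ b₂ v)
    (hb : ∀ v ∈ Set.Icc 0 U, b₂ v ≤ n * Real.exp (a * v)) :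
    ∃ F : Ω → ENNReal, Measurable F ∧
      ∫⁻ ω, F ω ∂p ≤ ENNReal.ofReal ((Real.exp (τ + 0.6 * n) - 1 - τ) / 2
        + n / (4 * (2 - τ)) * (Real.exp (a + τ - 1) / (2 - a - τ))) ∧
      ∀ ω, ∀ u ∈ Set.Icc 0 U,
        ENNReal.ofReal (Real.exp (u * X ω - b u - u ^ 2 + τ * u)) ≤ 1 + F ω := by
  have hE0 : 0 ≤ (Real.exp (τ + 0.6 * n) - 1 - τ) / 2 := by
    have := Real.add_one_le_exp (τ + 0.6 * n)
    have : 0 ≤ 0.6 * n := by positivity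
    linarith
  have hτ2 : 0 < 2 - τ := by linarith
  have haτ2 : 0 < 2 - a - τ := by linarith
  have hE1 : 0 ≤ n / (4 * (2 - τ)) * (Real.exp (a + τ - 1) / (2 - a - τ)) := by positivity
  rcases hU.eq_or_lt with rfl | hU
  · refine ⟨fun _ => 0, measurable_const, by simp, ?_⟩
    intro ω u hu
    have : u = 0 := le_antisymm hu.2 hu.1
    subst this
    simp [h.zero]
  set U₁ := min U 1 with hU₁
  have hU₁0 : 0 < U₁ := lt_min hU one_pos
  have hU₁1 : U₁ ≤ 1 := min_le_right _ _
  have hU₁U : U₁ ≤ U := min_le_left _ _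
  have hmX := h.meas
  have hsub : ∀ v ∈ Set.Icc 0 U₁, v ∈ Set.Icc 0 U := fun v hv => ⟨hv.1, hv.2.trans hU₁U⟩
  set t : ℝ → ℝ := fun v => 2 * v - τ with ht
  have htc : Continuous t := by rw [ht]; fun_prop
  have htpos : ∀ v ∈ Set.Icc 1 U, 0 < t v := fun v hv => by simp only [ht]; linarith [hv.1]
  have hatom : ∀ ω, ∀ u ∈ Set.Icc 0 U₁,
      ENNReal.ofReal (Real.exp (u * X ω - b u - u ^ 2 + τ * u))
        ≤ 1 + ENNReal.ofReal (endpointBound X τ U₁ ω) := by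
    intro ω u hu
    have h1 := h.exp_le_one_add_endpointBound (τ := τ) hU₁0 hu (fun v hv => hb0 v (hsub v hv)) ω
    calc _ ≤ ENNReal.ofReal (1 + endpointBound X τ U₁ ω) := ENNReal.ofReal_le_ofReal h1
      _ ≤ _ := by
        refine ENNReal.ofReal_add_le.trans ?_
        simp
  refine ⟨fun ω => ENNReal.ofReal (endpointBound X τ U₁ ω)
    + ∫⁻ v in Set.Icc 1 U, ENNReal.ofReal (slopeBound X b b₁ t τ ω v), ?_, ?_, ?_⟩
  · have hm : Measurable fun ω => ENNReal.ofReal (endpointBound X τ U₁ ω) := by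
      unfold endpointBound; fun_prop
    exact hm.add (h.measurable_slopeBound htc τ).lintegral_prod_right'
  · rw [lintegral_add_left (by unfold endpointBound; fun_prop), ENNReal.ofReal_add hE0 hE1]
    apply add_le_add
    · apply h.lintegral_endpointBound_le hn hτ hU₁0 hU₁1
      exact h.le_sq hn ha' hU₁1 (fun v hv => hb v (hsub v hv)) U₁ ⟨hU₁0.le, le_rfl⟩
    · rw [h.lintegral_slopeBound htc htpos]
      have hneg : -(2 - a - τ) < 0 := by linarith
      set g : ℝ → ℝ := fun v => n / (4 * (2 - τ)) * (Real.exp 1 * Real.exp (-(2 - a - τ) * v))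
        with hg
      have hgi : IntegrableOn g (Set.Ioi 1) :=
        ((integrableOn_exp_mul_Ioi hneg 1).const_mul _).const_mul _
      have hgI : ∫ v in Set.Ioi 1, g v
          = n / (4 * (2 - τ)) * (Real.exp (a + τ - 1) / (2 - a - τ)) := by
        rw [hg, integral_const_mul, integral_const_mul, integral_exp_mul_Ioi hneg]
        congr 1
        rw [neg_div_neg_eq, ← mul_div_assoc, ← Real.exp_add]
        congr 2; ring
      rw [← hgI, ofReal_integral_eq_lintegral_ofReal hgi
        (Filter.Eventually.of_forall fun v => by simp only [hg, Pi.zero_apply]; positivity),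
        setLIntegral_congr Ioi_ae_eq_Ici]
      refine le_trans (setLIntegral_mono' measurableSet_Icc (g := fun v => ENNReal.ofReal (g v))
        fun v hv => ?_) (lintegral_mono_set Set.Icc_subset_Ici_self)
      apply ENNReal.ofReal_le_ofReal
      have hv1 := hv.1
      have htv : 0 < 2 * v - τ := htpos v hv
      simp only [ht, hg, sub_self]
      have h1 : Real.exp (-v ^ 2 + τ * v)
          ≤ Real.exp 1 * Real.exp (-(2 - τ) * v) := by
        rw [← Real.exp_add]; apply Real.exp_le_exp.2; nlinarith [sq_nonneg (v - 1)]
      have h2 : Real.exp 1 * Real.exp (-(2 - a - τ) * v)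
          = Real.exp 1 * Real.exp (-(2 - τ) * v) * Real.exp (a * v) := by
        rw [mul_assoc (Real.exp 1), ← Real.exp_add (-(2 - τ) * v)]; congr 2; ring
      rw [h2]
      have h3 := hb v ⟨by linarith, hv.2⟩
      have h0 := hb0 v ⟨by linarith, hv.2⟩
      calc (b₂ v + 0 ^ 2) / (4 * (2 * v - τ)) * Real.exp (-v ^ 2 + τ * v)
          ≤ (n * Real.exp (a * v)) / (4 * (2 - τ))
              * (Real.exp 1 * Real.exp (-(2 - τ) * v)) := by
            apply mul_le_mul _ h1 (Real.exp_pos _).le (by positivity)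
            apply div_le_div₀ (by positivity) (by linarith) (by positivity) (by linarith)
        _ = _ := by ring
  · intro ω u hu
    rcases le_or_gt u U₁ with huU | huU
    · refine (hatom ω u ⟨hu.1, huU⟩).trans ?_
      gcongr
      exact le_self_add
    · have hU1 : 1 < U := by
        by_contra hcon
        have : U₁ = U := min_eq_left (not_lt.1 hcon)
        linarith [hu.2]
      have hU₁e : U₁ = 1 := min_eq_right hU1.le
      refine (h.ofReal_exp_le_add_lintegral htpos (hU₁e ▸ huU.le) hu.2 ω).trans ?_
      rw [← add_assoc]
      gcongr
      exact hatom ω 1 ⟨zero_le_one, hU₁e.ge⟩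

end HasCGF

/-! ### Numerical inequalities -/

lemma two_mul_small_le {n a τ : ℝ} (hn : 0 ≤ n) (hn' : n ≤ 0.6) (ha' : a ≤ 0.463)
    (hτ : 0 ≤ τ) (hτ' : τ ≤ 0.541 * n) :
    1 + 2 * ((Real.exp (τ + 0.6 * n) - 1 - τ) / 2
        + n / (4 * (2 - τ)) * (Real.exp (a + τ - 1) / (2 - a - τ))) ≤ Real.exp n := by
  have hτ2 : τ ≤ 0.3246 := by linarith
  have h1 : Real.exp (a + τ - 1) ≤ 0.81 := by
    have h2 : Real.exp (a + τ - 1) ≤ Real.exp (-0.2124) := Real.exp_le_exp.2 (by linarith)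
    have h3 := Real.quadratic_le_exp_of_nonneg (x := 0.2124) (by norm_num)
    have h4 : Real.exp (-0.2124) * Real.exp 0.2124 = 1 := by rw [← Real.exp_add]; norm_num
    nlinarith [Real.exp_pos (-0.2124)]
  have h2 : n / (4 * (2 - τ)) * (Real.exp (a + τ - 1) / (2 - a - τ)) ≤ 0.1 * n := by
    have e1 : n / (4 * (2 - τ)) ≤ n / 6.7016 := by
      apply div_le_div_of_nonneg_left hn (by norm_num) (by linarith)
    have e2 : Real.exp (a + τ - 1) / (2 - a - τ) ≤ 0.81 / 1.2124 := by
      apply div_le_div₀ (by norm_num) h1 (by norm_num) (by linarith)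
    calc _ ≤ n / 6.7016 * (0.81 / 1.2124) := by
          apply mul_le_mul e1 e2 _ (by positivity)
          exact div_nonneg (Real.exp_pos _).le (by linarith)
      _ ≤ 0.1 * n := by rw [div_mul_div_comm, div_le_iff₀ (by norm_num)]; nlinarith
  have h3 : Real.exp (τ + 0.6 * n) - τ ≤ Real.exp (1.141 * n) - 0.541 * n := by
    have e : Real.exp (1.141 * n) = Real.exp (τ + 0.6 * n) * Real.exp (0.541 * n - τ) := by
      rw [← Real.exp_add]; congr 1; ring
    rw [e]
    have := Real.add_one_le_exp (0.541 * n - τ)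
    have : 1 ≤ Real.exp (τ + 0.6 * n) := Real.one_le_exp (by positivity)
    nlinarith
  have h4 : Real.exp (1.141 * n) ≤ Real.exp n + 0.282 * n := by
    have e : Real.exp n = Real.exp (1.141 * n) * Real.exp (-(0.141 * n)) := by
      rw [← Real.exp_add]; congr 1; ring
    have e1 := Real.add_one_le_exp (-(0.141 * n))
    have e2 : Real.exp (1.141 * n) ≤ 2 := by
      rw [← Real.exp_log (by norm_num : (0:ℝ) < 2)]
      apply Real.exp_le_exp.2
      linarith [Real.log_two_gt_d9]
    have := Real.exp_pos (1.141 * n)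
    rw [e]
    nlinarith
  linarith

lemma le_mul_log {η ε : ℝ} (hη : 1 ≤ η) (hε : 0 ≤ ε) (hn : 3 * η * ε ≤ 1) :
    3 * η * ε ≤ (3 * η + 1 / 2) * Real.log (1 + ε) := by
  have h := Real.le_log_one_add_of_nonneg hε
  have h2 : 3 * η * ε ≤ (3 * η + 1 / 2) * (2 * ε / (ε + 2)) := by
    rw [← mul_div_assoc, le_div_iff₀ (by linarith)]
    nlinarith
  refine h2.trans (mul_le_mul_of_nonneg_left h (by linarith))

/-- The loss factor `(3 η + 1 / 2) ε / (1 + ε)`. -/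
def lossFactor (η ε : ℝ) : ℝ := (3 * η + 1 / 2) * (ε / (1 + ε))

lemma lossFactor_nonneg {η ε : ℝ} (hη : 1 ≤ η) (hε : 0 ≤ ε) : 0 ≤ lossFactor η ε := by
  unfold lossFactor; positivity

lemma lossFactor_le {η ε : ℝ} (hη : 1 ≤ η) (hε : 0 ≤ ε) :
    lossFactor η ε ≤ 7 / 6 * (3 * η * ε) := by
  unfold lossFactor
  have : ε / (1 + ε) ≤ ε := div_le_self hε (by linarith)
  nlinarith

lemma lossFactor_le_self {η ε : ℝ} (hε : 0 ≤ ε) (hn : 1 / 2 ≤ 3 * η * ε) :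
    lossFactor η ε ≤ 3 * η * ε := by
  unfold lossFactor
  rw [← mul_div_assoc, div_le_iff₀ (by linarith)]
  nlinarith

lemma lossFactor_le_div {η ε : ℝ} (hη' : η ≤ 3 / 2) (hε : 0 ≤ ε)
    (hn : 1 ≤ 3 * η * ε) :
    lossFactor η ε ≤ 5 * (3 * η * ε) / (3 * η * ε + 4.5) := by
  unfold lossFactor
  rw [← mul_div_assoc, div_le_div_iff₀ (by linarith) (by linarith)]
  have : 0 ≤ ε * (3 - 2 * η) := mul_nonneg hε (by linarith)
  nlinarith [mul_nonneg (mul_nonneg hε (by linarith : (0:ℝ) ≤ 3 - 2 * η)) (by linarith : 0 ≤ 3 * η * ε - 1), mul_nonneg hε (by linarith : 0 ≤ 3 * η * ε - 1)]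

lemma large_le_of_le_one {η ε : ℝ} (hη : 1 ≤ η) (hε : 0 ≤ ε) (hn : 0.6 ≤ 3 * η * ε)
    (hn' : 3 * η * ε ≤ 1) :
    Real.exp (3 / 14 * lossFactor η ε ^ 2) * √(1.61 * (3 * η * ε) + 1.571)
      ≤ Real.exp ((3 * η + 1 / 2) * Real.log (1 + ε)) := by
  have h1 := le_mul_log hη hε hn'
  have h2 := lossFactor_le_self (η := η) hε (by linarith)
  have h0 := lossFactor_nonneg hη hε
  set n := 3 * η * ε
  have h3 : lossFactor η ε ^ 2 ≤ n ^ 2 := by gcongr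
  refine le_trans ?_ (Real.exp_le_exp.2 h1)
  have h4 : √(1.61 * n + 1.571) ≤ Real.exp (n - 3 / 14 * n ^ 2) := by
    rw [Real.sqrt_le_left (Real.exp_pos _).le, ← Real.exp_nat_mul]
    have hy : 0 ≤ 2 * n - 3 / 7 * n ^ 2 := by nlinarith
    have := Real.quadratic_le_exp_of_nonneg hy
    have e : ((2:ℕ) : ℝ) * (n - 3 / 14 * n ^ 2) = 2 * n - 3 / 7 * n ^ 2 := by push_cast; ring
    rw [e]
    refine le_trans ?_ this
    have hm1 : 0 ≤ n - 0.6 := by linarith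
    have hm2 : 0 ≤ 1 - n := by linarith
    nlinarith [mul_nonneg hm1 hm2, mul_nonneg (mul_nonneg hm1 hm2) hm1,
      mul_nonneg (mul_nonneg hm1 hm2) (mul_nonneg hm1 hm2), mul_nonneg (mul_nonneg hm1 hm2) hm2]
  calc _ ≤ Real.exp (3 / 14 * n ^ 2) * Real.exp (n - 3 / 14 * n ^ 2) := by gcongr
    _ = Real.exp n := by rw [← Real.exp_add]; congr 1; ring

lemma large_le_of_one_le {η ε : ℝ} (hη : 1 ≤ η) (hη' : η ≤ 3 / 2) (hε : 0 ≤ ε)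
    (hn : 1 ≤ 3 * η * ε) :
    Real.exp (3 / 14 * lossFactor η ε ^ 2) * √(1.61 * (3 * η * ε) + 1.571)
      ≤ Real.exp ((3 * η + 1 / 2) * Real.log (1 + ε)) := by
  have h1 := lossFactor_le_div hη' hε hn
  have h0 := lossFactor_nonneg hη hε
  have hε1 : 2 * (3 * η * ε) / 9 ≤ ε := by nlinarith
  have hb : Real.log (1 + 3 * η * ε / 3) ≤ η * Real.log (1 + ε) := by
    rw [← Real.log_rpow (by linarith)]
    apply Real.log_le_log (by linarith)
    have := one_add_mul_self_le_rpow_one_add (s := ε) (by linarith) hη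
    linarith
  set n := 3 * η * ε with hndef
  set x := n / (n + 4.5) with hx
  have hx0 : 0 < x := by positivity
  have hx1 : x < 1 := by rw [hx, div_lt_one (by linarith)]; linarith
  have hx2 : 2 / 11 ≤ x := by rw [hx, div_le_div_iff₀ (by norm_num) (by linarith)]; linarith
  have h2 : lossFactor η ε ^ 2 ≤ 25 * x ^ 2 := by
    have : lossFactor η ε ≤ 5 * x := by rw [hx, ← mul_div_assoc]; exact h1
    nlinarith
  have hnx : n = 4.5 * x / (1 - x) := by
    rw [hx]; field_simp; ring
  have hpos : 0 < 1 - x := by linarith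
  have hl1 : Real.log (1 + n / 3) = Real.log (1 + x / 2) - Real.log (1 - x) := by
    rw [← Real.log_div (by positivity) hpos.ne']
    congr 1; rw [hnx]; field_simp; ring
  have hl2 : Real.log (1 + 2 * n / 9) = - Real.log (1 - x) := by
    rw [← Real.log_inv]
    congr 1; rw [hnx]; field_simp; ring
  have hl3 : Real.log (1.61 * n + 1.571) = Real.log (1.571 + 5.674 * x) - Real.log (1 - x) := by
    rw [← Real.log_div (by positivity) hpos.ne']
    congr 1; rw [hnx]; field_simp; ring
  have hl4 : Real.log (1.571 + 5.674 * x) ≤ 0.781 + 1.4185 * x := by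
    have e : Real.log (1.571 + 5.674 * x)
        = Real.log ((1.571 + 5.674 * x) / 4) + 2 * Real.log 2 := by
      rw [Real.log_div (by positivity) (by norm_num), show (4:ℝ) = 2 ^ 2 by norm_num,
        Real.log_pow]
      push_cast; ring
    have := Real.log_le_sub_one_of_pos (x := (1.571 + 5.674 * x) / 4) (by positivity)
    rw [e]
    linarith [Real.log_two_lt_d9]
  have hl5 : x + x ^ 2 / 2 + x ^ 3 / 3 ≤ - Real.log (1 - x) := by
    have h := Real.hasSum_pow_div_log_of_abs_lt_one (x := x) (by rw [abs_of_pos hx0]; exact hx1)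
    have := sum_le_hasSum (Finset.range 3) (fun i _ => by positivity) h
    simp only [Finset.sum_range_succ, Finset.sum_range_zero] at this
    norm_num at this
    linarith
  have hl6 : x / 2 - x ^ 2 / 8 ≤ Real.log (1 + x / 2) := by
    have h := Real.le_log_one_add_of_nonneg (x := x / 2) (by positivity)
    refine le_trans ?_ h
    rw [le_div_iff₀ (by positivity)]
    nlinarith [pow_pos hx0 3]
  have hl7 : Real.log (1 + 2 * n / 9) ≤ Real.log (1 + ε) :=
    Real.log_le_log (by positivity) (by linarith)
  have hsq : √(1.61 * n + 1.571) = Real.exp (Real.log (1.61 * n + 1.571) / 2) := by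
    rw [← Real.log_sqrt (by positivity), Real.exp_log (by positivity)]
  rw [hsq, ← Real.exp_add]
  apply Real.exp_le_exp.2
  have key : 0 ≤ 7.581 * x - 0.781 - (75 / 7 - 2.25) * x ^ 2 + 2 * x ^ 3 := by
    nlinarith [mul_nonneg (sub_nonneg.2 hx2) hpos.le, sq_nonneg (x - 1),
      mul_nonneg (mul_nonneg (sub_nonneg.2 hx2) hpos.le) hpos.le]
  nlinarith

lemma integral_Ioi_mul_exp_neg_sq : ∫ v in Set.Ioi (0 : ℝ), v * Real.exp (-v ^ 2) = 1 / 2 := by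
  have h := integral_rpow_mul_exp_neg_rpow (p := 2) (q := 1) (by norm_num) (by norm_num)
  norm_num at h
  simpa using h

lemma integral_Ioi_sq_mul_exp_neg_sq :
    ∫ v in Set.Ioi (0 : ℝ), v ^ 2 * Real.exp (-v ^ 2) = √Real.pi / 4 := by
  have h := integral_rpow_mul_exp_neg_rpow (p := 2) (q := 2) (by norm_num) (by norm_num)
  rw [show ((2 : ℝ) + 1) / 2 = 1 / 2 + 1 by norm_num, Real.Gamma_add_one (by norm_num),
    Real.Gamma_one_half_eq] at h
  norm_num at h
  rw [h]; ring

namespace HasCGF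

variable {Ω : Type*} {mΩ : MeasurableSpace Ω}
variable {p : Measure Ω} [IsProbabilityMeasure p] {X : Ω → ℝ} {b b₁ b₂ : ℝ → ℝ}

/-- Domination of the likelihood ratio when its variance `n` is not small compared with the
quadratic penalty. -/
lemma exists_dominating_of_large (h : HasCGF p X b b₁ b₂) {n a U : ℝ} (hn : 0 ≤ n)
    (ha' : a ^ 2 ≤ 2 / 7)
    (hb : ∀ v ∈ Set.Icc 0 U, b₂ v ≤ n * Real.exp (a * v)) :
    ∃ F : Ω → ENNReal, Measurable F ∧
      ∫⁻ ω, F ω ∂p ≤ ENNReal.ofReal ((√(1.2075 * n + 1.571) - 1) / 2) ∧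
      ∀ ω, ∀ u ∈ Set.Icc 0 U,
        ENNReal.ofReal (Real.exp (u * X ω - b u - u ^ 2)) ≤ 1 + F ω := by
  set P : ℝ := √Real.pi / 2 with hP
  have hP0 : 0 < P := by positivity
  have hP2 : P ^ 2 = Real.pi / 4 := by rw [hP, div_pow, Real.sq_sqrt Real.pi_pos.le]; norm_num
  set G : ℝ := Real.exp (2 / 7) * (√(Real.pi / (3 / 4)) / 2) with hG
  have hG0 : 0 < G := by positivity
  have hGP : P * G ≤ 1.2075 := by
    have h1 : √(Real.pi / (3 / 4)) = √Real.pi * √(4 / 3) := by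
      rw [← Real.sqrt_mul Real.pi_pos.le]; congr 1; ring
    have h2 : √(4 / 3 : ℝ) ≤ 1.15471 := by
      rw [Real.sqrt_le_left (by norm_num)]; norm_num
    have h3 : Real.exp (2 / 7) ≤ 1.33073 := by
      have := Real.exp_bound' (x := 2 / 7) (by norm_num) (by norm_num) (n := 6) (by norm_num)
      refine this.trans ?_
      simp only [Finset.sum_range_succ, Nat.factorial]
      norm_num
    have h4 : P * G = Real.exp (2 / 7) * √(4 / 3) * (Real.pi / 4) := by
      rw [← hP2, hG, h1, hP]; ring
    have h5 : Real.exp (2 / 7) * √(4 / 3) ≤ 1.33073 * 1.15471 := by gcongr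
    rw [h4]
    calc Real.exp (2 / 7) * √(4 / 3) * (Real.pi / 4) ≤ 1.33073 * 1.15471 * (3.1416 / 4) := by
          gcongr
          exact Real.pi_lt_d4.le
      _ ≤ _ := by norm_num
  set t : ℝ := √((n * G + 2 * P) / P) with ht
  have ht0 : 0 < t := by positivity
  have ht2 : t ^ 2 * P = n * G + 2 * P := by
    rw [ht, Real.sq_sqrt (by positivity)]; field_simp
  have hval : (n * G + t ^ 2 * P - 2 * t + 2 * P) / (4 * t)
      ≤ (√(1.2075 * n + 1.571) - 1) / 2 := by
    have h1 : t * P ≤ √(1.2075 * n + 1.571) := by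
      apply Real.le_sqrt_of_sq_le
      have : (t * P) ^ 2 = n * (P * G) + 2 * P ^ 2 := by
        linear_combination P * ht2
      rw [this, hP2]
      nlinarith [Real.pi_lt_d4]
    rw [div_le_iff₀ (by positivity)]
    nlinarith
  have hm : Measurable fun ω => ∫⁻ v in Set.Icc 0 U,
      ENNReal.ofReal (slopeBound X b b₁ (fun _ => t) 0 ω v) :=
    (h.measurable_slopeBound continuous_const 0).lintegral_prod_right'
  refine ⟨_, hm, ?_, ?_⟩
  · rw [h.lintegral_slopeBound continuous_const fun _ _ => ht0]
    refine le_trans ?_ (ENNReal.ofReal_le_ofReal hval)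
    set g : ℝ → ℝ := fun v => (n * Real.exp (2 / 7) * Real.exp (-(3 / 4) * v ^ 2)
      + t ^ 2 * Real.exp (-1 * v ^ 2) - 4 * t * (v * Real.exp (-v ^ 2))
      + 4 * (v ^ 2 * Real.exp (-v ^ 2))) / (4 * t) with hg
    have i1 : IntegrableOn (fun v : ℝ => n * Real.exp (2 / 7) * Real.exp (-(3 / 4) * v ^ 2))
        (Set.Ioi 0) := ((integrable_exp_neg_mul_sq (by norm_num)).const_mul _).integrableOn
    have i2 : IntegrableOn (fun v : ℝ => t ^ 2 * Real.exp (-1 * v ^ 2)) (Set.Ioi 0) :=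
      ((integrable_exp_neg_mul_sq (by norm_num)).const_mul _).integrableOn
    have i3 : IntegrableOn (fun v : ℝ => 4 * t * (v * Real.exp (-v ^ 2))) (Set.Ioi 0) := by
      have := integrableOn_rpow_mul_exp_neg_mul_sq (b := 1) one_pos (s := 1) (by norm_num)
      simp only [Real.rpow_one, neg_mul, one_mul] at this
      exact this.const_mul _
    have i4 : IntegrableOn (fun v : ℝ => 4 * (v ^ 2 * Real.exp (-v ^ 2))) (Set.Ioi 0) := by
      have := integrableOn_rpow_mul_exp_neg_mul_sq (b := 1) one_pos (s := 2) (by norm_num)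
      simp only [Real.rpow_two, neg_mul, one_mul] at this
      exact this.const_mul _
    have i12 : IntegrableOn (fun v : ℝ => n * Real.exp (2 / 7) * Real.exp (-(3 / 4) * v ^ 2)
      + t ^ 2 * Real.exp (-1 * v ^ 2)) (Set.Ioi 0) := i1.add i2
    have i123 : IntegrableOn (fun v : ℝ => n * Real.exp (2 / 7) * Real.exp (-(3 / 4) * v ^ 2)
      + t ^ 2 * Real.exp (-1 * v ^ 2) - 4 * t * (v * Real.exp (-v ^ 2))) (Set.Ioi 0) := i12.sub i3
    have hgi : IntegrableOn g (Set.Ioi 0) := (i123.add i4).div_const _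
    have hgI : ∫ v in Set.Ioi 0, g v = (n * G + t ^ 2 * P - 2 * t + 2 * P) / (4 * t) := by
      rw [hg, integral_div, integral_add i123 i4, integral_sub i12 i3, integral_add i1 i2,
        integral_const_mul, integral_const_mul, integral_const_mul, integral_const_mul,
        integral_gaussian_Ioi, integral_gaussian_Ioi, integral_Ioi_mul_exp_neg_sq,
        integral_Ioi_sq_mul_exp_neg_sq, hG, hP, div_one]
      ring
    have hle : ∀ v, (n * Real.exp (2 / 7) * Real.exp (-(3 / 4) * v ^ 2)
        + (t - 2 * v) ^ 2 * Real.exp (-v ^ 2)) / (4 * t) = g v := by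
      intro v
      simp only [hg, neg_mul, one_mul]
      ring
    rw [← hgI, ofReal_integral_eq_lintegral_ofReal hgi
      (Filter.Eventually.of_forall fun v => by
        simp only [← hle, Pi.zero_apply]; positivity), setLIntegral_congr Ioi_ae_eq_Ici]
    refine le_trans (setLIntegral_mono' measurableSet_Icc (g := fun v => ENNReal.ofReal (g v))
      fun v hv => ?_) (lintegral_mono_set Set.Icc_subset_Ici_self)
    apply ENNReal.ofReal_le_ofReal
    rw [← hle, div_mul_eq_mul_div]
    apply div_le_div_of_nonneg_right _ (by positivity)
    have e1 : Real.exp (-v ^ 2 + 0 * v) = Real.exp (-v ^ 2) := by simp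
    rw [e1, add_mul]
    simp only [sub_zero]
    apply add_le_add_left
    calc b₂ v * Real.exp (-v ^ 2) ≤ n * Real.exp (a * v) * Real.exp (-v ^ 2) := by
          gcongr
          exact hb v hv
      _ = n * Real.exp (a * v - v ^ 2) := by
          rw [mul_assoc, ← Real.exp_add]; rfl
      _ ≤ n * Real.exp (2 / 7 + -(3 / 4) * v ^ 2) := by
          gcongr
          nlinarith [sq_nonneg (a - v / 2)]
      _ = _ := by rw [Real.exp_add, mul_assoc]
  · intro ω u hu
    have := h.ofReal_exp_le_add_lintegral (τ := 0) (t := fun _ => t) (fun _ _ => ht0) hu.1 hu.2 ω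
    simpa [h.zero] using this

end HasCGF

/-! ### Self-concordance -/

lemma le_mul_exp_of_abs_deriv_le {f : ℝ → ℝ} {R l u : ℝ} (hf : Differentiable ℝ f)
    (h : ∀ z ∈ Set.Icc l u, |deriv f z| ≤ R * f z) {x y : ℝ} (hx : x ∈ Set.Icc l u)
    (hy : y ∈ Set.Icc l u) : f y ≤ f x * Real.exp (R * |y - x|) := by
  have hd : ∀ c v : ℝ, HasDerivAt (fun v => f v * Real.exp (c * v))
      ((deriv f v + c * f v) * Real.exp (c * v)) v := by
    intro c v
    have h1 : HasDerivAt (fun v => c * v) c v := by simpa using (hasDerivAt_id v).const_mul c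
    have := (hf v).hasDerivAt.mul h1.exp
    convert! this using 1
    ring
  rcases le_total x y with hxy | hxy
  · have hanti : AntitoneOn (fun v => f v * Real.exp (-R * v)) (Set.Icc l u) := by
      apply antitoneOn_of_deriv_nonpos (convex_Icc l u)
      · exact fun v _ => (hd _ v).continuousAt.continuousWithinAt
      · exact fun v _ => (hd _ v).differentiableAt.differentiableWithinAt
      · intro v hv
        rw [(hd _ v).deriv]
        have := (abs_le.1 (h v (interior_subset hv))).2
        exact mul_nonpos_of_nonpos_of_nonneg (by linarith) (Real.exp_pos _).le
    have h1 := hanti hx hy hxy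
    simp only at h1
    rw [abs_of_nonneg (sub_nonneg.2 hxy)]
    calc f y = f y * Real.exp (-R * y) * Real.exp (R * y) := by
          rw [mul_assoc, ← Real.exp_add]; simp
      _ ≤ f x * Real.exp (-R * x) * Real.exp (R * y) := by gcongr
      _ = _ := by rw [mul_assoc, ← Real.exp_add]; congr 2; ring
  · have hmono : MonotoneOn (fun v => f v * Real.exp (R * v)) (Set.Icc l u) := by
      apply monotoneOn_of_deriv_nonneg (convex_Icc l u)
      · exact fun v _ => (hd _ v).continuousAt.continuousWithinAt
      · exact fun v _ => (hd _ v).differentiableAt.differentiableWithinAt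
      · intro v hv
        rw [(hd _ v).deriv]
        have := (abs_le.1 (h v (interior_subset hv))).1
        exact mul_nonneg (by linarith) (Real.exp_pos _).le
    have h1 := hmono hy hx hxy
    simp only at h1
    rw [abs_sub_comm, abs_of_nonneg (sub_nonneg.2 hxy)]
    calc f y = f y * Real.exp (R * y) * Real.exp (-R * y) := by
          rw [mul_assoc, ← Real.exp_add]; simp
      _ ≤ f x * Real.exp (R * x) * Real.exp (-R * y) := by gcongr
      _ = _ := by rw [mul_assoc, ← Real.exp_add]; congr 2; ring

/-! ### Exponential families on the line -/

/-- The density `exp ((r z - m z) / g)` of an exponential family. -/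
def expDensity (m : ℝ → ℝ) (g z r : ℝ) : ℝ := Real.exp ((r * z - m z) / g)

/-- The member with natural parameter `z` of the exponential family with base measure `ν`. -/
def expLaw (ν : Measure ℝ) (m : ℝ → ℝ) (g z : ℝ) : Measure ℝ :=
  ν.withDensity fun r => ENNReal.ofReal (expDensity m g z r)

lemma measurable_expDensity (m : ℝ → ℝ) (g z : ℝ) : Measurable (expDensity m g z) := by
  unfold expDensity; fun_prop

lemma lintegral_expLaw (ν : Measure ℝ) (m : ℝ → ℝ) (g z : ℝ) {F : ℝ → ENNReal}
    (hF : Measurable F) :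
    ∫⁻ r, F r ∂(expLaw ν m g z) = ∫⁻ r, ENNReal.ofReal (expDensity m g z r) * F r ∂ν := by
  rw [expLaw, lintegral_withDensity_eq_lintegral_mul _ (measurable_expDensity m g z).ennreal_ofReal
    hF]
  rfl

lemma lintegral_expDensity {ν : Measure ℝ} {m : ℝ → ℝ} {g z : ℝ}
    (h : IsProbabilityMeasure (expLaw ν m g z)) :
    ∫⁻ r, ENNReal.ofReal (expDensity m g z r) ∂ν = 1 := by
  have := h.measure_univ
  rwa [expLaw, withDensity_apply _ MeasurableSet.univ, Measure.restrict_univ] at this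

lemma hasCGF_expLaw {ν : Measure ℝ} {m : ℝ → ℝ} {g : ℝ}
    (hnorm : ∀ z, IsProbabilityMeasure (expLaw ν m g z)) (hm : Differentiable ℝ m)
    (hm' : Differentiable ℝ (link m)) (z₀ s : ℝ) :
    HasCGF (expLaw ν m g z₀) (fun r => s * (r - link m z₀) / g)
      (fun u => (m (z₀ + s * u) - m z₀ - s * u * link m z₀) / g)
      (fun u => s * (link m (z₀ + s * u) - link m z₀) / g)
      (fun u => s ^ 2 * slope m (z₀ + s * u) / g) := by
  have hlin : ∀ u, ∫⁻ r, ENNReal.ofReal (Real.exp (u * (s * (r - link m z₀) / g)))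
      ∂(expLaw ν m g z₀)
      = ENNReal.ofReal (Real.exp ((m (z₀ + s * u) - m z₀ - s * u * link m z₀) / g)) := by
    intro u
    rw [lintegral_expLaw _ _ _ _ (by fun_prop)]
    have e : ∀ r, ENNReal.ofReal (expDensity m g z₀ r)
        * ENNReal.ofReal (Real.exp (u * (s * (r - link m z₀) / g)))
        = ENNReal.ofReal (Real.exp ((m (z₀ + s * u) - m z₀ - s * u * link m z₀) / g))
          * ENNReal.ofReal (expDensity m g (z₀ + s * u) r) := by
      intro r
      rw [expDensity, expDensity, ← ENNReal.ofReal_mul (Real.exp_pos _).le,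
        ← ENNReal.ofReal_mul (Real.exp_pos _).le, ← Real.exp_add, ← Real.exp_add]
      congr 2; ring
    simp only [e]
    rw [lintegral_const_mul _ (measurable_expDensity m g _).ennreal_ofReal,
      lintegral_expDensity (hnorm _), mul_one]
  have hint : ∀ u, Integrable (fun r => Real.exp (u * (s * (r - link m z₀) / g)))
      (expLaw ν m g z₀) := by
    intro u
    refine ⟨by fun_prop, ?_⟩
    rw [hasFiniteIntegral_iff_ofReal (Filter.Eventually.of_forall fun _ => (Real.exp_pos _).le),
      hlin]
    exact ENNReal.ofReal_lt_top
  have haff : ∀ u, HasDerivAt (fun u => z₀ + s * u) s u := fun u => by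
    simpa using ((hasDerivAt_id u).const_mul s).const_add z₀
  refine ⟨by fun_prop, hint, ?_, ?_, ?_, by simp⟩
  · intro u
    rw [integral_eq_lintegral_of_nonneg_ae
      (Filter.Eventually.of_forall fun _ => (Real.exp_pos _).le) (by fun_prop), hlin,
      ENNReal.toReal_ofReal (Real.exp_pos _).le]
  · intro u
    have h1 : HasDerivAt m (link m (z₀ + s * u)) (z₀ + s * u) := (hm _).hasDerivAt
    have h2 : HasDerivAt (fun u => m (z₀ + s * u)) (link m (z₀ + s * u) * s) u :=
      HasDerivAt.comp u h1 (haff u)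
    have h3 : HasDerivAt (fun u => s * u * link m z₀) (s * link m z₀) u := by
      simpa using ((hasDerivAt_id u).const_mul s).mul_const (link m z₀)
    have h4 := ((h2.sub_const (m z₀)).sub h3).div_const g
    convert! h4 using 1
    ring
  · intro u
    have h1 : HasDerivAt (link m) (slope m (z₀ + s * u)) (z₀ + s * u) := (hm' _).hasDerivAt
    have h2 : HasDerivAt (fun u => link m (z₀ + s * u)) (slope m (z₀ + s * u) * s) u :=
      HasDerivAt.comp u h1 (haff u)
    have h4 := ((h2.sub_const (link m z₀)).const_mul s).div_const g
    convert! h4 using 1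
    ring

/-- Replacing the curvature `ε` by at least `ε exp (-x)` lowers the logarithmic potential by at
most a linear term. -/
lemma potential_ge {η ε ε' x : ℝ} (hη : 1 ≤ η) (hε : 0 ≤ ε) (h : ε * Real.exp (-x) ≤ ε') :
    (3 * η + 1 / 2) * Real.log (1 + ε) - lossFactor η ε * x
      ≤ (3 * η + 1 / 2) * Real.log (1 + ε') := by
  have hε1 : 0 < 1 + ε := by linarith
  set ρ := ε / (1 + ε) with hρ
  have hρ0 : 0 ≤ ρ := by positivity
  have hρ1 : ρ ≤ 1 := by rw [hρ, div_le_one hε1]; linarith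
  have h1 := convexOn_exp.2 (Set.mem_univ 0) (Set.mem_univ (-x)) (sub_nonneg.2 hρ1) hρ0 (by ring)
  simp only [smul_eq_mul, mul_zero, zero_add, Real.exp_zero] at h1
  have h2 : Real.exp (ρ * -x) * (1 + ε) ≤ 1 + ε' := by
    have e : (1 - ρ + ρ * Real.exp (-x)) * (1 + ε) = 1 + ε * Real.exp (-x) := by
      rw [hρ]; field_simp; ring
    nlinarith
  have h3 : Real.log (1 + ε) - ρ * x ≤ Real.log (1 + ε') := by
    rw [← Real.log_exp (ρ * -x)] at *
    have := Real.log_le_log (by positivity) h2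
    rw [Real.log_mul (Real.exp_pos _).ne' hε1.ne', Real.log_exp] at this
    rw [Real.log_exp] at this
    linarith
  unfold lossFactor
  have : 0 ≤ 3 * η + 1 / 2 := by linarith
  nlinarith

/-- The penalized log-likelihood ratio of the natural parameter `z` against `z₀`. -/
def penalizedLik (m : ℝ → ℝ) (g η s₂ z₀ z r : ℝ) : ℝ :=
  ((r * z - m z) - (r * z₀ - m z₀)) / g - (z - z₀) ^ 2 / (3 * η * s₂)
    - (3 * η + 1 / 2) * Real.log (1 + slope m z * s₂ / g)

/-- Dominating functions for the two directions combine to a dominating function for the penalized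
log-likelihood ratio. -/
lemma exists_dominating_of_directions {p : Measure ℝ} [IsProbabilityMeasure p]
    {f : ℝ → ℝ → ℝ} {A z₀ k l κ E N : ℝ} {B : ℝ → ℝ → ℝ → ℝ} (hk : 0 < k)
    (hE : 0 ≤ E)
    (hdir : ∀ s U : ℝ, s ^ 2 = k ^ 2 → (∀ v ∈ Set.Icc 0 U, z₀ + s * v ∈ Set.Icc (-A) A) →
      ∃ F : ℝ → ENNReal, Measurable F ∧ ∫⁻ r, F r ∂p ≤ ENNReal.ofReal E ∧
        ∀ r, ∀ u ∈ Set.Icc 0 U, ENNReal.ofReal (Real.exp (B s u r)) ≤ 1 + F r)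
    (hf : ∀ s u r : ℝ, s ^ 2 = k ^ 2 → 0 ≤ u → z₀ + s * u ∈ Set.Icc (-A) A →
      f (z₀ + s * u) r ≤ B s u r - l + κ)
    (hEN : 1 + 2 * E ≤ N) (hN : Real.exp κ * N ≤ Real.exp l) (hz₀ : z₀ ∈ Set.Icc (-A) A) :
    ∃ F : ℝ → ENNReal, Measurable F ∧ ∫⁻ r, F r ∂p ≤ 1 ∧
      ∀ r, ∀ z ∈ Set.Icc (-A) A, ENNReal.ofReal (Real.exp (f z r)) ≤ F r := by
  obtain ⟨F₁, hF₁, hI₁, hB₁⟩ := hdir k ((A - z₀) / k) rfl (by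
    intro v hv
    have : k * v ≤ A - z₀ := by
      have := (le_div_iff₀ hk).1 hv.2
      linarith
    have := mul_nonneg hk.le hv.1
    exact ⟨by linarith [hz₀.1], by linarith⟩)
  obtain ⟨F₂, hF₂, hI₂, hB₂⟩ := hdir (-k) ((A + z₀) / k) (by ring) (by
    intro v hv
    have : k * v ≤ A + z₀ := by
      have := (le_div_iff₀ hk).1 hv.2
      linarith
    have := mul_nonneg hk.le hv.1
    exact ⟨by linarith, by linarith [hz₀.2]⟩)
  refine ⟨fun r => ENNReal.ofReal (Real.exp (κ - l)) * (1 + F₁ r + F₂ r), by fun_prop, ?_, ?_⟩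
  · rw [lintegral_const_mul _ (by fun_prop), lintegral_add_right _ hF₂,
      lintegral_add_right _ hF₁]
    simp only [lintegral_const, measure_univ, mul_one]
    calc _ ≤ ENNReal.ofReal (Real.exp (κ - l)) * (1 + ENNReal.ofReal E + ENNReal.ofReal E) := by
          gcongr
      _ = ENNReal.ofReal (Real.exp (κ - l) * (1 + 2 * E)) := by
          rw [ENNReal.ofReal_mul (Real.exp_pos _).le, two_mul, ← add_assoc,
            ENNReal.ofReal_add (by positivity) hE, ENNReal.ofReal_add zero_le_one hE,
            ENNReal.ofReal_one]
      _ ≤ 1 := by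
          rw [ENNReal.ofReal_le_one, Real.exp_sub, div_mul_eq_mul_div, div_le_one (Real.exp_pos _)]
          refine le_trans ?_ hN
          gcongr
  · have key : ∀ s u r : ℝ, s ^ 2 = k ^ 2 → 0 ≤ u → z₀ + s * u ∈ Set.Icc (-A) A →
        ENNReal.ofReal (Real.exp (f (z₀ + s * u) r))
          ≤ ENNReal.ofReal (Real.exp (κ - l)) * ENNReal.ofReal (Real.exp (B s u r)) := by
      intro s u r hs hu hz
      rw [← ENNReal.ofReal_mul (Real.exp_pos _).le, ← Real.exp_add]
      apply ENNReal.ofReal_le_ofReal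
      apply Real.exp_le_exp.2
      linarith [hf s u r hs hu hz]
    intro r z hz
    rcases le_total z₀ z with h | h
    · have e : z₀ + k * ((z - z₀) / k) = z := by field_simp; ring
      have hu : (z - z₀) / k ∈ Set.Icc 0 ((A - z₀) / k) :=
        ⟨div_nonneg (by linarith) hk.le, by gcongr; exact hz.2⟩
      have := key k _ r rfl hu.1 (e.symm ▸ hz)
      rw [e] at this
      exact this.trans (mul_le_mul' le_rfl ((hB₁ r _ hu).trans le_self_add))
    · have e : z₀ + -k * ((z₀ - z) / k) = z := by field_simp; ring
      have hu : (z₀ - z) / k ∈ Set.Icc 0 ((A + z₀) / k) :=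
        ⟨div_nonneg (by linarith) hk.le, by gcongr; linarith [hz.1]⟩
      have := key (-k) _ r (by ring) hu.1 (e.symm ▸ hz)
      rw [e] at this
      refine this.trans (mul_le_mul' le_rfl ((hB₂ r _ hu).trans ?_))
      rw [add_right_comm]
      exact le_self_add

variable {ν : Measure ℝ} {m : ℝ → ℝ} {g A R η s₂ z₀ : ℝ}

/-- The maximal penalized likelihood ratio over an interval on which the family is
self-concordant has expectation at most one. -/
theorem exists_dominating_penalizedLik
    (hnorm : ∀ z, IsProbabilityMeasure (expLaw ν m g z)) (hm : Differentiable ℝ m)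
    (hm' : Differentiable ℝ (link m)) (hm'' : Differentiable ℝ (slope m)) (hg : 0 < g)
    (hR : 0 ≤ R) (hη : 1 ≤ η) (hz₀ : z₀ ∈ Set.Icc (-A) A)
    (hpos : ∀ z ∈ Set.Icc (-A) A, 0 ≤ slope m z)
    (hsc : ∀ z ∈ Set.Icc (-A) A, |deriv (slope m) z| ≤ R * slope m z) (hs₂ : 0 < s₂)
    (h1 : 14 * η * R ^ 2 * s₂ ≤ 1) (h2 : 6 * η * (η - 1) * (slope m z₀ * s₂ / g) ≤ 1) :
    ∃ F : ℝ → ENNReal, Measurable F ∧ ∫⁻ r, F r ∂(expLaw ν m g z₀) ≤ 1 ∧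
      ∀ r, ∀ z ∈ Set.Icc (-A) A,
        ENNReal.ofReal (Real.exp (penalizedLik m g η s₂ z₀ z r)) ≤ F r := by
  have := hnorm z₀
  set ε := slope m z₀ * s₂ / g with hεdef
  have hε : 0 ≤ ε := by have := hpos z₀ hz₀; positivity
  set ℓ := (3 * η + 1 / 2) * Real.log (1 + ε) with hℓ
  set Λ := lossFactor η ε with hΛ
  have hΛ0 : 0 ≤ Λ := lossFactor_nonneg hη hε
  have hgrow : ∀ s v : ℝ, 0 ≤ v → z₀ + s * v ∈ Set.Icc (-A) A →
      slope m (z₀ + s * v) ≤ slope m z₀ * Real.exp (R * |s| * v) ∧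
      slope m z₀ * Real.exp (-(R * |s| * v)) ≤ slope m (z₀ + s * v) := by
    intro s v hv hz
    have e : R * |z₀ + s * v - z₀| = R * |s| * v := by
      rw [add_sub_cancel_left, abs_mul, abs_of_nonneg hv]; ring
    have a1 := le_mul_exp_of_abs_deriv_le hm'' hsc hz₀ hz
    have a2 := le_mul_exp_of_abs_deriv_le hm'' hsc hz hz₀
    rw [abs_sub_comm, e] at a2
    rw [e] at a1
    refine ⟨a1, ?_⟩
    rw [Real.exp_neg, ← div_eq_mul_inv, div_le_iff₀ (Real.exp_pos _)]
    exact a2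
  have hpot : ∀ s v : ℝ, 0 ≤ v → z₀ + s * v ∈ Set.Icc (-A) A →
      ℓ - Λ * (R * |s| * v)
        ≤ (3 * η + 1 / 2) * Real.log (1 + slope m (z₀ + s * v) * s₂ / g) := by
    intro s v hv hz
    apply potential_ge hη hε
    rw [hεdef, div_mul_eq_mul_div, mul_right_comm]
    gcongr
    exact (hgrow s v hv hz).2
  rcases le_or_gt (3 * η * ε) 0.6 with hn | hn
  · set k := √(3 * η * s₂) with hk
    have hk0 : 0 < k := by positivity
    have hk2 : k ^ 2 = 3 * η * s₂ := Real.sq_sqrt (by positivity)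
    set a := R * k with ha
    have ha0 : 0 ≤ a := by positivity
    have ha2 : a ≤ 0.463 := by
      apply le_of_sq_le_sq _ (by norm_num)
      rw [ha, mul_pow, hk2]; nlinarith
    set τ := Λ * a with hτ
    have hτ0 : 0 ≤ τ := by positivity
    have hτ1 : τ ≤ 0.541 * (3 * η * ε) := by
      have := lossFactor_le hη hε
      calc τ ≤ 7 / 6 * (3 * η * ε) * 0.463 := by
            rw [hτ]; gcongr
        _ ≤ _ := by nlinarith [mul_nonneg (by linarith : 0 ≤ η) hε]
    have hn0 : 0 ≤ 3 * η * ε := by positivity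
    have hsmall := two_mul_small_le hn0 hn ha2 hτ0 hτ1
    have habs : ∀ s : ℝ, s ^ 2 = k ^ 2 → R * |s| = a := by
      intro s hs
      rw [ha, (sq_eq_sq_iff_abs_eq_abs s k).1 hs, abs_of_pos hk0]
    refine exists_dominating_of_directions (f := penalizedLik m g η s₂ z₀) (k := k) (l := ℓ)
      (κ := 0) (N := Real.exp (3 * η * ε)) (B := fun s u r =>
        u * (s * (r - link m z₀) / g) - (m (z₀ + s * u) - m z₀ - s * u * link m z₀) / g
          - u ^ 2 + τ * u) hk0 ?_ ?_ ?_ hsmall ?_ hz₀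
    · have t1 : 0 ≤ Real.exp (τ + 0.6 * (3 * η * ε)) - 1 - τ := by
        linarith [Real.add_one_le_exp (τ + 0.6 * (3 * η * ε))]
      have t2 : 0 < 2 - τ := by linarith
      have t3 : 0 < 2 - a - τ := by linarith
      positivity
    · intro s U hs hU
      rcases lt_or_ge U 0 with hU0 | hU0
      · refine ⟨fun _ => 0, measurable_const, by simp, ?_⟩
        intro r u hu
        exact absurd (hu.1.trans hu.2) (not_le.2 hU0)
      apply (hasCGF_expLaw hnorm hm hm' z₀ s).exists_dominating_of_small hn0 ha0 ha2 hτ0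
        (by linarith) hU0
      · intro v hv
        have := hpos _ (hU v hv)
        positivity
      · intro v hv
        have h3 := (hgrow s v hv.1 (hU v hv)).1
        rw [habs s hs] at h3
        rw [hs, hk2, div_le_iff₀ hg]
        calc 3 * η * s₂ * slope m (z₀ + s * v)
            ≤ 3 * η * s₂ * (slope m z₀ * Real.exp (a * v)) := by gcongr
          _ = _ := by rw [hεdef]; field_simp
    · intro s u r hs hu hz
      have h3 := hpot s u hu hz
      rw [habs s hs] at h3
      unfold penalizedLik
      have e1 : (z₀ + s * u - z₀) ^ 2 / (3 * η * s₂) = u ^ 2 := by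
        rw [add_sub_cancel_left, mul_pow, hs, hk2]; field_simp
      have e2 : (r * (z₀ + s * u) - m (z₀ + s * u) - (r * z₀ - m z₀)) / g
          = u * (s * (r - link m z₀) / g)
            - (m (z₀ + s * u) - m z₀ - s * u * link m z₀) / g := by ring
      rw [e1, e2]
      have e3 : Λ * (a * u) = τ * u := by rw [hτ]; ring
      linarith
    · rw [Real.exp_zero, one_mul]
      exact Real.exp_le_exp.2 (le_mul_log hη hε (by linarith))
  · set k := √(4 * η * s₂) with hk
    have hk0 : 0 < k := by positivity
    have hk2 : k ^ 2 = 4 * η * s₂ := Real.sq_sqrt (by positivity)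
    set a := R * k with ha
    have ha0 : 0 ≤ a := by positivity
    have ha2 : a ^ 2 ≤ 2 / 7 := by rw [ha, mul_pow, hk2]; nlinarith
    have hn0 : 0 ≤ 4 * η * ε := by positivity
    have habs : ∀ s : ℝ, s ^ 2 = k ^ 2 → R * |s| = a := by
      intro s hs
      rw [ha, (sq_eq_sq_iff_abs_eq_abs s k).1 hs, abs_of_pos hk0]
    have hlarge : Real.exp (3 / 14 * Λ ^ 2) * √(1.61 * (3 * η * ε) + 1.571) ≤ Real.exp ℓ := by
      rcases le_total (3 * η * ε) 1 with hn1 | hn1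
      · exact large_le_of_le_one hη hε hn.le hn1
      · exact large_le_of_one_le hη (by nlinarith) hε hn1
    refine exists_dominating_of_directions (f := penalizedLik m g η s₂ z₀) (k := k) (l := ℓ)
      (κ := 3 / 14 * Λ ^ 2) (N := √(1.61 * (3 * η * ε) + 1.571)) (B := fun s u r =>
        u * (s * (r - link m z₀) / g) - (m (z₀ + s * u) - m z₀ - s * u * link m z₀) / g
          - u ^ 2) (E := (√(1.2075 * (4 * η * ε) + 1.571) - 1) / 2) hk0 ?_ ?_ ?_ ?_ hlarge hz₀
    · have : 1 ≤ √(1.2075 * (4 * η * ε) + 1.571) := Real.one_le_sqrt.2 (by linarith)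
      linarith
    · intro s U hs hU
      apply (hasCGF_expLaw hnorm hm hm' z₀ s).exists_dominating_of_large hn0 ha2
      intro v hv
      have h3 := (hgrow s v hv.1 (hU v hv)).1
      rw [habs s hs] at h3
      rw [hs, hk2, div_le_iff₀ hg]
      calc 4 * η * s₂ * slope m (z₀ + s * v)
          ≤ 4 * η * s₂ * (slope m z₀ * Real.exp (a * v)) := by gcongr
        _ = _ := by rw [hεdef]; field_simp
    · intro s u r hs hu hz
      have h3 := hpot s u hu hz
      rw [habs s hs] at h3
      unfold penalizedLik
      have e1 : (z₀ + s * u - z₀) ^ 2 / (3 * η * s₂) = 4 / 3 * u ^ 2 := by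
        rw [add_sub_cancel_left, mul_pow, hs, hk2]; field_simp
      have e2 : (r * (z₀ + s * u) - m (z₀ + s * u) - (r * z₀ - m z₀)) / g
          = u * (s * (r - link m z₀) / g)
            - (m (z₀ + s * u) - m z₀ - s * u * link m z₀) / g := by ring
      rw [e1, e2]
      have e3 : Λ * (a * u) ≤ 1 / 3 * u ^ 2 + 3 / 14 * Λ ^ 2 := by
        have e4 : (Λ * a) ^ 2 ≤ 2 / 7 * Λ ^ 2 := by
          rw [mul_pow]; nlinarith [sq_nonneg Λ]
        nlinarith [sq_nonneg (2 * u - 3 * (Λ * a))]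
      linarith
    · have : 1.2075 * (4 * η * ε) + 1.571 = 1.61 * (3 * η * ε) + 1.571 := by ring
      rw [this]; linarith

/-! ### A maximal inequality for products of conditional e-values -/

section Ville

variable {Ω : Type*} {mΩ : MeasurableSpace Ω}

/-- The running product of `W 1, W 2, …`, stopped when it reaches the level `c`. -/
def stoppedProd (W : ℕ → Ω → ENNReal) (c : ENNReal) : ℕ → Ω → ENNReal
  | 0 => fun _ => 1
  | t + 1 => fun ω => if stoppedProd W c t ω < c then stoppedProd W c t ω * W (t + 1) ω
      else stoppedProd W c t ω

lemma measurable_stoppedProd {𝓖 : Filtration ℕ mΩ} {T : ℕ} {W : ℕ → Ω → ENNReal}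
    (hW : ∀ t ∈ Set.Icc 1 T, Measurable[𝓖 (t + 1)] (W t)) (c : ENNReal) :
    ∀ t ≤ T, Measurable[𝓖 (t + 1)] (stoppedProd W c t)
  | 0, _ => measurable_const
  | t + 1, ht => by
    have ih : Measurable[𝓖 (t + 1 + 1)] (stoppedProd W c t) :=
      (measurable_stoppedProd hW c t (by lia)).mono (𝓖.mono (by lia)) le_rfl
    have hW' := hW (t + 1) ⟨by lia, ht⟩
    exact Measurable.ite (measurableSet_lt ih measurable_const) (ih.mul hW') ih

lemma lintegral_stoppedProd_le {P : Measure Ω} [IsProbabilityMeasure P] {𝓖 : Filtration ℕ mΩ}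
    {T : ℕ} {W : ℕ → Ω → ENNReal}
    (hW : ∀ t ∈ Set.Icc 1 T, Measurable[𝓖 (t + 1)] (W t))
    (hstep : ∀ t ∈ Set.Icc 1 T, ∀ φ : Ω → ENNReal, Measurable[𝓖 t] φ →
      ∫⁻ ω, φ ω * W t ω ∂P ≤ ∫⁻ ω, φ ω ∂P) (c : ENNReal) :
    ∀ t ≤ T, ∫⁻ ω, stoppedProd W c t ω ∂P ≤ 1
  | 0, _ => by simp [stoppedProd]
  | t + 1, ht => by
    have ih := lintegral_stoppedProd_le hW hstep c t (by lia)
    have hN : Measurable[𝓖 (t + 1)] (stoppedProd W c t) := measurable_stoppedProd hW c t (by lia)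
    set N := stoppedProd W c t with hNdef
    have hS : MeasurableSet[𝓖 (t + 1)] {ω | N ω < c} := measurableSet_lt hN measurable_const
    set φ₁ := {ω | N ω < c}.indicator N with hφ₁
    set φ₂ := {ω | N ω < c}ᶜ.indicator N with hφ₂
    have m₁ : Measurable[𝓖 (t + 1)] φ₁ := hN.indicator hS
    have m₂ : Measurable[𝓖 (t + 1)] φ₂ := hN.indicator hS.compl
    have e1 : ∀ ω, stoppedProd W c (t + 1) ω = φ₁ ω * W (t + 1) ω + φ₂ ω := by
      intro ω
      by_cases h : N ω < c
      · simp [stoppedProd, hφ₁, hφ₂, ← hNdef, h]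
      · simp [stoppedProd, hφ₁, hφ₂, ← hNdef, h]
    have e2 : ∀ ω, φ₁ ω + φ₂ ω = N ω := fun ω => by
      by_cases h : N ω < c <;> simp [hφ₁, hφ₂, h]
    have m₂' : Measurable φ₂ := m₂.mono (𝓖.le _) le_rfl
    calc ∫⁻ ω, stoppedProd W c (t + 1) ω ∂P
        = ∫⁻ ω, φ₁ ω * W (t + 1) ω ∂P + ∫⁻ ω, φ₂ ω ∂P := by
          simp only [e1]
          rw [lintegral_add_right _ m₂']
      _ ≤ ∫⁻ ω, φ₁ ω ∂P + ∫⁻ ω, φ₂ ω ∂P := by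
          exact add_le_add (hstep (t + 1) ⟨by lia, ht⟩ φ₁ m₁) le_rfl
      _ = ∫⁻ ω, N ω ∂P := by
          rw [← lintegral_add_right _ m₂']
          simp only [e2]
      _ ≤ 1 := ih

lemma le_stoppedProd_of_le {W : ℕ → Ω → ENNReal} {c : ENNReal} {ω : Ω} {s : ℕ}
    (h : c ≤ stoppedProd W c s ω) : ∀ k, c ≤ stoppedProd W c (s + k) ω
  | 0 => h
  | k + 1 => by
    have ih := le_stoppedProd_of_le h k
    rw [← add_assoc]
    simp only [stoppedProd]
    rwa [if_neg (not_lt.2 ih)]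

lemma prod_eq_stoppedProd {W : ℕ → Ω → ENNReal} {c : ENNReal} {ω : Ω} {T : ℕ}
    (h : stoppedProd W c T ω < c) : ∀ t ≤ T,
      stoppedProd W c t ω = ∏ s ∈ Finset.Icc 1 t, W s ω
  | 0, _ => by simp [stoppedProd]
  | t + 1, ht => by
    have ih := prod_eq_stoppedProd h t (by lia)
    have hlt : stoppedProd W c t ω < c := by
      by_contra hcon
      have := le_stoppedProd_of_le (not_lt.1 hcon) (T - t)
      rw [show t + (T - t) = T by lia] at this
      exact absurd h (not_lt.2 this)
    rw [Finset.prod_Icc_succ_top (by lia), ← ih]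
    simp only [stoppedProd]
    rw [if_pos hlt]

/-- Ville's inequality for a product of conditional e-values over a finite horizon. -/
theorem exists_measurableSet_prod_lt {P : Measure Ω} [IsProbabilityMeasure P]
    {𝓖 : Filtration ℕ mΩ} {T : ℕ} {W : ℕ → Ω → ENNReal}
    (hW : ∀ t ∈ Set.Icc 1 T, Measurable[𝓖 (t + 1)] (W t))
    (hstep : ∀ t ∈ Set.Icc 1 T, ∀ φ : Ω → ENNReal, Measurable[𝓖 t] φ →
      ∫⁻ ω, φ ω * W t ω ∂P ≤ ∫⁻ ω, φ ω ∂P) {δ : ℝ} (hδ : 0 < δ) :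
    ∃ A : Set Ω, MeasurableSet A ∧ 1 - δ ≤ P.real A ∧
      ∀ ω ∈ A, ∀ t ≤ T, ∏ s ∈ Finset.Icc 1 t, W s ω < ENNReal.ofReal (1 / δ) := by
  set c := ENNReal.ofReal (1 / δ) with hc
  have hc0 : c ≠ 0 := by simp [hc, hδ]
  have hm : Measurable (stoppedProd W c T) :=
    (measurable_stoppedProd hW c T le_rfl).mono (𝓖.le _) le_rfl
  have hA : MeasurableSet {ω | stoppedProd W c T ω < c} := measurableSet_lt hm measurable_const
  refine ⟨_, hA, ?_, ?_⟩
  · have h1 : P {ω | c ≤ stoppedProd W c T ω} ≤ ENNReal.ofReal δ := by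
      refine (meas_ge_le_lintegral_div hm.aemeasurable hc0 ENNReal.ofReal_ne_top).trans ?_
      refine (ENNReal.div_le_div_right (lintegral_stoppedProd_le hW hstep c T le_rfl) c).trans ?_
      rw [hc, one_div, one_div, ENNReal.ofReal_inv_of_pos hδ, inv_inv]
    have h2 : {ω | c ≤ stoppedProd W c T ω} = {ω | stoppedProd W c T ω < c}ᶜ := by
      ext ω; simp
    rw [h2] at h1
    have h3 : P.real {ω | stoppedProd W c T ω < c}ᶜ ≤ δ := by
      rw [measureReal_def]
      exact ENNReal.toReal_le_of_le_ofReal hδ.le h1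
    rw [probReal_compl_eq_one_sub hA] at h3
    linarith
  · intro ω hω t ht
    rw [← prod_eq_stoppedProd hω t ht]
    by_contra hcon
    have := le_stoppedProd_of_le (not_lt.1 hcon) (T - t)
    rw [show t + (T - t) = T by lia] at this
    exact absurd hω (not_lt.2 this)

end Ville

/-! ### Conditioning on the past -/

/-- The laws `expLaw ν m g z` as a Markov kernel in the parameter `z`. -/
def expKernel (ν : Measure ℝ) (m : ℝ → ℝ) (g : ℝ)
    [IsProbabilityMeasure (expLaw ν m g 0)] : Kernel ℝ ℝ :=
  Kernel.withDensity (Kernel.const ℝ (expLaw ν m g 0))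
    fun z r => ENNReal.ofReal (Real.exp ((r * z - m z + m 0) / g))

lemma expKernel_apply {ν : Measure ℝ} {m : ℝ → ℝ} {g : ℝ}
    [IsProbabilityMeasure (expLaw ν m g 0)] (hm : Measurable m) (z : ℝ) :
    expKernel ν m g z = expLaw ν m g z := by
  have hmeas : Measurable (Function.uncurry fun z r : ℝ =>
      ENNReal.ofReal (Real.exp ((r * z - m z + m 0) / g))) := by
    unfold Function.uncurry; fun_prop
  rw [expKernel, Kernel.withDensity_apply _ hmeas, Kernel.const_apply]
  have h1 : Measurable fun r : ℝ => ENNReal.ofReal (expDensity m g 0 r) :=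
    (measurable_expDensity (m := m) (g := g) (z := 0)).ennreal_ofReal
  have h2 : Measurable fun r : ℝ =>
      ENNReal.ofReal (Real.exp ((r * z - m z + m 0) / g)) := by fun_prop
  unfold expLaw
  rw [← withDensity_mul _ h1 h2]
  congr 1
  ext r
  simp only [Pi.mul_apply]
  unfold expDensity
  rw [← ENNReal.ofReal_mul (Real.exp_pos _).le]
  rw [← Real.exp_add]
  congr 2
  ring

/-- If, given `𝓕`, the variable `r` has law `expLaw ν m g z`, then `𝓕`-measurable quantities may be
frozen when integrating `r` out. -/
theorem lintegral_comp_eq_of_condLaw {Ω E : Type*} [MeasurableSpace E]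
    {𝓕 mΩ : MeasurableSpace Ω} {P : Measure Ω} [IsProbabilityMeasure P] (h𝓕 : 𝓕 ≤ mΩ)
    {ν : Measure ℝ} {m : ℝ → ℝ} {g : ℝ}
    (hnorm : ∀ z, IsProbabilityMeasure (expLaw ν m g z)) (hm : Measurable m)
    {z : Ω → ℝ} (hz : Measurable[𝓕] z) {Y : Ω → E} (hY : Measurable[𝓕] Y)
    {r : Ω → ℝ} (hr : Measurable r)
    (hlaw : ∀ B : Set ℝ, MeasurableSet B →
      P[(r ⁻¹' B).indicator (fun _ => (1 : ℝ)) | 𝓕] =ᵐ[P] fun ω => (expLaw ν m g (z ω)).real B)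
    {F : E × ℝ → ENNReal} (hF : Measurable F) :
    ∫⁻ ω, F (Y ω, r ω) ∂P = ∫⁻ ω, ∫⁻ s, F (Y ω, s) ∂(expLaw ν m g (z ω)) ∂P := by
  have hz' : Measurable z := hz.mono h𝓕 le_rfl
  have hY' : Measurable Y := hY.mono h𝓕 le_rfl
  have := hnorm 0
  have hker := expKernel_apply (ν := ν) (g := g) hm
  have hK : IsMarkovKernel (expKernel ν m g) := ⟨fun w => by rw [hker]; exact hnorm w⟩
  let κ : Kernel (E × ℝ) ℝ := (expKernel ν m g).comap Prod.snd measurable_snd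
  have hκ : IsMarkovKernel κ := inferInstance
  let Y' : Ω → E × ℝ := fun ω => (Y ω, z ω)
  have hY'' : Measurable[𝓕] Y' := hY.prodMk hz
  have hYm : Measurable Y' := hY'.prodMk hz'
  have hPm : IsProbabilityMeasure (P.map Y') := Measure.isProbabilityMeasure_map hYm.aemeasurable
  have key : P.map (fun ω => (Y' ω, r ω)) = (P.map Y') ⊗ₘ κ := by
    have : IsProbabilityMeasure (P.map (fun ω => (Y' ω, r ω))) :=
      Measure.isProbabilityMeasure_map (hYm.prodMk hr).aemeasurable
    refine Measure.ext_prod fun {s B} hs hB => ?_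
    rw [Measure.map_apply (hYm.prodMk hr) (hs.prod hB), Measure.compProd_apply_prod hs hB,
      setLIntegral_map hs (Kernel.measurable_coe κ hB) hYm]
    have hS : MeasurableSet[𝓕] (Y' ⁻¹' s) := hY'' hs
    have hS' : MeasurableSet (Y' ⁻¹' s) := h𝓕 _ hS
    have hB' : MeasurableSet (r ⁻¹' B) := hr hB
    have hint : Integrable ((r ⁻¹' B).indicator (fun _ => (1 : ℝ))) P :=
      (integrable_const 1).indicator hB'
    have h1 := setIntegral_condExp h𝓕 hint hS
    rw [integral_indicator_const (1 : ℝ) hB', smul_eq_mul, mul_one, measureReal_restrict_apply hB',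
      setIntegral_congr_ae hS' ((hlaw B hB).mono fun ω h _ => h)] at h1
    have h2 : ∀ ω, (expLaw ν m g (z ω)).real B = (κ (Y' ω) B).toReal := fun ω => by
      simp only [κ, Y', Kernel.comap_apply, hker, measureReal_def]
    simp only [h2] at h1
    rw [integral_toReal (f := fun ω => κ (Y' ω) B)
      (((Kernel.measurable_coe κ hB).comp hYm).aemeasurable) (Filter.Eventually.of_forall fun ω => measure_lt_top _ _), measureReal_def,
      ENNReal.toReal_eq_toReal_iff' ?_ (measure_ne_top _ _)] at h1
    · rw [show (fun ω => (Y' ω, r ω)) ⁻¹' s ×ˢ B = r ⁻¹' B ∩ Y' ⁻¹' s by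
        ext ω; simp [and_comm]]
      exact h1.symm
    · refine ne_of_lt ((lintegral_mono fun ω => prob_le_one).trans_lt ?_)
      simp [measure_lt_top]
  have hG : Measurable fun p : (E × ℝ) × ℝ => F (p.1.1, p.2) := by fun_prop
  calc ∫⁻ ω, F (Y ω, r ω) ∂P
      = ∫⁻ p, F (p.1.1, p.2) ∂(P.map fun ω => (Y' ω, r ω)) := by
        rw [lintegral_map hG (hYm.prodMk hr)]
    _ = ∫⁻ ω, ∫⁻ s, F (Y ω, s) ∂(expLaw ν m g (z ω)) ∂P := by
        rw [key, Measure.lintegral_compProd hG, lintegral_map _ hYm]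
        · simp only [κ, Y', Kernel.comap_apply, hker]
        · exact hG.lintegral_kernel_prod_right'

/-! ### The weighted likelihood ratio of one round -/

/-- The exponent of one round: the weighted log-likelihood ratio between `z` and the true value
`z₁`, minus the stability penalty around `z₀` and the logarithmic penalty. -/
def stepLog (m : ℝ → ℝ) (g η w σ₂ z₁ z₀ z r : ℝ) : ℝ :=
  w / g * ((m z₁ - m z) - r * (z₁ - z)) - (z - z₀) ^ 2 / (3 * η * σ₂)
    - (3 * η + 1 / 2) * Real.log (1 + w / g * slope m z * σ₂)

/-- Projection onto `[-A, A]`. -/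
def clamp (A z : ℝ) : ℝ := max (-A) (min A z)

lemma clamp_mem {A : ℝ} (hA : 0 ≤ A) (z : ℝ) : clamp A z ∈ Set.Icc (-A) A :=
  ⟨le_max_left _ _, max_le (by linarith) (min_le_left _ _)⟩

lemma clamp_of_mem {A z : ℝ} (hz : z ∈ Set.Icc (-A) A) : clamp A z = z := by
  rw [clamp, min_eq_right hz.2, max_eq_right hz.1]

/-- The supremum over `z ∈ [-A, A]` of `exp (stepLog …)`. -/
def stepSup (m : ℝ → ℝ) (g η A w σ₂ z₁ z₀ r : ℝ) : ENNReal :=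
  ⨆ q : ℚ, ENNReal.ofReal (Real.exp (stepLog m g η w σ₂ z₁ z₀ (clamp A q) r))

lemma measurable_stepSup {m : ℝ → ℝ} (hm : Measurable m) (hm'' : Measurable (slope m)) (g η : ℝ) :
    Measurable fun p : (ℝ × ℝ × ℝ × ℝ × ℝ) × ℝ =>
      stepSup m g η p.1.1 p.1.2.1 p.1.2.2.1 p.1.2.2.2.1 p.1.2.2.2.2 p.2 := by
  unfold stepSup stepLog clamp
  refine Measurable.iSup fun q => ?_
  fun_prop

lemma le_stepSup {m : ℝ → ℝ} (hm : Continuous m) (hm'' : Continuous (slope m))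
    {g η A w σ₂ : ℝ} (hg : 0 < g) (hw : 0 ≤ w) (hσ : 0 ≤ σ₂)
    (hpos : ∀ z ∈ Set.Icc (-A) A, 0 ≤ slope m z) (z₁ z₀ r : ℝ) {z : ℝ} (hz : z ∈ Set.Icc (-A) A) :
    ENNReal.ofReal (Real.exp (stepLog m g η w σ₂ z₁ z₀ z r))
      ≤ stepSup m g η A w σ₂ z₁ z₀ r := by
  have hA : 0 ≤ A := by have := hz.1.trans hz.2; linarith
  have hc : Continuous fun z => clamp A z := by unfold clamp; fun_prop
  have hcont : Continuous fun z : ℝ =>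
      ENNReal.ofReal (Real.exp (stepLog m g η w σ₂ z₁ z₀ (clamp A z) r)) := by
    have hlog : Continuous fun z : ℝ => Real.log (1 + w / g * slope m (clamp A z) * σ₂) := by
      refine Continuous.log (by fun_prop) fun z => ?_
      have := hpos _ (clamp_mem hA z)
      positivity
    refine ENNReal.continuous_ofReal.comp (Real.continuous_exp.comp ?_)
    unfold stepLog
    fun_prop
  have h : ∀ y : ℝ, ENNReal.ofReal (Real.exp (stepLog m g η w σ₂ z₁ z₀ (clamp A y) r))
      ≤ stepSup m g η A w σ₂ z₁ z₀ r := fun y =>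
    Rat.denseRange_cast.induction_on (p := fun y : ℝ =>
      ENNReal.ofReal (Real.exp (stepLog m g η w σ₂ z₁ z₀ (clamp A y) r))
        ≤ stepSup m g η A w σ₂ z₁ z₀ r) y (isClosed_le hcont continuous_const)
      fun q => le_iSup (fun q : ℚ =>
        ENNReal.ofReal (Real.exp (stepLog m g η w σ₂ z₁ z₀ (clamp A q) r))) q
  simpa only [clamp_of_mem hz] using h z

lemma exp_weight_mul_le {w y : ℝ} (h0 : 0 ≤ w) (h1 : w ≤ 1) :
    Real.exp (w * y) ≤ 1 - w + w * Real.exp y := by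
  have := convexOn_exp.2 (Set.mem_univ 0) (Set.mem_univ y) (sub_nonneg.2 h1) h0 (by ring)
  simpa using this

/-- The conditional expectation of the one-round supremum is at most one. -/
theorem lintegral_stepSup_le {ν : Measure ℝ} {m : ℝ → ℝ} {g η R A w σ₂ z₀ z₁ : ℝ}
    (hnorm : ∀ z, IsProbabilityMeasure (expLaw ν m g z))
    (hm : Differentiable ℝ m) (hm' : Differentiable ℝ (link m)) (hm'' : Differentiable ℝ (slope m))
    (hg : 0 < g) (hR : 0 ≤ R) (hη : 1 ≤ η) (hz₀ : z₀ ∈ Set.Icc (-A) A)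
    (hpos : ∀ z ∈ Set.Icc (-A) A, 0 ≤ slope m z)
    (hsc : ∀ z ∈ Set.Icc (-A) A, |deriv (slope m) z| ≤ R * slope m z)
    (hw : 0 < w) (hw1 : w ≤ 1) (hσ : 0 < σ₂) (h1 : 14 * η * R ^ 2 * σ₂ ≤ 1)
    (h2 : 6 * η * (η - 1) * (slope m z₀ * (w * σ₂) / g) ≤ 1) :
    ∫⁻ r, stepSup m g η A w σ₂ z₁ z₀ r ∂(expLaw ν m g z₁) ≤ 1 := by
  have hA : 0 ≤ A := by have := hz₀.1.trans hz₀.2; linarith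
  have hs₂ : 0 < w * σ₂ := mul_pos hw hσ
  have h1' : 14 * η * R ^ 2 * (w * σ₂) ≤ 1 := by
    refine le_trans ?_ h1
    have : w * σ₂ ≤ σ₂ := by nlinarith
    gcongr
  obtain ⟨F, hF, hFint, hFle⟩ := exists_dominating_penalizedLik hnorm hm hm' hm'' hg hR hη hz₀
    hpos hsc hs₂ h1' h2
  set h : ℝ → ℝ := fun r => (m z₁ - m z₀ - r * (z₁ - z₀)) / g with hh
  have hmeas : Measurable fun r => ENNReal.ofReal (Real.exp (h r)) := by fun_prop
  have hbound : ∀ r, stepSup m g η A w σ₂ z₁ z₀ r ≤ ENNReal.ofReal (1 - w)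
      + ENNReal.ofReal w * (ENNReal.ofReal (Real.exp (h r)) * F r) := by
    intro r
    refine iSup_le fun q => ?_
    set z := clamp A q
    have hz := clamp_mem hA q
    have hlog : 0 ≤ Real.log (1 + slope m z * (w * σ₂) / g) := by
      refine Real.log_nonneg ?_
      have := hpos z hz
      have : 0 ≤ slope m z * (w * σ₂) / g := by positivity
      linarith
    have e1 : stepLog m g η w σ₂ z₁ z₀ z r
        ≤ w * (h r + penalizedLik m g η (w * σ₂) z₀ z r) := by
      have e2 : w / g * slope m z * σ₂ = slope m z * (w * σ₂) / g := by ring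
      have e3 : w * ((z - z₀) ^ 2 / (3 * η * (w * σ₂))) = (z - z₀) ^ 2 / (3 * η * σ₂) := by
        field_simp
      have e4 : w * (h r + penalizedLik m g η (w * σ₂) z₀ z r)
          = w / g * ((m z₁ - m z) - r * (z₁ - z)) - w * ((z - z₀) ^ 2 / (3 * η * (w * σ₂)))
            - w * ((3 * η + 1 / 2) * Real.log (1 + slope m z * (w * σ₂) / g)) := by
        unfold penalizedLik; rw [hh]; ring
      rw [e4, e3, stepLog, e2]
      have : 0 ≤ (3 * η + 1 / 2) * Real.log (1 + slope m z * (w * σ₂) / g) := by positivity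
      nlinarith
    calc ENNReal.ofReal (Real.exp (stepLog m g η w σ₂ z₁ z₀ z r))
        ≤ ENNReal.ofReal (1 - w + w * (Real.exp (h r)
            * Real.exp (penalizedLik m g η (w * σ₂) z₀ z r))) := by
          refine ENNReal.ofReal_le_ofReal ((Real.exp_le_exp.2 e1).trans ?_)
          rw [← Real.exp_add]
          exact exp_weight_mul_le hw.le hw1
      _ = ENNReal.ofReal (1 - w) + ENNReal.ofReal w * (ENNReal.ofReal (Real.exp (h r))
            * ENNReal.ofReal (Real.exp (penalizedLik m g η (w * σ₂) z₀ z r))) := by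
          rw [ENNReal.ofReal_add (by linarith) (by positivity), ENNReal.ofReal_mul hw.le,
            ENNReal.ofReal_mul (Real.exp_pos _).le]
      _ ≤ _ := by
          gcongr
          exact hFle r z hz
  have := hnorm z₁
  have hprod : Measurable fun r => ENNReal.ofReal (Real.exp (h r)) * F r := hmeas.mul hF
  have hshift : ∫⁻ r, ENNReal.ofReal (Real.exp (h r)) * F r ∂(expLaw ν m g z₁)
      = ∫⁻ r, F r ∂(expLaw ν m g z₀) := by
    rw [lintegral_expLaw ν m g z₁ hprod, lintegral_expLaw ν m g z₀ hF]
    refine lintegral_congr fun r => ?_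
    rw [← mul_assoc]
    congr 1
    unfold expDensity
    rw [← ENNReal.ofReal_mul (Real.exp_pos _).le, ← Real.exp_add]
    congr 2
    rw [hh]
    ring
  calc ∫⁻ r, stepSup m g η A w σ₂ z₁ z₀ r ∂(expLaw ν m g z₁)
      ≤ ∫⁻ r, ENNReal.ofReal (1 - w)
          + ENNReal.ofReal w * (ENNReal.ofReal (Real.exp (h r)) * F r) ∂(expLaw ν m g z₁) :=
        lintegral_mono hbound
    _ = ENNReal.ofReal (1 - w) + ENNReal.ofReal w * ∫⁻ r, F r ∂(expLaw ν m g z₀) := by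
        rw [lintegral_add_left measurable_const, lintegral_const, measure_univ, mul_one,
          lintegral_const_mul _ hprod, hshift]
    _ ≤ ENNReal.ofReal (1 - w) + ENNReal.ofReal w * 1 := by gcongr
    _ = 1 := by
        rw [mul_one, ← ENNReal.ofReal_add (by linarith) hw.le]
        simp

/-- In a degenerate round the supremum equals one. -/
lemma stepSup_zero (m : ℝ → ℝ) (g η w r : ℝ) : stepSup m g η 0 w 0 0 0 r = 1 := by
  have h : ∀ q : ℚ, clamp 0 (q : ℝ) = 0 := fun q => by
    have := clamp_mem le_rfl (q : ℝ)
    simpa using this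
  simp [stepSup, stepLog, h]

/-- A function of frozen quantities and the reward whose conditional integrals are at most one is a
conditional e-value. -/
theorem lintegral_mul_le_of_condLaw {Ω E : Type*} [MeasurableSpace E] {𝓕 mΩ : MeasurableSpace Ω}
    {P : Measure Ω} [IsProbabilityMeasure P] (h𝓕 : 𝓕 ≤ mΩ) {ν : Measure ℝ} {m : ℝ → ℝ} {g : ℝ}
    (hnorm : ∀ z, IsProbabilityMeasure (expLaw ν m g z)) (hm : Measurable m)
    {z : Ω → ℝ} (hz : Measurable[𝓕] z) {Y : Ω → E} (hY : Measurable[𝓕] Y)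
    {r : Ω → ℝ} (hr : Measurable r)
    (hlaw : ∀ B : Set ℝ, MeasurableSet B →
      P[(r ⁻¹' B).indicator (fun _ => (1 : ℝ)) | 𝓕] =ᵐ[P] fun ω => (expLaw ν m g (z ω)).real B)
    {G : E × ℝ → ENNReal} (hG : Measurable G)
    (hle : ∀ ω, ∫⁻ s, G (Y ω, s) ∂(expLaw ν m g (z ω)) ≤ 1)
    {φ : Ω → ENNReal} (hφ : Measurable[𝓕] φ) :
    ∫⁻ ω, φ ω * G (Y ω, r ω) ∂P ≤ ∫⁻ ω, φ ω ∂P := by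
  have hF : Measurable fun p : (ENNReal × E) × ℝ => p.1.1 * G (p.1.2, p.2) := by fun_prop
  refine (lintegral_comp_eq_of_condLaw h𝓕 hnorm hm hz (hφ.prodMk hY) hr hlaw hF).trans_le ?_
  refine lintegral_mono fun ω => ?_
  have hGω : Measurable fun s => G (Y ω, s) := by fun_prop
  calc ∫⁻ s, φ ω * G (Y ω, s) ∂(expLaw ν m g (z ω))
      = φ ω * ∫⁻ s, G (Y ω, s) ∂(expLaw ν m g (z ω)) := lintegral_const_mul _ hGω
    _ ≤ φ ω * 1 := by gcongr; exact hle ω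
    _ = φ ω := mul_one _

/-- The one-round supremum is a conditional e-value. -/
theorem lintegral_mul_stepSup_le {Ω : Type*} {𝓕 mΩ : MeasurableSpace Ω} {P : Measure Ω}
    [IsProbabilityMeasure P] (h𝓕 : 𝓕 ≤ mΩ) {ν : Measure ℝ} {m : ℝ → ℝ} {g η : ℝ}
    (hnorm : ∀ z, IsProbabilityMeasure (expLaw ν m g z))
    (hm : Measurable m) (hm'' : Measurable (slope m))
    {A w σ₂ z₀ z₁ : Ω → ℝ} (hA : Measurable[𝓕] A) (hw : Measurable[𝓕] w)
    (hσ : Measurable[𝓕] σ₂) (hz₀ : Measurable[𝓕] z₀) (hz₁ : Measurable[𝓕] z₁)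
    {r : Ω → ℝ} (hr : Measurable r)
    (hlaw : ∀ B : Set ℝ, MeasurableSet B →
      P[(r ⁻¹' B).indicator (fun _ => (1 : ℝ)) | 𝓕] =ᵐ[P] fun ω => (expLaw ν m g (z₁ ω)).real B)
    (hle : ∀ ω, ∫⁻ s, stepSup m g η (A ω) (w ω) (σ₂ ω) (z₁ ω) (z₀ ω) s
      ∂(expLaw ν m g (z₁ ω)) ≤ 1)
    {φ : Ω → ENNReal} (hφ : Measurable[𝓕] φ) :
    ∫⁻ ω, φ ω * stepSup m g η (A ω) (w ω) (σ₂ ω) (z₁ ω) (z₀ ω) (r ω) ∂P ≤ ∫⁻ ω, φ ω ∂P :=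
  lintegral_mul_le_of_condLaw (Y := fun ω => (A ω, w ω, σ₂ ω, z₁ ω, z₀ ω)) h𝓕 hnorm hm hz₁
    (hA.prodMk (hw.prodMk (hσ.prodMk (hz₁.prodMk hz₀)))) hr hlaw
    (measurable_stepSup hm hm'' g η) hle hφ

/-! ### Coercive symmetric operators -/

/-- `A` is symmetric with `l I ≤ A`. -/
structure IsCoerciveSymm {d : ℕ} (l : ℝ) (A : Vec d →L[ℝ] Vec d) : Prop where
  symm : ∀ u v, inner ℝ (A u) v = inner ℝ u (A v)
  coercive : ∀ v, l * ‖v‖ ^ 2 ≤ inner ℝ v (A v)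

namespace IsCoerciveSymm

variable {d : ℕ} {l : ℝ} {A : Vec d →L[ℝ] Vec d}

lemma inner_nonneg (hl : 0 ≤ l) (hA : IsCoerciveSymm l A) (v : Vec d) : 0 ≤ inner ℝ v (A v) :=
  le_trans (by positivity) (hA.coercive v)

lemma mnorm_sq (hl : 0 ≤ l) (hA : IsCoerciveSymm l A) (v : Vec d) :
    mnorm A v ^ 2 = inner ℝ v (A v) :=
  Real.sq_sqrt (hA.inner_nonneg hl v)

lemma inner_sq_le (hl : 0 ≤ l) (hA : IsCoerciveSymm l A) (u v : Vec d) :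
    inner ℝ u (A v) ^ 2 ≤ inner ℝ u (A u) * inner ℝ v (A v) := by
  have h : ∀ s : ℝ, 0 ≤ inner ℝ v (A v) * (s * s) + 2 * inner ℝ u (A v) * s
      + inner ℝ u (A u) := by
    intro s
    have h1 := hA.inner_nonneg hl (u + s • v)
    have h2 : inner ℝ v (A u) = inner ℝ u (A v) := by rw [← hA.symm, real_inner_comm]
    simp only [map_add, map_smul, inner_add_left, inner_add_right, real_inner_smul_left,
      real_inner_smul_right, h2] at h1
    linarith
  have := discrim_le_zero h
  rw [discrim] at this
  linarith

variable (hl : 0 < l) (hA : IsCoerciveSymm l A)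

include hl hA

lemma injective : Function.Injective A := by
  rw [injective_iff_map_eq_zero]
  intro v hv
  have := hA.coercive v
  rw [hv, inner_zero_right] at this
  have h2 : ‖v‖ ^ 2 ≤ 0 := by nlinarith
  have h3 : ‖v‖ = 0 := by nlinarith [norm_nonneg v]
  exact norm_eq_zero.1 h3

lemma apply_inverse (x : Vec d) : A (A.inverse x) = x := by
  let e : Vec d ≃L[ℝ] Vec d := (LinearEquiv.ofInjectiveEndo (A : Vec d →ₗ[ℝ] Vec d)
    (hA.injective hl)).toContinuousLinearEquiv
  have he : (e : Vec d →L[ℝ] Vec d) = A := by ext v; rfl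
  have h : A.inverse = e.symm := by rw [← he, ContinuousLinearMap.inverse_equiv]
  rw [h]
  exact e.apply_symm_apply x

lemma inner_inverse (x : Vec d) :
    inner ℝ x (A.inverse x) = inner ℝ (A.inverse x) (A (A.inverse x)) := by
  rw [hA.apply_inverse hl, real_inner_comm]

lemma mnorm_inverse_sq (x : Vec d) : mnorm A.inverse x ^ 2 = inner ℝ x (A.inverse x) := by
  rw [mnorm, Real.sq_sqrt]
  rw [hA.inner_inverse hl]
  exact hA.inner_nonneg hl.le _

lemma abs_inner_le (x v : Vec d) : |inner ℝ x v| ≤ mnorm A.inverse x * mnorm A v := by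
  have h0 : 0 ≤ mnorm A.inverse x * mnorm A v := mul_nonneg (Real.sqrt_nonneg _) (Real.sqrt_nonneg _)
  refine abs_le_of_sq_le_sq ?_ h0
  have h := hA.inner_sq_le hl.le v (A.inverse x)
  rw [hA.apply_inverse hl, real_inner_comm] at h
  rw [mul_pow, hA.mnorm_inverse_sq hl, hA.mnorm_sq hl.le, mul_comm,
    real_inner_comm (A.inverse x) x]
  exact h

lemma mnorm_inverse_sq_le (x : Vec d) : mnorm A.inverse x ^ 2 ≤ ‖x‖ ^ 2 / l := by
  have h1 := hA.coercive (A.inverse x)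
  rw [← hA.inner_inverse hl] at h1
  rw [hA.mnorm_inverse_sq hl, le_div_iff₀ hl]
  have h2 := real_inner_le_norm x (A.inverse x)
  set y := ‖A.inverse x‖
  have hy : 0 ≤ y := norm_nonneg _
  have h3 : l * y ≤ ‖x‖ := by
    rcases hy.eq_or_lt with h | h
    · rw [← h]; simp
    · nlinarith
  calc inner ℝ x (A.inverse x) * l ≤ ‖x‖ * y * l := by gcongr
    _ = ‖x‖ * (l * y) := by ring
    _ ≤ ‖x‖ * ‖x‖ := by gcongr
    _ = _ := by ring

lemma eq_zero_of_mnorm_inverse (x : Vec d) (h : mnorm A.inverse x = 0) : x = 0 := by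
  have h1 := hA.coercive (A.inverse x)
  rw [← hA.inner_inverse hl, ← hA.mnorm_inverse_sq hl, h] at h1
  have h2 : ‖A.inverse x‖ ^ 2 ≤ 0 := by nlinarith
  have h3 : A.inverse x = 0 := norm_eq_zero.1 (by nlinarith [norm_nonneg (A.inverse x)])
  rw [← hA.apply_inverse hl x, h3, map_zero]

/-- The squared dual norm as a countable supremum. -/
lemma mnorm_inverse_sq_eq_iSup (x : Vec d) :
    mnorm A.inverse x ^ 2 = ⨆ n : ℕ, (2 * inner ℝ x (TopologicalSpace.denseSeq (Vec d) n)
      - inner ℝ (TopologicalSpace.denseSeq (Vec d) n)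
        (A (TopologicalSpace.denseSeq (Vec d) n))) := by
  set f : Vec d → ℝ := fun v => 2 * inner ℝ x v - inner ℝ v (A v) with hf
  have hcont : Continuous f := by fun_prop
  have hle : ∀ v, f v ≤ mnorm A.inverse x ^ 2 := by
    intro v
    have h1 := hA.abs_inner_le hl x v
    have h2 := hA.mnorm_sq hl.le v
    have h3 := le_abs_self (inner ℝ x v)
    simp only [hf, ← h2]
    nlinarith [sq_nonneg (mnorm A.inverse x - mnorm A v)]
  have hbdd : BddAbove (Set.range fun n => f (TopologicalSpace.denseSeq (Vec d) n)) :=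
    ⟨_, by rintro _ ⟨n, rfl⟩; exact hle _⟩
  change _ = ⨆ n, f (TopologicalSpace.denseSeq (Vec d) n)
  refine le_antisymm ?_ (ciSup_le fun n => hle _)
  have key : ∀ v, f v ≤ ⨆ n, f (TopologicalSpace.denseSeq (Vec d) n) := fun v =>
    (TopologicalSpace.denseRange_denseSeq (Vec d)).induction_on
      (p := fun v => f v ≤ ⨆ n, f (TopologicalSpace.denseSeq (Vec d) n)) v
      (isClosed_le hcont continuous_const) fun n => le_ciSup hbdd n
  have h := key (A.inverse x)
  simp only [hf] at h
  rw [← hA.inner_inverse hl, ← hA.mnorm_inverse_sq hl] at h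
  simp only [hf]
  linarith

end IsCoerciveSymm

/-- The rank-one operator `c x xᵀ`. -/
def outer {d : ℕ} (c : ℝ) (x : Vec d) : Vec d →L[ℝ] Vec d :=
  c • (innerSL ℝ x).smulRight x

@[simp] lemma outer_apply {d : ℕ} (c : ℝ) (x v : Vec d) :
    outer c x v = (c * inner ℝ x v) • x := by
  simp [outer, smul_smul]

namespace IsCoerciveSymm

variable {d : ℕ} {l : ℝ} {A : Vec d →L[ℝ] Vec d}

lemma inner_outer (c : ℝ) (x u v : Vec d) :
    inner ℝ u (outer c x v) = c * inner ℝ x u * inner ℝ x v := by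
  rw [outer_apply, real_inner_smul_right, real_inner_comm x u]; ring

lemma add_outer (hA : IsCoerciveSymm l A) {c : ℝ} (hc : 0 ≤ c) (x : Vec d) :
    IsCoerciveSymm l (A + outer c x) where
  symm u v := by
    rw [add_apply, add_apply, inner_add_left,
      inner_add_right, hA.symm, real_inner_comm v (outer c x u), inner_outer, inner_outer]
    ring
  coercive v := by
    rw [add_apply, inner_add_right, inner_outer]
    nlinarith [hA.coercive v, mul_nonneg hc (mul_self_nonneg (inner ℝ x v))]

lemma smul_id (l : ℝ) : IsCoerciveSymm l (l • ContinuousLinearMap.id ℝ (Vec d)) where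
  symm u v := by simp [real_inner_smul_left, real_inner_smul_right]
  coercive v := by simp [real_inner_smul_right]

lemma mnorm_add_outer_sq (hl : 0 ≤ l) (hA : IsCoerciveSymm l A) {c : ℝ} (hc : 0 ≤ c)
    (x v : Vec d) :
    mnorm (A + outer c x) v ^ 2 = mnorm A v ^ 2 + c * inner ℝ x v ^ 2 := by
  rw [(hA.add_outer hc x).mnorm_sq hl, hA.mnorm_sq hl, add_apply,
    inner_add_right, inner_outer]
  ring

lemma det_add_outer (hl : 0 < l) (hA : IsCoerciveSymm l A) (c : ℝ) (x : Vec d) :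
    LinearMap.det (A + outer c x : Vec d →L[ℝ] Vec d).toLinearMap
      = LinearMap.det A.toLinearMap * (1 + c * mnorm A.inverse x ^ 2) := by
  have h : (A + outer c x : Vec d →L[ℝ] Vec d).toLinearMap = A.toLinearMap ∘ₗ
      LinearMap.transvection (c • (innerSL ℝ x).toLinearMap) (A.inverse x) := by
    ext v : 1
    simp [LinearMap.transvection.apply, hA.apply_inverse hl]
  rw [h, LinearMap.det_comp, LinearMap.transvection.det, hA.mnorm_inverse_sq hl]
  simp

lemma trace_add_outer (A : Vec d →L[ℝ] Vec d) (c : ℝ) (x : Vec d) :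
    LinearMap.trace ℝ (Vec d) (A + outer c x : Vec d →L[ℝ] Vec d).toLinearMap
      = LinearMap.trace ℝ (Vec d) A.toLinearMap + c * ‖x‖ ^ 2 := by
  have h : (A + outer c x : Vec d →L[ℝ] Vec d).toLinearMap
      = A.toLinearMap + c • (innerSL ℝ x).toLinearMap.smulRight x := by
    ext v : 1
    simp [smul_smul]
  rw [h, map_add, map_smul, LinearMap.trace_smulRight]
  simp

/-- The determinant-trace inequality. -/
lemma log_det_le (hd : 1 ≤ d) (hl : 0 < l) (hA : IsCoerciveSymm l A) :
    0 < LinearMap.det A.toLinearMap ∧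
    Real.log (LinearMap.det A.toLinearMap / l ^ d)
      ≤ d * Real.log (LinearMap.trace ℝ (Vec d) A.toLinearMap / (d * l)) := by
  have hsymm : A.toLinearMap.IsSymmetric := hA.symm
  have hn : Module.finrank ℝ (Vec d) = d := by simp
  set e := hsymm.eigenvalues hn with he
  have hpos : ∀ i, 0 < e i := by
    intro i
    have h1 := hsymm.apply_eigenvectorBasis hn i
    have h2 := hA.coercive (hsymm.eigenvectorBasis hn i)
    have h3 : A (hsymm.eigenvectorBasis hn i) = e i • hsymm.eigenvectorBasis hn i := h1
    rw [h3, real_inner_smul_right, real_inner_self_eq_norm_sq,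
      (hsymm.eigenvectorBasis hn).norm_eq_one] at h2
    linarith
  have hdet : LinearMap.det A.toLinearMap = ∏ i, e i := hsymm.det_eq_prod_eigenvalues hn
  have htr : LinearMap.trace ℝ (Vec d) A.toLinearMap = ∑ i, e i :=
    hsymm.trace_eq_sum_eigenvalues hn
  have hd' : (0 : ℝ) < d := by exact_mod_cast hd
  have : Nonempty (Fin d) := ⟨⟨0, hd⟩⟩
  have hsum : 0 < ∑ i, e i := Finset.sum_pos (fun i _ => hpos i) Finset.univ_nonempty
  refine ⟨by rw [hdet]; exact Finset.prod_pos fun i _ => hpos i, ?_⟩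
  rw [hdet, htr]
  set u := (∑ i, e i) / (d * l) with hu
  have hu0 : 0 < u := by positivity
  have h1 : (∏ i, e i) / l ^ d = ∏ i, (e i / l) := by
    rw [Finset.prod_div_distrib]; simp
  rw [h1, Real.log_prod (fun i _ => (div_pos (hpos i) hl).ne')]
  have h2 : ∀ i, Real.log (e i / l) ≤ Real.log u + (e i / l / u - 1) := by
    intro i
    have h3 := Real.log_le_sub_one_of_pos (div_pos (div_pos (hpos i) hl) hu0)
    rw [Real.log_div (div_pos (hpos i) hl).ne' hu0.ne'] at h3
    linarith
  refine (Finset.sum_le_sum fun i _ => h2 i).trans (le_of_eq ?_)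
  rw [Finset.sum_add_distrib, Finset.sum_sub_distrib, ← Finset.sum_div, ← Finset.sum_div]
  simp only [Finset.sum_const, Finset.card_univ, Fintype.card_fin, nsmul_eq_mul, mul_one]
  have : (∑ i, e i) / l / u = d := by rw [hu]; field_simp
  rw [this]
  ring

end IsCoerciveSymm

/-! ### Gradient and Hessian of the loss -/

section Loss

variable {d : ℕ} {m : ℝ → ℝ} (hm : Differentiable ℝ m) (g w : ℝ) (x : Vec d) (r : ℝ)

include hm

lemma hasGradientAt_loss (θ : Vec d) :
    HasGradientAt (loss m g w x r) ((w / g * (link m (inner ℝ x θ) - r)) • x) θ := by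
  rw [hasGradientAt_iff_hasFDerivAt]
  have h1 : HasFDerivAt (fun θ : Vec d => inner ℝ x θ) (innerSL ℝ x) θ :=
    (innerSL ℝ x).hasFDerivAt
  have h2 := ((hm (inner ℝ x θ)).hasDerivAt.comp_hasFDerivAt θ h1).sub (h1.const_mul r)
  have h3 := (h2.const_mul w).mul_const g⁻¹
  refine (h3.congr_fderiv ?_).congr_of_eventuallyEq (Filter.Eventually.of_forall fun θ => ?_)
  · ext v
    simp [link]
    ring
  · simp [loss, div_eq_mul_inv]

lemma gradient_loss (θ : Vec d) :
    gradient (loss m g w x r) θ = (w / g * (link m (inner ℝ x θ) - r)) • x :=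
  (hasGradientAt_loss hm g w x r θ).gradient

lemma hessian_loss (hm' : Differentiable ℝ (link m)) (θ : Vec d) :
    hessian (loss m g w x r) θ = outer (w / g * slope m (inner ℝ x θ)) x := by
  have h0 : gradient (loss m g w x r) = fun θ => (w / g * (link m (inner ℝ x θ) - r)) • x :=
    funext (gradient_loss hm g w x r)
  have h1 : HasFDerivAt (fun θ : Vec d => inner ℝ x θ) (innerSL ℝ x) θ :=
    (innerSL ℝ x).hasFDerivAt
  have h2 := ((((hm' (inner ℝ x θ)).hasDerivAt.comp_hasFDerivAt θ h1).sub_const r).const_mul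
    (w / g)).smul_const x
  rw [hessian, h0]
  refine (h2.congr_fderiv ?_).fderiv
  ext1 v
  simp [slope, outer_apply, smul_smul, mul_assoc]

end Loss

/-! ### Second-order estimates for self-concordant links -/

lemma nonneg_of_second_deriv_nonneg {h h₁ h₂ : ℝ → ℝ} (hd : ∀ s, HasDerivAt h (h₁ s) s)
    (hd₁ : ∀ s, HasDerivAt h₁ (h₂ s) s) (h0 : h 0 = 0) (h10 : h₁ 0 = 0)
    (hpos : ∀ s ∈ Set.Icc (0 : ℝ) 1, 0 ≤ h₂ s) : 0 ≤ h 1 := by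
  have mono : ∀ {f f' : ℝ → ℝ}, (∀ s, HasDerivAt f (f' s) s) → f 0 = 0 →
      (∀ s ∈ Set.Icc (0 : ℝ) 1, 0 ≤ f' s) → ∀ s ∈ Set.Icc (0 : ℝ) 1, 0 ≤ f s := by
    intro f f' hf hf0 hp s hs
    have hmono : MonotoneOn f (Set.Icc 0 1) := by
      refine monotoneOn_of_deriv_nonneg (convex_Icc 0 1)
        (fun s _ => (hf s).continuousAt.continuousWithinAt)
        (fun s _ => (hf s).differentiableAt.differentiableWithinAt) fun s hs => ?_
      rw [(hf s).deriv]
      exact hp s (interior_subset hs)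
    rw [← hf0]
    exact hmono ⟨le_rfl, zero_le_one⟩ hs hs.1
  exact mono hd h0 (mono hd₁ h10 hpos) 1 ⟨zero_le_one, le_rfl⟩

lemma segment_mem_Icc {l u a b s : ℝ} (ha : a ∈ Set.Icc l u) (hb : b ∈ Set.Icc l u)
    (hs : s ∈ Set.Icc (0 : ℝ) 1) : a + s * (b - a) ∈ Set.Icc l u := by
  have h1 := mul_le_mul_of_nonneg_left ha.1 (sub_nonneg.2 hs.2)
  have h2 := mul_le_mul_of_nonneg_left hb.1 hs.1
  have h3 := mul_le_mul_of_nonneg_left ha.2 (sub_nonneg.2 hs.2)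
  have h4 := mul_le_mul_of_nonneg_left hb.2 hs.1
  constructor <;> nlinarith

lemma hasDerivAt_comp_segment {f : ℝ → ℝ} (hf : Differentiable ℝ f) (a u s : ℝ) :
    HasDerivAt (fun s => f (a + s * u)) (deriv f (a + s * u) * u) s := by
  have h1 : HasDerivAt (fun s : ℝ => a + s * u) u s := by
    simpa using ((hasDerivAt_id s).mul_const u).const_add a
  exact (hf (a + s * u)).hasDerivAt.comp s h1

lemma abs_taylor_le {f : ℝ → ℝ} (hf : Differentiable ℝ f) (hf' : Differentiable ℝ (deriv f))
    {l u a b K : ℝ} (hK : ∀ z ∈ Set.Icc l u, |deriv (deriv f) z| ≤ K)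
    (ha : a ∈ Set.Icc l u) (hb : b ∈ Set.Icc l u) :
    |f b - f a - deriv f a * (b - a)| ≤ K / 2 * (b - a) ^ 2 := by
  have key : ∀ e : ℝ, |e| = 1 → 0 ≤ e * (f b - f a - deriv f a * (b - a))
      + K / 2 * (b - a) ^ 2 := by
    intro e he
    have h := nonneg_of_second_deriv_nonneg
      (h := fun s => e * (f (a + s * (b - a)) - f a - deriv f a * (s * (b - a)))
        + K / 2 * (s * (b - a)) ^ 2)
      (h₁ := fun s => e * (deriv f (a + s * (b - a)) * (b - a) - deriv f a * (b - a))
        + K * (s * (b - a)) * (b - a))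
      (h₂ := fun s => e * (deriv (deriv f) (a + s * (b - a)) * (b - a) * (b - a))
        + K * (b - a) * (b - a)) ?_ ?_ (by simp) (by simp) ?_
    · simpa using h
    · intro s
      have h1 : HasDerivAt (fun s : ℝ => s * (b - a)) (b - a) s := by
        simpa using (hasDerivAt_id s).mul_const (b - a)
      refine (((((hasDerivAt_comp_segment hf a (b - a) s).sub_const (f a)).sub
        (h1.const_mul (deriv f a))).const_mul e).add ((h1.pow 2).const_mul (K / 2))).congr_deriv ?_
      push_cast
      ring
    · intro s
      have h1 : HasDerivAt (fun s : ℝ => s * (b - a)) (b - a) s := by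
        simpa using (hasDerivAt_id s).mul_const (b - a)
      refine (((((hasDerivAt_comp_segment hf' a (b - a) s).mul_const (b - a)).sub_const
        (deriv f a * (b - a))).const_mul e).add
          ((h1.const_mul K).mul_const (b - a))).congr_deriv ?_
      ring
    · intro s hs
      have h1 := hK _ (segment_mem_Icc ha hb hs)
      have h2 : |e * deriv (deriv f) (a + s * (b - a))| ≤ K := by rw [abs_mul, he, one_mul]; exact h1
      have h3 := (abs_le.1 h2).1
      nlinarith [sq_nonneg (b - a)]
  have k1 := key 1 (by simp)
  have k2 := key (-1) (by simp)
  rw [abs_le]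
  constructor <;> linarith

lemma two_sub_le_mul_exp_neg {a : ℝ} (ha : 0 ≤ a) : 2 - a ≤ (2 + a) * Real.exp (-a) := by
  have h := nonneg_of_second_deriv_nonneg
    (h := fun s => (2 + s * a) * Real.exp (-(s * a)) - 2 + s * a)
    (h₁ := fun s => a - (1 + s * a) * a * Real.exp (-(s * a)))
    (h₂ := fun s => s * a * a * a * Real.exp (-(s * a))) ?_ ?_ (by simp) (by simp) ?_
  · simp only [one_mul] at h; linarith
  · intro s
    have h1 : HasDerivAt (fun s : ℝ => s * a) a s := by simpa using (hasDerivAt_id s).mul_const a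
    refine ((((h1.const_add 2).mul h1.neg.exp).sub_const 2).add h1).congr_deriv ?_
    simp only [Pi.neg_apply]
    ring
  · intro s
    have h1 : HasDerivAt (fun s : ℝ => s * a) a s := by simpa using (hasDerivAt_id s).mul_const a
    refine ((((h1.const_add 1).mul_const a).mul h1.neg.exp).const_sub a).congr_deriv ?_
    simp only [Pi.neg_apply]
    ring
  · intro s hs
    have := hs.1
    positivity

/-- The Bregman divergence of a self-concordant function dominates a quadratic. -/
lemma bregman_ge {m : ℝ → ℝ} (hm : Differentiable ℝ m) (hm' : Differentiable ℝ (link m))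
    (hm'' : Differentiable ℝ (slope m)) {l u a b R : ℝ} (hR : 0 ≤ R)
    (hpos : ∀ z ∈ Set.Icc l u, 0 ≤ slope m z)
    (hsc : ∀ z ∈ Set.Icc l u, |deriv (slope m) z| ≤ R * slope m z)
    (ha : a ∈ Set.Icc l u) (hb : b ∈ Set.Icc l u) :
    slope m a * (b - a) ^ 2 ≤ (2 + R * |b - a|) * (m b - m a - link m a * (b - a)) := by
  set k := R * |b - a| with hk
  have hk0 : 0 ≤ k := by positivity
  have hcurv : ∀ s ∈ Set.Icc (0 : ℝ) 1,
      slope m a * Real.exp (-(s * k)) ≤ slope m (a + s * (b - a)) := by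
    intro s hs
    have h1 := le_mul_exp_of_abs_deriv_le hm'' hsc (segment_mem_Icc ha hb hs) ha
    rw [show |a - (a + s * (b - a))| = s * |b - a| by
      rw [show a - (a + s * (b - a)) = -(s * (b - a)) by ring, abs_neg, abs_mul,
        abs_of_nonneg hs.1], show R * (s * |b - a|) = s * k by rw [hk]; ring] at h1
    rw [Real.exp_neg, ← div_eq_mul_inv, div_le_iff₀ (Real.exp_pos _)]
    exact h1
  have d1 : ∀ s : ℝ, HasDerivAt (fun s : ℝ => s * (b - a)) (b - a) s := fun s => by
    simpa using (hasDerivAt_id s).mul_const (b - a)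
  have d2 : ∀ s : ℝ, HasDerivAt (fun s : ℝ => s * k) k s := fun s => by
    simpa using (hasDerivAt_id s).mul_const k
  have hl : deriv m = link m := rfl
  have hs' : deriv (link m) = slope m := rfl
  rcases hk0.eq_or_lt with hk1 | hk1
  · rw [← hk1] at hcurv ⊢
    have h := nonneg_of_second_deriv_nonneg
      (h := fun s => m (a + s * (b - a)) - m a - link m a * (s * (b - a))
        - slope m a / 2 * (s * (b - a)) ^ 2)
      (h₁ := fun s => link m (a + s * (b - a)) * (b - a) - link m a * (b - a)
        - slope m a * (s * (b - a)) * (b - a))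
      (h₂ := fun s => slope m (a + s * (b - a)) * (b - a) * (b - a)
        - slope m a * (b - a) * (b - a)) ?_ ?_ (by simp) (by simp) ?_
    · simp only [one_mul, add_sub_cancel] at h; linarith
    · intro s
      refine ((((hasDerivAt_comp_segment hm a (b - a) s).sub_const (m a)).sub
        ((d1 s).const_mul (link m a))).sub (((d1 s).pow 2).const_mul
          (slope m a / 2))).congr_deriv ?_
      rw [hl]; push_cast; ring
    · intro s
      refine ((((hasDerivAt_comp_segment hm' a (b - a) s).mul_const (b - a)).sub_const
        (link m a * (b - a))).sub (((d1 s).const_mul (slope m a)).mul_const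
          (b - a))).congr_deriv ?_
      rw [hs']
    · intro s hs
      have := hcurv s hs
      simp only [mul_zero, neg_zero, Real.exp_zero, mul_one] at this
      nlinarith [sq_nonneg (b - a)]
  · have h := nonneg_of_second_deriv_nonneg
      (h := fun s => k ^ 2 * (m (a + s * (b - a)) - m a - link m a * (s * (b - a)))
        - slope m a * (b - a) ^ 2 * (Real.exp (-(s * k)) - 1 + s * k))
      (h₁ := fun s => k ^ 2 * (link m (a + s * (b - a)) * (b - a) - link m a * (b - a))
        - slope m a * (b - a) ^ 2 * (k - k * Real.exp (-(s * k))))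
      (h₂ := fun s => k ^ 2 * (slope m (a + s * (b - a)) * (b - a) * (b - a))
        - slope m a * (b - a) ^ 2 * (k ^ 2 * Real.exp (-(s * k)))) ?_ ?_ (by simp) (by simp) ?_
    · simp only [one_mul, add_sub_cancel] at h
      have h3 := two_sub_le_mul_exp_neg hk0
      have h4 : k ^ 2 ≤ (2 + k) * (Real.exp (-k) - 1 + k) := by nlinarith
      have h5 : 0 ≤ slope m a * (b - a) ^ 2 := mul_nonneg (hpos a ha) (sq_nonneg _)
      have h6 : k ^ 2 * (slope m a * (b - a) ^ 2)
          ≤ k ^ 2 * ((2 + k) * (m b - m a - link m a * (b - a))) := by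
        have := mul_le_mul_of_nonneg_left h4 h5
        nlinarith
      exact le_of_mul_le_mul_left h6 (by positivity)
    · intro s
      refine (((((hasDerivAt_comp_segment hm a (b - a) s).sub_const (m a)).sub
        ((d1 s).const_mul (link m a))).const_mul (k ^ 2)).sub ((((d2 s).neg.exp.sub_const 1).add
          (d2 s)).const_mul (slope m a * (b - a) ^ 2))).congr_deriv ?_
      simp only [Pi.neg_apply]
      rw [hl]; ring
    · intro s
      refine (((((hasDerivAt_comp_segment hm' a (b - a) s).mul_const (b - a)).sub_const
        (link m a * (b - a))).const_mul (k ^ 2)).sub ((((d2 s).neg.exp.const_mul k).const_sub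
          k).const_mul (slope m a * (b - a) ^ 2))).congr_deriv ?_
      simp only [Pi.neg_apply]
      rw [hs']; ring
    · intro s hs
      have := mul_le_mul_of_nonneg_left (hcurv s hs) (by positivity : 0 ≤ k ^ 2 * (b - a) ^ 2)
      nlinarith

/-! ### One step of online mirror descent -/

/-- On `[-A, A]` the slope lies in `[0, L]` and the link is `R`-self-concordant. -/
structure LinkBounds (m : ℝ → ℝ) (L R A : ℝ) : Prop where
  nonneg : ∀ z ∈ Set.Icc (-A) A, 0 ≤ slope m z
  le : ∀ z ∈ Set.Icc (-A) A, slope m z ≤ L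
  self_concordant : ∀ z ∈ Set.Icc (-A) A, |deriv (slope m) z| ≤ R * slope m z

lemma mem_ball_iff {d : ℕ} {S : ℝ} {θ : Vec d} : θ ∈ ball d S ↔ ‖θ‖ ≤ S :=
  mem_closedBall_zero_iff

lemma inner_mem_Icc {d : ℕ} {S : ℝ} {θ : Vec d} (x : Vec d) (hθ : θ ∈ ball d S) :
    inner ℝ x θ ∈ Set.Icc (-(S * ‖x‖)) (S * ‖x‖) := by
  rw [Set.mem_Icc, ← abs_le]
  calc |inner ℝ x θ| ≤ ‖x‖ * ‖θ‖ := abs_real_inner_le_norm x θ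
    _ ≤ ‖x‖ * S := by gcongr; exact mem_ball_iff.1 hθ
    _ = _ := mul_comm _ _

lemma exists_mem_ball_inner_eq {d : ℕ} {S : ℝ} (x : Vec d) {z : ℝ} (hS : 0 ≤ S)
    (hz : z ∈ Set.Icc (-(S * ‖x‖)) (S * ‖x‖)) : ∃ θ ∈ ball d S, z = inner ℝ x θ := by
  rcases eq_or_ne x 0 with rfl | hx
  · refine ⟨0, mem_ball_iff.2 (by simpa), ?_⟩
    simpa using hz
  · have hx' : 0 < ‖x‖ := norm_pos_iff.2 hx
    refine ⟨(z / ‖x‖ ^ 2) • x, mem_ball_iff.2 ?_, ?_⟩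
    · rw [norm_smul, Real.norm_eq_abs, abs_div, abs_of_pos (by positivity : 0 < ‖x‖ ^ 2),
        div_mul_eq_mul_div, div_le_iff₀ (by positivity)]
      have := abs_le.2 hz
      nlinarith
    · rw [real_inner_smul_right, real_inner_self_eq_norm_sq]
      field_simp

lemma nonneg_of_forall_quadratic {B Q : ℝ} (h : ∀ e : ℝ, 0 < e → e ≤ 1 → 0 ≤ e * B + e ^ 2 * Q) :
    0 ≤ B := by
  by_contra hB
  push Not at hB
  have hK : 0 < |Q| + -B := by have := abs_nonneg Q; linarith
  have he1 : -B / (2 * (|Q| + -B)) ≤ 1 := by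
    rw [div_le_one (by positivity)]; have := abs_nonneg Q; linarith
  have he0 : 0 < -B / (2 * (|Q| + -B)) := div_pos (by linarith) (by positivity)
  have h1 := h _ he0 he1
  set e := -B / (2 * (|Q| + -B)) with he
  have h2 : e * (2 * (|Q| + -B)) = -B := by rw [he]; field_simp
  have h3 : e * Q ≤ e * |Q| := by gcongr; exact le_abs_self Q
  have h4 : 0 ≤ B + e * Q := by
    by_contra hc
    push Not at hc
    nlinarith [mul_neg_of_pos_of_neg he0 hc]
  nlinarith

section Step

variable {d : ℕ} {m : ℝ → ℝ} {L R S η l α g w r c : ℝ} {H : Vec d →L[ℝ] Vec d} {x θ₀ θ₁ θs : Vec d}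

/-- First-order optimality of the mirror descent step. -/
lemma omd_variational (hm : Differentiable ℝ m) (hm' : Differentiable ℝ (link m))
    (hH : IsCoerciveSymm l H) (hl : 0 ≤ l) (hη : 0 < η)
    (hc : 0 ≤ w / g * slope m (inner ℝ x θ₀)) (h₁ : θ₁ ∈ ball d S) (hs : θs ∈ ball d S)
    (hmin : IsMinOn (omdObjective η (loss m g w x r) H θ₀) (ball d S) θ₁) :
    mnorm H (θs - θ₁) ^ 2 + mnorm H (θ₁ - θ₀) ^ 2 ≤ mnorm H (θs - θ₀) ^ 2
      + 2 * η * (w / g) * (link m (inner ℝ x θ₀) + slope m (inner ℝ x θ₀)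
        * (inner ℝ x θ₁ - inner ℝ x θ₀) - r) * (inner ℝ x θs - inner ℝ x θ₁) := by
  set Δ := θ₁ - θ₀ with hΔ
  set v := θs - θ₁ with hv
  set G := w / g * (link m (inner ℝ x θ₀) - r) with hG
  set c₀ := w / g * slope m (inner ℝ x θ₀) with hc₀
  have hobj : ∀ θ, omdObjective η (loss m g w x r) H θ₀ θ = G * inner ℝ x (θ - θ₀)
      + 1 / 2 * (c₀ * inner ℝ x (θ - θ₀) ^ 2)
      + 1 / (2 * η) * inner ℝ (θ - θ₀) (H (θ - θ₀)) := by
    intro θ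
    rw [omdObjective, gradient_loss hm, hessian_loss hm g w x r hm', hH.mnorm_sq hl,
      real_inner_smul_left, mnorm, IsCoerciveSymm.inner_outer, Real.sq_sqrt]
    · rw [hc₀]; ring
    · rw [mul_assoc]
      exact mul_nonneg hc (mul_self_nonneg _)
  have hsymm : inner ℝ v (H Δ) = inner ℝ Δ (H v) := by rw [← hH.symm, real_inner_comm]
  have key : 0 ≤ G * inner ℝ x v + c₀ * (inner ℝ x Δ * inner ℝ x v)
      + 1 / η * inner ℝ Δ (H v) := by
    apply nonneg_of_forall_quadratic
      (Q := 1 / 2 * (c₀ * inner ℝ x v ^ 2) + 1 / (2 * η) * inner ℝ v (H v))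
    intro e he0 he1
    have hmem : θ₁ + e • v ∈ ball d S :=
      (convex_closedBall (0 : Vec d) S).add_smul_sub_mem h₁ hs ⟨he0.le, he1⟩
    have h : omdObjective η (loss m g w x r) H θ₀ θ₁
      ≤ omdObjective η (loss m g w x r) H θ₀ (θ₁ + e • v) := hmin hmem
    rw [hobj, hobj] at h
    rw [show θ₁ + e • v - θ₀ = Δ + e • v by rw [hΔ]; abel] at h
    simp only [← hΔ, map_add, map_smul, inner_add_left, inner_add_right, real_inner_smul_left,
      real_inner_smul_right, hsymm] at h
    have e1 : 1 / η * inner ℝ Δ (H v) = 1 / (2 * η) * (2 * inner ℝ Δ (H v)) := by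
      field_simp
    rw [e1]
    linarith
  have h3 : inner ℝ (θs - θ₀) (H (θs - θ₀)) = inner ℝ v (H v) + 2 * inner ℝ Δ (H v)
      + inner ℝ Δ (H Δ) := by
    rw [show θs - θ₀ = Δ + v by rw [hΔ, hv]; abel]
    simp only [map_add, inner_add_left, inner_add_right, hsymm]
    ring
  rw [hH.mnorm_sq hl, hH.mnorm_sq hl, hH.mnorm_sq hl, h3, ← inner_sub_right, ← inner_sub_right,
    ← hv, ← hΔ]
  have h4 := mul_le_mul_of_nonneg_left key (by positivity : 0 ≤ 2 * η)
  have e2 : 2 * η * (G * inner ℝ x v + c₀ * (inner ℝ x Δ * inner ℝ x v)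
      + 1 / η * inner ℝ Δ (H v)) = 2 * η * (w / g) * (link m (inner ℝ x θ₀)
        + slope m (inner ℝ x θ₀) * inner ℝ x Δ - r) * inner ℝ x v + 2 * inner ℝ Δ (H v) := by
    rw [hG, hc₀]; field_simp; ring
  rw [mul_zero, e2] at h4
  linarith

/-- The mirror descent step decreases the distance to the true parameter, up to the one-round
likelihood exponent and the corruption. -/
theorem omd_step (hm : Differentiable ℝ m) (hm' : Differentiable ℝ (link m))
    (hm'' : Differentiable ℝ (slope m)) (hH : IsCoerciveSymm l H) (hl : 0 < l)
    (hη : η = 1 + R * S) (hR : 0 ≤ R) (hS : 0 < S) (hL : 0 < L) (hg : 0 < g)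
    (hw : 0 ≤ w) (hwα : w / g * mnorm H.inverse x ≤ α)
    (hlα : 36 * η ^ 2 * α ^ 2 * R ^ 2 * S ^ 2 * L ^ 2 ≤ l) (hx : ‖x‖ ≤ 1)
    (hb : LinkBounds m L R (S * ‖x‖)) (h₀ : θ₀ ∈ ball d S) (h₁ : θ₁ ∈ ball d S)
    (hs : θs ∈ ball d S)
    (hmin : IsMinOn (omdObjective η (loss m g w x (r + c)) H θ₀) (ball d S) θ₁) :
    mnorm (H + outer (w / g * slope m (inner ℝ x θ₁)) x) (θs - θ₁) ^ 2
      ≤ mnorm H (θs - θ₀) ^ 2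
        + 2 * η * (stepLog m g η w (mnorm H.inverse x ^ 2) (inner ℝ x θs) (inner ℝ x θ₀)
            (inner ℝ x θ₁) r
          + (3 * η + 1 / 2) * Real.log (1 + w / g * slope m (inner ℝ x θ₁)
            * mnorm H.inverse x ^ 2))
        + 2 * η * α * |c|
          * mnorm (H + outer (w / g * slope m (inner ℝ x θ₁)) x) (θs - θ₁) := by
  have hη1 : 1 ≤ η := by rw [hη]; have := mul_nonneg hR hS.le; linarith
  set y := w / g with hy
  have hy0 : 0 ≤ y := by positivity
  have hz₀ := inner_mem_Icc x h₀
  have hz₁ := inner_mem_Icc x h₁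
  have hzs := inner_mem_Icc x hs
  have hvar := omd_variational hm hm' hH hl.le (by linarith) (mul_nonneg hy0 (hb.nonneg _ hz₀))
    h₁ hs hmin
  have hc₁ : 0 ≤ y * slope m (inner ℝ x θ₁) := mul_nonneg hy0 (hb.nonneg _ hz₁)
  have hnew := hH.mnorm_add_outer_sq hl.le hc₁ x (θs - θ₁)
  set σ := mnorm H.inverse x with hσ
  have hσ0 : 0 ≤ σ := Real.sqrt_nonneg _
  have hu := hH.abs_inner_le hl x (θ₁ - θ₀)
  have hv := hH.abs_inner_le hl x (θs - θ₁)
  rw [inner_sub_right, ← hσ] at hu hv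
  rw [inner_sub_right] at hnew
  have hσ1 : σ ^ 2 ≤ 1 / l := by
    refine (hH.mnorm_inverse_sq_le hl x).trans ?_
    gcongr
    exact pow_le_one₀ (norm_nonneg _) hx
  have hDnew : mnorm H (θs - θ₁) ≤ mnorm (H + outer (y * slope m (inner ℝ x θ₁)) x) (θs - θ₁) := by
    refine le_of_sq_le_sq ?_ (Real.sqrt_nonneg _)
    rw [hnew]
    have := mul_nonneg hc₁ (sq_nonneg (inner ℝ x θs - inner ℝ x θ₁))
    linarith
  set D' := mnorm (H + outer (y * slope m (inner ℝ x θ₁)) x) (θs - θ₁)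
  set DΔ := mnorm H (θ₁ - θ₀)
  have hDΔ0 : 0 ≤ DΔ := Real.sqrt_nonneg _
  have hD'0 : 0 ≤ D' := Real.sqrt_nonneg _
  set z₀ := inner ℝ x θ₀
  set z₁ := inner ℝ x θ₁
  set zs := inner ℝ x θs
  have hdiff : |zs - z₁| ≤ 2 * S := by
    have h1 : S * ‖x‖ ≤ S := by nlinarith
    rw [abs_le]
    constructor <;> linarith [hzs.1, hzs.2, hz₁.1, hz₁.2]
  have hbreg : slope m z₁ * (zs - z₁) ^ 2 ≤ 2 * η * (m zs - m z₁ - link m z₁ * (zs - z₁)) := by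
    have h1 := bregman_ge hm hm' hm'' hR hb.nonneg hb.self_concordant hz₁ hzs
    have h2 : 0 ≤ m zs - m z₁ - link m z₁ * (zs - z₁) := by
      have h3 := mul_nonneg (hb.nonneg _ hz₁) (sq_nonneg (zs - z₁))
      have h4 : 0 < 2 + R * |zs - z₁| := by positivity
      exact nonneg_of_mul_nonneg_right (h3.trans h1) h4
    refine h1.trans (mul_le_mul_of_nonneg_right ?_ h2)
    rw [hη]
    nlinarith
  have htaylor : |link m z₁ - link m z₀ - slope m z₀ * (z₁ - z₀)| ≤ R * L / 2 * (z₁ - z₀) ^ 2 :=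
    abs_taylor_le hm' hm'' (fun z hz => (hb.self_concordant z hz).trans (by
      have := hb.le z hz; gcongr)) hz₀ hz₁
  -- the linearization error is absorbed by the stability term
  have hsq : (z₁ - z₀) ^ 2 ≤ σ ^ 2 * DΔ ^ 2 := by
    rw [← mul_pow]; exact sq_le_sq' (by linarith [(abs_le.1 hu).1]) (abs_le.1 hu).2
  have hαRS : 6 * η * α * R * S * L * σ ≤ 1 := by
    refine le_of_sq_le_sq ?_ zero_le_one
    calc (6 * η * α * R * S * L * σ) ^ 2
        = 36 * η ^ 2 * α ^ 2 * R ^ 2 * S ^ 2 * L ^ 2 * σ ^ 2 := by ring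
      _ ≤ l * (1 / l) := by gcongr
      _ = 1 ^ 2 := by field_simp
  have herr : 2 * η * y * (link m z₀ + slope m z₀ * (z₁ - z₀) - link m z₁) * (zs - z₁)
      ≤ DΔ ^ 2 / 3 := by
    have h1 : (link m z₀ + slope m z₀ * (z₁ - z₀) - link m z₁) * (zs - z₁)
        ≤ R * L / 2 * (z₁ - z₀) ^ 2 * (2 * S) := by
      refine (le_abs_self _).trans ?_
      rw [abs_mul]
      refine mul_le_mul ?_ hdiff (abs_nonneg _) (by positivity)
      rwa [show link m z₀ + slope m z₀ * (z₁ - z₀) - link m z₁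
        = -(link m z₁ - link m z₀ - slope m z₀ * (z₁ - z₀)) by ring, abs_neg]
    calc 2 * η * y * (link m z₀ + slope m z₀ * (z₁ - z₀) - link m z₁) * (zs - z₁)
        = 2 * η * y * ((link m z₀ + slope m z₀ * (z₁ - z₀) - link m z₁) * (zs - z₁)) := by ring
      _ ≤ 2 * η * y * (R * L / 2 * (z₁ - z₀) ^ 2 * (2 * S)) := by gcongr
      _ ≤ 2 * η * y * (R * L / 2 * (σ ^ 2 * DΔ ^ 2) * (2 * S)) := by gcongr
      _ = 2 * η * R * L * S * σ * DΔ ^ 2 * (y * σ) := by ring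
      _ ≤ 2 * η * R * L * S * σ * DΔ ^ 2 * α := by gcongr
      _ = 6 * η * α * R * S * L * σ * (DΔ ^ 2 / 3) := by ring
      _ ≤ 1 * (DΔ ^ 2 / 3) := by gcongr
      _ = _ := one_mul _
  have hcorr : -(2 * η * y * c * (zs - z₁)) ≤ 2 * η * α * |c| * D' := by
    calc -(2 * η * y * c * (zs - z₁)) ≤ |2 * η * y * c * (zs - z₁)| := neg_le_abs _
      _ = 2 * η * |c| * (y * |zs - z₁|) := by
        rw [abs_mul, abs_mul, abs_mul, abs_of_nonneg hy0,
          abs_of_nonneg (by positivity : 0 ≤ 2 * η)]; ring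
      _ ≤ 2 * η * |c| * (y * (σ * D')) := by
        gcongr
        exact hv.trans (by gcongr)
      _ = 2 * η * |c| * (y * σ * D') := by ring
      _ ≤ 2 * η * |c| * (α * D') := by gcongr
      _ = _ := by ring
  have hstab : 2 / 3 * ((z₁ - z₀) ^ 2 / σ ^ 2) ≤ 2 / 3 * DΔ ^ 2 := by
    gcongr
    exact div_le_of_le_mul₀ (by positivity) (by positivity) (by linarith)
  have e1 : 2 * η * (stepLog m g η w (σ ^ 2) zs z₀ z₁ r
      + (3 * η + 1 / 2) * Real.log (1 + y * slope m z₁ * σ ^ 2))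
      = 2 * η * y * (m zs - m z₁ - r * (zs - z₁)) - 2 / 3 * ((z₁ - z₀) ^ 2 / σ ^ 2) := by
    rw [stepLog, ← hy]
    have : 2 * η * ((z₁ - z₀) ^ 2 / (3 * η * σ ^ 2)) = 2 / 3 * ((z₁ - z₀) ^ 2 / σ ^ 2) := by
      rcases hσ0.eq_or_lt with h | h
      · rw [← h]; simp
      · field_simp
    linear_combination (-1) * this
  rw [e1, hnew]
  have hbreg' := mul_le_mul_of_nonneg_left hbreg hy0
  linarith

end Step

/-! ### Confidence weights -/

section Weight

variable {d : ℕ} {α g : ℝ} (hα : 0 < α) (hg : 0 < g) (H : Vec d →L[ℝ] Vec d) (x : Vec d)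

lemma mnorm_nonneg {d : ℕ} (A : Vec d →L[ℝ] Vec d) (x : Vec d) : 0 ≤ mnorm A x :=
  Real.sqrt_nonneg _

lemma weight_le_one : weight α g H x ≤ 1 := by
  unfold weight
  split_ifs with h
  · exact le_rfl
  · exact min_le_left _ _

include hα hg

lemma weight_pos : 0 < weight α g H x := by
  unfold weight
  split_ifs with h
  · exact one_pos
  · have := (mnorm_nonneg H.inverse x).lt_of_ne' h
    exact lt_min one_pos (by positivity)

lemma weight_div_mul_le : weight α g H x / g * mnorm H.inverse x ≤ α := by
  unfold weight
  split_ifs with h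
  · rw [h, mul_zero]; exact hα.le
  · have h0 := (mnorm_nonneg H.inverse x).lt_of_ne' h
    calc min 1 (α * g / mnorm H.inverse x) / g * mnorm H.inverse x
        ≤ (α * g / mnorm H.inverse x) / g * mnorm H.inverse x := by gcongr; exact min_le_right _ _
      _ = α := by field_simp

lemma weight_mul_of_lt_one (h : weight α g H x < 1) :
    weight α g H x * mnorm H.inverse x = α * g := by
  unfold weight at h ⊢
  split_ifs at h ⊢ with h0
  · exact absurd h (lt_irrefl _)
  · rcases min_lt_iff.1 h with h1 | h1
    · exact absurd h1 (lt_irrefl _)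
    · rw [min_eq_right h1.le]
      field_simp

end Weight

/-! ### Consequences of the standing assumptions -/

section Arms

variable {d T : ℕ} {M : GLM d} {S L R : ℝ} {X : ℕ → Set (Vec d)}

lemma inv_kappa_le_slope (hA : M.ValidArms S L R T X) {t : ℕ} (ht : t ∈ Set.Icc 1 T) {y : Vec d}
    (hy : y ∈ X t) {θ : Vec d} (hθ : θ ∈ ball d S) :
    sInf (M.slopes S T X) ≤ slope M.m (inner ℝ y θ) := by
  have hbdd : BddBelow (M.slopes S T X) := by
    by_contra h
    have := hA.curvature_pos
    rw [Real.sInf_of_not_bddBelow h] at this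
    exact lt_irrefl _ this
  exact csInf_le hbdd ⟨t, ht, y, hy, θ, hθ, rfl⟩

lemma linkBounds (hA : M.ValidArms S L R T X) (hS : 0 ≤ S) {t : ℕ} (ht : t ∈ Set.Icc 1 T)
    {y : Vec d} (hy : y ∈ X t) : LinkBounds M.m L R (S * ‖y‖) where
  nonneg z hz := by
    obtain ⟨θ, hθ, rfl⟩ := exists_mem_ball_inner_eq y hS hz
    exact hA.curvature_pos.le.trans (inv_kappa_le_slope hA ht hy hθ)
  le z hz := by
    obtain ⟨θ, hθ, rfl⟩ := exists_mem_ball_inner_eq y hS hz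
    exact hA.slope_le t ht y hy θ hθ
  self_concordant z hz := by
    obtain ⟨θ, hθ, rfl⟩ := exists_mem_ball_inner_eq y hS hz
    exact hA.self_concordant t ht y hy θ hθ

end Arms

/-- Admissible inputs of the learner. -/
structure Params.Pos (p : Params) : Prop where
  S_pos : 0 < p.S
  L_pos : 0 < p.L
  R_nonneg : 0 ≤ p.R
  δ_pos : 0 < p.δ
  δ_lt : p.δ < 1
  α_pos : 0 < p.α
  C_nonneg : 0 ≤ p.C

namespace Params.Pos

variable {p : Params} (hp : p.Pos) {d : ℕ}

include hp

lemma one_le_η : 1 ≤ p.η := by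
  have := mul_nonneg hp.R_nonneg hp.S_pos.le
  unfold Params.η; linarith

lemma lam_pos (hd : 1 ≤ d) : 0 < p.lam d := by
  have hd' : (0 : ℝ) < d := by exact_mod_cast hd
  have := hp.S_pos
  exact lt_of_lt_of_le (by positivity) (le_max_right _ _)

lemma log_inv_δ_pos : 0 < Real.log (1 / p.δ) :=
  Real.log_pos ((one_lt_div hp.δ_pos).2 hp.δ_lt)

/-- The radicand of `β`. -/
lemma β_sq (hd : 1 ≤ d) {γ : ℕ → ℝ} {t : ℕ} (hγ : ∀ s ∈ Finset.Ico 1 t, 0 < γ s) :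
    p.β d γ t ^ 2 = 2 * p.η * Real.log (1 / p.δ)
      + d * (6 * p.η ^ 2 + p.η) * Real.log (1 + ∑ s ∈ Finset.Ico 1 t, p.L / (p.lam d * γ s))
      + 4 * p.lam d * p.S ^ 2 := by
  have h1 := hp.one_le_η
  have h2 := hp.lam_pos hd
  have h3 := hp.log_inv_δ_pos
  have h5 := hp.L_pos
  have h4 : 0 ≤ Real.log (1 + ∑ s ∈ Finset.Ico 1 t, p.L / (p.lam d * γ s)) := by
    apply Real.log_nonneg
    have : 0 ≤ ∑ s ∈ Finset.Ico 1 t, p.L / (p.lam d * γ s) :=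
      Finset.sum_nonneg fun s hs => by have := hγ s hs; positivity
    linarith
  exact Real.sq_sqrt (by positivity)

lemma β_mono (hd : 1 ≤ d) {γ : ℕ → ℝ} {s t : ℕ} (hst : s ≤ t)
    (hγ : ∀ s ∈ Finset.Ico 1 t, 0 < γ s) : p.β d γ s ≤ p.β d γ t := by
  have h1 := hp.one_le_η
  have h2 := hp.lam_pos hd
  have h5 := hp.L_pos
  have hsub : Finset.Ico 1 s ⊆ Finset.Ico 1 t := Finset.Ico_subset_Ico_right hst
  have h0 : 0 ≤ ∑ u ∈ Finset.Ico 1 s, p.L / (p.lam d * γ u) :=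
    Finset.sum_nonneg fun u hu => by have := hγ u (hsub hu); positivity
  have hsum : ∑ u ∈ Finset.Ico 1 s, p.L / (p.lam d * γ u)
      ≤ ∑ u ∈ Finset.Ico 1 t, p.L / (p.lam d * γ u) :=
    Finset.sum_le_sum_of_subset_of_nonneg hsub fun u hu _ => by have := hγ u hu; positivity
  unfold Params.β
  gcongr

end Params.Pos

/-! ### A run of the algorithm -/

/-- A run of the algorithm under the standing assumptions, for a fixed outcome. -/
structure RunData {d : ℕ} (M : GLM d) (p : Params) (T : ℕ) (X : ℕ → Set (Vec d))
    (x θ : ℕ → Vec d) (r c : ℕ → ℝ) (H : ℕ → Vec d →L[ℝ] Vec d) : Prop where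
  one_le_d : 1 ≤ d
  valid : M.Valid p.S T
  arms : M.ValidArms p.S p.L p.R T X
  pos : p.Pos
  run : IsRun M p T X x (fun t => r t + c t) θ H

/-- The confidence weight of round `t`. -/
def roundWeight {d : ℕ} (M : GLM d) (p : Params) (x : ℕ → Vec d) (H : ℕ → Vec d →L[ℝ] Vec d)
    (t : ℕ) : ℝ := weight p.α (M.disp t) (H t) (x t)

/-- The curvature added to `H` in round `t`. -/
def roundCurv {d : ℕ} (M : GLM d) (p : Params) (x θ : ℕ → Vec d) (H : ℕ → Vec d →L[ℝ] Vec d)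
    (t : ℕ) : ℝ :=
  roundWeight M p x H t / M.disp t * slope M.m (inner ℝ (x t) (θ (t + 1)))

/-- The dual norm of the arm of round `t`. -/
def roundWidth {d : ℕ} (x : ℕ → Vec d) (H : ℕ → Vec d →L[ℝ] Vec d) (t : ℕ) : ℝ :=
  mnorm (H t).inverse (x t)

/-- The likelihood exponent of round `t`, as a function of the evaluation point. -/
def roundLog {d : ℕ} (M : GLM d) (p : Params) (x θ : ℕ → Vec d) (r : ℕ → ℝ)
    (H : ℕ → Vec d →L[ℝ] Vec d) (t : ℕ) (z : ℝ) : ℝ :=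
  stepLog M.m (M.disp t) p.η (roundWeight M p x H t) (roundWidth x H t ^ 2)
    (inner ℝ (x t) M.θstar) (inner ℝ (x t) (θ t)) z (r t)

namespace RunData

variable {d : ℕ} {M : GLM d} {p : Params} {T : ℕ} {X : ℕ → Set (Vec d)}
  {x θ : ℕ → Vec d} {r c : ℕ → ℝ} {H : ℕ → Vec d →L[ℝ] Vec d}
  (h : RunData M p T X x θ r c H)

include h

lemma lam_pos : 0 < p.lam d := h.pos.lam_pos h.one_le_d

lemma mem_arms {t : ℕ} (ht : t ∈ Set.Icc 1 T) : x t ∈ X t := (h.run.select t ht).1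

lemma norm_le {t : ℕ} (ht : t ∈ Set.Icc 1 T) : ‖x t‖ ≤ 1 :=
  mem_ball_iff.1 (h.arms.arms t ht (h.mem_arms ht))

lemma disp_pos {t : ℕ} (ht : t ∈ Set.Icc 1 T) : 0 < M.disp t := h.valid.disp_pos t ht

lemma bounds {t : ℕ} (ht : t ∈ Set.Icc 1 T) : LinkBounds M.m p.L p.R (p.S * ‖x t‖) :=
  linkBounds h.arms h.pos.S_pos.le ht (h.mem_arms ht)

lemma θ_mem : ∀ t ∈ Set.Icc 1 (T + 1), θ t ∈ ball d p.S := by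
  intro t ht
  rcases Nat.lt_or_ge t 2 with h1 | h1
  · rw [show t = 1 by have := ht.1; lia]; exact h.run.init_θ
  · obtain ⟨s, rfl⟩ : ∃ s, t = s + 1 := ⟨t - 1, by lia⟩
    exact (h.run.update_θ s ⟨by lia, by have := ht.2; lia⟩).1

lemma weight_pos {t : ℕ} (ht : t ∈ Set.Icc 1 T) : 0 < roundWeight M p x H t :=
  HCW.weight_pos h.pos.α_pos (h.disp_pos ht) _ _

lemma slope_nonneg {t : ℕ} (ht : t ∈ Set.Icc 1 T) {ϑ : Vec d} (hϑ : ϑ ∈ ball d p.S) :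
    0 ≤ slope M.m (inner ℝ (x t) ϑ) := (h.bounds ht).nonneg _ (inner_mem_Icc _ hϑ)

lemma slope_le {t : ℕ} (ht : t ∈ Set.Icc 1 T) {ϑ : Vec d} (hϑ : ϑ ∈ ball d p.S) :
    slope M.m (inner ℝ (x t) ϑ) ≤ p.L := (h.bounds ht).le _ (inner_mem_Icc _ hϑ)

lemma curv_nonneg {t : ℕ} (ht : t ∈ Set.Icc 1 T) : 0 ≤ roundCurv M p x θ H t := by
  have h1 := h.weight_pos ht
  have h2 := h.disp_pos ht
  have h3 := h.slope_nonneg ht (h.θ_mem (t + 1) ⟨by lia, by have := ht.2; lia⟩)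
  unfold roundCurv
  positivity

lemma curv_le {t : ℕ} (ht : t ∈ Set.Icc 1 T) : roundCurv M p x θ H t ≤ p.L / M.disp t := by
  have h1 := h.weight_pos ht
  have h2 := h.disp_pos ht
  have hmem := h.θ_mem (t + 1) ⟨by lia, by have := ht.2; lia⟩
  have h3 := h.slope_nonneg ht hmem
  have h4 := h.slope_le ht hmem
  have h5 : roundWeight M p x H t ≤ 1 := weight_le_one _ _
  unfold roundCurv
  calc roundWeight M p x H t / M.disp t * slope M.m (inner ℝ (x t) (θ (t + 1)))
      ≤ 1 / M.disp t * p.L := by gcongr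
    _ = _ := by ring

lemma update {t : ℕ} (ht : t ∈ Set.Icc 1 T) :
    H (t + 1) = H t + outer (roundCurv M p x θ H t) (x t) := by
  rw [h.run.update_H t ht, roundLoss, hessian_loss h.valid.diff_m _ _ _ _ h.valid.diff_link]
  rfl

lemma coercive : ∀ t ∈ Set.Icc 1 (T + 1), IsCoerciveSymm (p.lam d) (H t) := by
  intro t ht
  obtain ⟨s, rfl⟩ : ∃ s, t = s + 1 := ⟨t - 1, by have := ht.1; lia⟩
  have hs : s ≤ T := by have := ht.2; lia
  clear ht
  induction s with
  | zero => rw [h.run.init_H]; exact IsCoerciveSymm.smul_id _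
  | succ s ih =>
    have hmem : s + 1 ∈ Set.Icc 1 T := ⟨by lia, hs⟩
    rw [h.update hmem]
    exact (ih (by lia)).add_outer (h.curv_nonneg hmem) _

lemma coercive' {t : ℕ} (ht : t ∈ Set.Icc 1 T) : IsCoerciveSymm (p.lam d) (H t) :=
  h.coercive t ⟨ht.1, by have := ht.2; lia⟩

lemma width_sq_le {t : ℕ} (ht : t ∈ Set.Icc 1 T) : roundWidth x H t ^ 2 ≤ 1 / p.lam d := by
  have hl := h.lam_pos
  refine ((h.coercive' ht).mnorm_inverse_sq_le hl (x t)).trans ?_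
  gcongr
  exact pow_le_one₀ (norm_nonneg _) (h.norm_le ht)

lemma det_trace : ∀ t ≤ T,
    LinearMap.det (H (t + 1)).toLinearMap
      = p.lam d ^ d * ∏ s ∈ Finset.Icc 1 t, (1 + roundCurv M p x θ H s * roundWidth x H s ^ 2) ∧
    LinearMap.trace ℝ (Vec d) (H (t + 1)).toLinearMap
      = d * p.lam d + ∑ s ∈ Finset.Icc 1 t, roundCurv M p x θ H s * ‖x s‖ ^ 2
  | 0, _ => by
    rw [h.run.init_H]
    simp [LinearMap.det_smul, mul_comm]
  | t + 1, ht => by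
    have ih := det_trace t (by lia)
    have hmem : t + 1 ∈ Set.Icc 1 T := ⟨by lia, ht⟩
    rw [h.update hmem, (h.coercive' hmem).det_add_outer h.lam_pos, IsCoerciveSymm.trace_add_outer,
      ih.1, ih.2, Finset.prod_Icc_succ_top (by lia), Finset.sum_Icc_succ_top (by lia)]
    exact ⟨by rw [mul_assoc]; rfl, by rw [add_assoc]⟩

/-- The elliptical potential lemma. -/
lemma sum_log_le {t : ℕ} (ht : t ≤ T) :
    ∑ s ∈ Finset.Icc 1 t, Real.log (1 + roundCurv M p x θ H s * roundWidth x H s ^ 2)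
      ≤ d * Real.log (1 + ∑ s ∈ Finset.Icc 1 t, p.L / (p.lam d * M.disp s)) := by
  have hl := h.lam_pos
  have hd : (1 : ℝ) ≤ d := by exact_mod_cast h.one_le_d
  have hmem : ∀ s ∈ Finset.Icc 1 t, s ∈ Set.Icc 1 T := fun s hs => by
    rw [Finset.mem_Icc] at hs; exact ⟨hs.1, hs.2.trans ht⟩
  have h1 := ((h.coercive (t + 1) ⟨by lia, by lia⟩).log_det_le h.one_le_d hl).2
  rw [(h.det_trace t ht).1, (h.det_trace t ht).2, mul_div_cancel_left₀ _ (pow_pos hl d).ne',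
    Real.log_prod] at h1
  · refine h1.trans ?_
    have h2 : 0 ≤ ∑ s ∈ Finset.Icc 1 t, roundCurv M p x θ H s * ‖x s‖ ^ 2 :=
      Finset.sum_nonneg fun s hs => mul_nonneg (h.curv_nonneg (hmem s hs)) (sq_nonneg _)
    have h3 : ∑ s ∈ Finset.Icc 1 t, roundCurv M p x θ H s * ‖x s‖ ^ 2
        ≤ p.lam d * ∑ s ∈ Finset.Icc 1 t, p.L / (p.lam d * M.disp s) := by
      rw [Finset.mul_sum]
      refine Finset.sum_le_sum fun s hs => ?_
      have h4 := h.curv_le (hmem s hs)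
      have h5 := h.curv_nonneg (hmem s hs)
      have h6 := h.disp_pos (hmem s hs)
      calc roundCurv M p x θ H s * ‖x s‖ ^ 2 ≤ roundCurv M p x θ H s * 1 := by
            gcongr; exact pow_le_one₀ (norm_nonneg _) (h.norm_le (hmem s hs))
        _ ≤ p.L / M.disp s := by rwa [mul_one]
        _ = _ := by field_simp
    gcongr
    rw [div_le_iff₀ (by positivity)]
    have h7 : 0 ≤ ∑ s ∈ Finset.Icc 1 t, p.L / (p.lam d * M.disp s) := by
      by_contra hc
      push Not at hc
      nlinarith
    nlinarith [mul_nonneg hl.le h7, mul_nonneg (sub_nonneg.2 hd) (mul_nonneg hl.le h7)]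
  · intro s hs
    have := mul_nonneg (h.curv_nonneg (hmem s hs)) (sq_nonneg (roundWidth x H s))
    linarith

/-- The deterministic bound on the distance to the true parameter. -/
lemma dist_sq_le : ∀ t ≤ T, mnorm (H (t + 1)) (M.θstar - θ (t + 1)) ^ 2 ≤ 4 * p.lam d * p.S ^ 2
      + 2 * p.η * ∑ s ∈ Finset.Icc 1 t, roundLog M p x θ r H s (inner ℝ (x s) (θ (s + 1)))
      + (6 * p.η ^ 2 + p.η) * ∑ s ∈ Finset.Icc 1 t,
          Real.log (1 + roundCurv M p x θ H s * roundWidth x H s ^ 2)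
      + 2 * p.η * p.α * ∑ s ∈ Finset.Icc 1 t,
          |c s| * mnorm (H (s + 1)) (M.θstar - θ (s + 1))
  | 0, _ => by
    have hl := h.lam_pos
    have hS := h.pos.S_pos
    rw [h.run.init_H, (IsCoerciveSymm.smul_id _).mnorm_sq hl.le]
    have h1 : ‖M.θstar - θ 1‖ ≤ 2 * p.S := by
      refine (norm_sub_le _ _).trans ?_
      have h2 := mem_ball_iff.1 h.valid.θstar_mem
      have h3 := mem_ball_iff.1 h.run.init_θ
      linarith
    simp only [zero_add, smul_apply, ContinuousLinearMap.id_apply,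
      real_inner_smul_right, real_inner_self_eq_norm_sq, Finset.Icc_eq_empty (by lia : ¬ 1 ≤ 0),
      Finset.sum_empty, mul_zero, add_zero]
    calc p.lam d * ‖M.θstar - θ 1‖ ^ 2 ≤ p.lam d * (2 * p.S) ^ 2 := by gcongr
      _ = _ := by ring
  | t + 1, ht => by
    have ih := dist_sq_le t (by lia)
    have hmem : t + 1 ∈ Set.Icc 1 T := ⟨by lia, ht⟩
    have hstep := omd_step (w := roundWeight M p x H (t + 1)) (r := r (t + 1)) (c := c (t + 1))
      h.valid.diff_m h.valid.diff_link h.valid.diff_slope (h.coercive' hmem) h.lam_pos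
      (rfl : p.η = 1 + p.R * p.S) h.pos.R_nonneg h.pos.S_pos h.pos.L_pos (h.disp_pos hmem)
      (h.weight_pos hmem).le (weight_div_mul_le h.pos.α_pos (h.disp_pos hmem) _ _)
      ((le_max_right _ _).trans (le_max_left _ _)) (h.norm_le hmem) (h.bounds hmem)
      (h.θ_mem (t + 1) ⟨by lia, by lia⟩) (h.θ_mem (t + 1 + 1) ⟨by lia, by lia⟩)
      h.valid.θstar_mem (h.run.update_θ (t + 1) hmem).2
    change mnorm (H (t + 1) + outer (roundCurv M p x θ H (t + 1)) (x (t + 1))) _ ^ 2 ≤ _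
      + 2 * p.η * (roundLog M p x θ r H (t + 1) (inner ℝ (x (t + 1)) (θ (t + 1 + 1)))
        + (3 * p.η + 1 / 2) * Real.log (1 + roundCurv M p x θ H (t + 1)
          * roundWidth x H (t + 1) ^ 2)) + 2 * p.η * p.α * |c (t + 1)|
        * mnorm (H (t + 1) + outer (roundCurv M p x θ H (t + 1)) (x (t + 1))) _ at hstep
    rw [← h.update hmem] at hstep
    simp only [Finset.sum_Icc_succ_top (by lia : 1 ≤ t + 1)]
    linarith

/-- If the likelihood exponents stay below the level `log (1 / δ)` and the corruption within its
budget, the true parameter is in all confidence sets. -/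
theorem mem_confSet
    (hlog : ∀ t ≤ T, ∑ s ∈ Finset.Icc 1 t, roundLog M p x θ r H s (inner ℝ (x s) (θ (s + 1)))
      ≤ Real.log (1 / p.δ))
    (hc : ∑ t ∈ Finset.Icc 1 T, |c t| ≤ p.C) :
    ∀ t ≤ T, M.θstar ∈ p.confSet M.disp (t + 1) (θ (t + 1)) (H (t + 1)) := by
  intro t
  induction t using Nat.strong_induction_on with
  | _ t ih =>
  intro ht
  refine ⟨h.valid.θstar_mem, ?_⟩
  have hη := h.pos.one_le_η
  have hα := h.pos.α_pos
  have hC := h.pos.C_nonneg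
  have hγ : ∀ s ∈ Finset.Ico 1 (t + 1), 0 < M.disp s := fun s hs => by
    rw [Finset.mem_Ico] at hs; exact h.disp_pos ⟨hs.1, by lia⟩
  have hβ := h.pos.β_sq h.one_le_d hγ
  have hβ0 : 0 ≤ p.β d M.disp (t + 1) := Real.sqrt_nonneg _
  set β := p.β d M.disp (t + 1) with hβdef
  set D := mnorm (H (t + 1)) (M.θstar - θ (t + 1)) with hD
  have hD0 : 0 ≤ D := mnorm_nonneg _ _
  by_contra hcon
  push Not at hcon
  have hIco : Finset.Ico 1 (t + 1) = Finset.Icc 1 t := by ext; simp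
  have h1 := h.dist_sq_le t ht
  have h2 := h.sum_log_le ht
  have h3 := hlog t ht
  have h4 : ∑ s ∈ Finset.Icc 1 t, |c s| * mnorm (H (s + 1)) (M.θstar - θ (s + 1)) ≤ p.C * D := by
    have hsub : Finset.Icc 1 t ⊆ Finset.Icc 1 T := Finset.Icc_subset_Icc_right ht
    calc ∑ s ∈ Finset.Icc 1 t, |c s| * mnorm (H (s + 1)) (M.θstar - θ (s + 1))
        ≤ ∑ s ∈ Finset.Icc 1 t, |c s| * D := by
          refine Finset.sum_le_sum fun s hs => ?_
          rw [Finset.mem_Icc] at hs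
          gcongr
          rcases hs.2.eq_or_lt with rfl | hlt
          · exact le_rfl
          · have h5 := (ih s hlt (by lia)).2
            have h6 := h.pos.β_mono h.one_le_d (by lia : s + 1 ≤ t + 1) hγ
            linarith
      _ = (∑ s ∈ Finset.Icc 1 t, |c s|) * D := by rw [Finset.sum_mul]
      _ ≤ (∑ s ∈ Finset.Icc 1 T, |c s|) * D := by
          gcongr
      _ ≤ p.C * D := by gcongr
  rw [hIco] at hβ
  have h5 : D ^ 2 ≤ β ^ 2 + 2 * p.η * p.α * p.C * D := by
    have e1 := mul_le_mul_of_nonneg_left h2 (by positivity : 0 ≤ 6 * p.η ^ 2 + p.η)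
    have e2 := mul_le_mul_of_nonneg_left h3 (by positivity : 0 ≤ 2 * p.η)
    have e3 := mul_le_mul_of_nonneg_left h4 (by positivity : 0 ≤ 2 * p.η * p.α)
    rw [hβ]
    linarith
  have h6 : 0 ≤ 2 * p.η * p.α * p.C := by positivity
  nlinarith

end RunData

/-! ### The confidence event -/

lemma isProbabilityMeasure_expLaw {d : ℕ} {M : GLM d} {S : ℝ} {T : ℕ} (hd : 1 ≤ d)
    (hV : M.Valid S T) {t : ℕ} (ht : t ∈ Set.Icc 1 T) (z : ℝ) :
    IsProbabilityMeasure (expLaw (M.ν (M.τ t)) M.m (M.disp t) z) := by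
  have h := hV.normalized t ht (EuclideanSpace.single ⟨0, hd⟩ z) (EuclideanSpace.single ⟨0, hd⟩ 1)
  have e : inner ℝ (EuclideanSpace.single (⟨0, hd⟩ : Fin d) (1 : ℝ))
      (EuclideanSpace.single ⟨0, hd⟩ z) = z := by
    rw [EuclideanSpace.inner_single_left]; simp
  have h2 : IsProbabilityMeasure (expLaw (M.ν (M.τ t)) M.m (M.disp t)
    (inner ℝ (EuclideanSpace.single (⟨0, hd⟩ : Fin d) (1 : ℝ))
      (EuclideanSpace.single ⟨0, hd⟩ z))) := h
  rwa [e] at h2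

lemma measurable_stepSup_comp {Ω : Type*} {𝓕 : MeasurableSpace Ω} {m : ℝ → ℝ} (hm : Measurable m)
    (hm'' : Measurable (slope m)) (g η : ℝ) {A w σ₂ z₁ z₀ r : Ω → ℝ} (hA : Measurable A)
    (hw : Measurable w) (hσ : Measurable σ₂) (hz₁ : Measurable z₁) (hz₀ : Measurable z₀)
    (hr : Measurable r) :
    Measurable fun ω => stepSup m g η (A ω) (w ω) (σ₂ ω) (z₁ ω) (z₀ ω) (r ω) := by
  unfold stepSup stepLog clamp
  refine Measurable.iSup fun q => ?_
  fun_prop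

/-- The one-round supremum in round `t` of a run. -/
def roundSup {d : ℕ} (M : GLM d) (p : Params) (x θ : ℕ → Vec d)
    (H : ℕ → Vec d →L[ℝ] Vec d) (t : ℕ) (s : ℝ) : ENNReal :=
  stepSup M.m (M.disp t) p.η (p.S * ‖x t‖) (roundWeight M p x H t) (roundWidth x H t ^ 2)
    (inner ℝ (x t) M.θstar) (inner ℝ (x t) (θ t)) s

namespace RunData

variable {d : ℕ} {M : GLM d} {p : Params} {T : ℕ} {X : ℕ → Set (Vec d)}
  {x θ : ℕ → Vec d} {r c : ℕ → ℝ} {H : ℕ → Vec d →L[ℝ] Vec d}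
  (h : RunData M p T X x θ r c H)

include h

lemma roundLog_le_roundSup {t : ℕ} (ht : t ∈ Set.Icc 1 T) :
    ENNReal.ofReal (Real.exp (roundLog M p x θ r H t (inner ℝ (x t) (θ (t + 1)))))
      ≤ roundSup M p x θ H t (r t) :=
  le_stepSup h.valid.diff_m.continuous h.valid.diff_slope.continuous (h.disp_pos ht)
    (h.weight_pos ht).le (sq_nonneg _) (h.bounds ht).nonneg _ _ _
    (inner_mem_Icc _ (h.θ_mem (t + 1) ⟨by lia, by have := ht.2; lia⟩))

lemma lintegral_roundSup_le {t : ℕ} (ht : t ∈ Set.Icc 1 T) :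
    ∫⁻ s, roundSup M p x θ H t s
      ∂(expLaw (M.ν (M.τ t)) M.m (M.disp t) (inner ℝ (x t) M.θstar)) ≤ 1 := by
  have hnorm := isProbabilityMeasure_expLaw h.one_le_d h.valid ht
  have hl := h.lam_pos
  have hη := h.pos.one_le_η
  have hd : (1 : ℝ) ≤ d := by exact_mod_cast h.one_le_d
  have hL := h.pos.L_pos
  have hR := h.pos.R_nonneg
  have hS := h.pos.S_pos
  have hα := h.pos.α_pos
  have hθ := h.θ_mem t ⟨ht.1, by have := ht.2; lia⟩
  unfold roundSup
  rcases (mnorm_nonneg (H t).inverse (x t)).eq_or_lt with h0 | h0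
  · have hx := (h.coercive' ht).eq_zero_of_mnorm_inverse hl _ h0.symm
    have := hnorm 0
    have e : roundWidth x H t = 0 := h0.symm
    simp [hx, e, stepSup_zero]
  · have hσ : 0 < roundWidth x H t := h0
    have hσ2 := h.width_sq_le ht
    have hle : ∀ q ≤ p.lam d, q * roundWidth x H t ^ 2 ≤ 1 := fun q hq => by
      calc q * roundWidth x H t ^ 2 ≤ p.lam d * (1 / p.lam d) := by gcongr
        _ = 1 := by field_simp
    refine lintegral_stepSup_le hnorm h.valid.diff_m h.valid.diff_link h.valid.diff_slope
      (h.disp_pos ht) hR hη (inner_mem_Icc _ hθ) (h.bounds ht).nonneg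
      (h.bounds ht).self_concordant (h.weight_pos ht) (weight_le_one _ _) (by positivity) ?_ ?_
    · refine hle _ (le_trans ?_ ((le_max_left _ _).trans (le_max_left _ _)))
      nlinarith [mul_nonneg (sub_nonneg.2 hd) (by positivity : 0 ≤ 14 * p.η * p.R ^ 2)]
    · have h1 : (6 * p.η * p.α * p.R * p.S * p.L * roundWidth x H t) ^ 2 ≤ 1 ^ 2 := by
        have := hle _ ((le_max_right (14 * d * p.η * p.R ^ 2) _).trans (le_max_left _ (d / (4 * p.S ^ 2))))
        calc _ = 36 * p.η ^ 2 * p.α ^ 2 * p.R ^ 2 * p.S ^ 2 * p.L ^ 2 * roundWidth x H t ^ 2 := by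
              ring
          _ ≤ 1 ^ 2 := by rwa [one_pow]
      have h2 := le_of_sq_le_sq h1 zero_le_one
      have h3 : roundWeight M p x H t / M.disp t * roundWidth x H t ≤ p.α :=
        weight_div_mul_le hα (h.disp_pos ht) _ _
      have h4 := h.slope_le ht hθ
      have h5 := h.slope_nonneg ht hθ
      have h6 := h.weight_pos ht
      have h7 := h.disp_pos ht
      have e : p.η - 1 = p.R * p.S := by unfold Params.η; ring
      rw [e]
      calc 6 * p.η * (p.R * p.S) * (slope M.m (inner ℝ (x t) (θ t))
            * (roundWeight M p x H t * roundWidth x H t ^ 2) / M.disp t)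
          = 6 * p.η * (p.R * p.S) * roundWidth x H t * (slope M.m (inner ℝ (x t) (θ t))
            * (roundWeight M p x H t / M.disp t * roundWidth x H t)) := by ring
        _ ≤ 6 * p.η * (p.R * p.S) * roundWidth x H t * (p.L * p.α) := by gcongr
        _ = 6 * p.η * p.α * p.R * p.S * p.L * roundWidth x H t := by ring
        _ ≤ 1 := h2

end RunData

section Event

variable {d : ℕ} {M : GLM d} {p : Params} {T : ℕ} {Ω : Type*} {mΩ : MeasurableSpace Ω}
  {P : Measure Ω} {𝓖 : Filtration ℕ mΩ} {X : ℕ → Ω → Set (Vec d)} {x θ : ℕ → Ω → Vec d}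
  {r c : ℕ → Ω → ℝ} {H : ℕ → Ω → Vec d →L[ℝ] Vec d}

lemma measurable_roundWidth_of {t : ℕ} (ht : t ∈ Set.Icc 1 T)
    (hE : IsEnvironment M P 𝓖 T p.C x θ r c)
    (hrun : ∀ ω, RunData M p T (fun t => X t ω) (fun t => x t ω) (fun t => θ t ω)
      (fun t => r t ω) (fun t => c t ω) (fun t => H t ω))
    (hH : ∀ v, Measurable[𝓖 t] fun ω => inner ℝ v (H t ω v)) :
    Measurable[𝓖 t] fun ω => roundWidth (fun t => x t ω) (fun t => H t ω) t := by
  have hx := hE.meas_x t ht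
  have e : (fun ω => roundWidth (fun t => x t ω) (fun t => H t ω) t) = fun ω =>
      √(⨆ n : ℕ, (2 * inner ℝ (x t ω) (TopologicalSpace.denseSeq (Vec d) n)
        - inner ℝ (TopologicalSpace.denseSeq (Vec d) n)
          (H t ω (TopologicalSpace.denseSeq (Vec d) n)))) := by
    funext ω
    rw [← ((hrun ω).coercive' ht).mnorm_inverse_sq_eq_iSup (hrun ω).lam_pos,
      Real.sqrt_sq (mnorm_nonneg _ _)]
    rfl
  rw [e]
  refine Measurable.sqrt (Measurable.iSup fun n => ?_)
  exact ((hx.inner measurable_const).const_mul 2).sub (hH _)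

lemma measurable_roundWeight_of {t : ℕ}
    (hw : Measurable[𝓖 t] fun ω => roundWidth (fun t => x t ω) (fun t => H t ω) t) :
    Measurable[𝓖 t] fun ω => roundWeight M p (fun t => x t ω) (fun t => H t ω) t := by
  unfold roundWeight weight
  refine Measurable.ite (hw (measurableSet_singleton 0)) measurable_const ?_
  exact measurable_const.min (measurable_const.div hw)

lemma measurable_inner_H (hE : IsEnvironment M P 𝓖 T p.C x θ r c)
    (hrun : ∀ ω, RunData M p T (fun t => X t ω) (fun t => x t ω) (fun t => θ t ω)
      (fun t => r t ω) (fun t => c t ω) (fun t => H t ω)) :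
    ∀ t ≤ T, ∀ v, Measurable[𝓖 (t + 1)] fun ω => inner ℝ v (H (t + 1) ω v)
  | 0, _, v => by
    have e : (fun ω => inner ℝ v (H (0 + 1) ω v)) = fun _ =>
        inner ℝ v ((p.lam d • ContinuousLinearMap.id ℝ (Vec d)) v) := by
      funext ω
      rw [(hrun ω).run.init_H]
    rw [e]
    exact measurable_const
  | t + 1, ht, v => by
    have ih := measurable_inner_H hE hrun t (by lia)
    have hmem : t + 1 ∈ Set.Icc 1 T := ⟨by lia, ht⟩
    have hle := 𝓖.mono (by lia : t + 1 ≤ t + 1 + 1)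
    have hw : Measurable[𝓖 (t + 1 + 1)] _ :=
      (measurable_roundWeight_of (M := M) (p := p)
        (measurable_roundWidth_of hmem hE hrun ih)).mono hle le_rfl
    have hx : Measurable[𝓖 (t + 1 + 1)] _ := (hE.meas_x (t + 1) hmem).mono hle le_rfl
    have hθ := hE.meas_θ (t + 1 + 1) ⟨by lia, by lia⟩
    have e : (fun ω => inner ℝ v (H (t + 1 + 1) ω v)) = fun ω => inner ℝ v (H (t + 1) ω v)
        + roundWeight M p (fun t => x t ω) (fun t => H t ω) (t + 1) / M.disp (t + 1)
          * slope M.m (inner ℝ (x (t + 1) ω) (θ (t + 1 + 1) ω)) * inner ℝ (x (t + 1) ω) v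
          * inner ℝ (x (t + 1) ω) v := by
      funext ω
      rw [(hrun ω).update hmem, add_apply, inner_add_right, IsCoerciveSymm.inner_outer]
      rfl
    rw [e]
    have hslope : Measurable (slope M.m) := measurable_deriv _
    exact ((ih v).mono hle le_rfl).add ((((hw.div_const _).mul
      (hslope.comp (hx.inner hθ))).mul (hx.inner measurable_const)).mul
        (hx.inner measurable_const))

/-- With probability at least `1 - δ` the likelihood exponents stay below `log (1 / δ)` and the
corruption stays within its budget. -/
theorem exists_event [IsProbabilityMeasure P] (hd : 1 ≤ d) (hV : M.Valid p.S T) (hp : p.Pos)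
    (hE : IsEnvironment M P 𝓖 T p.C x θ r c)
    (hrun : ∀ ω, RunData M p T (fun t => X t ω) (fun t => x t ω) (fun t => θ t ω)
      (fun t => r t ω) (fun t => c t ω) (fun t => H t ω)) :
    ∃ A : Set Ω, MeasurableSet A ∧ 1 - p.δ ≤ P.real A ∧ ∀ ω ∈ A,
      (∀ t ≤ T, ∑ s ∈ Finset.Icc 1 t, roundLog M p (fun t => x t ω) (fun t => θ t ω)
        (fun t => r t ω) (fun t => H t ω) s (inner ℝ (x s ω) (θ (s + 1) ω))
          ≤ Real.log (1 / p.δ)) ∧ ∑ t ∈ Finset.Icc 1 T, |c t ω| ≤ p.C := by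
  have hm : Measurable M.m := hV.diff_m.continuous.measurable
  have hslope : Measurable (slope M.m) := measurable_deriv _
  have hwidth : ∀ t ∈ Set.Icc 1 T,
      Measurable[𝓖 t] fun ω => roundWidth (fun t => x t ω) (fun t => H t ω) t := by
    intro t ht
    obtain ⟨s, rfl⟩ : ∃ s, t = s + 1 := ⟨t - 1, by have := ht.1; lia⟩
    exact measurable_roundWidth_of ht hE hrun
      (measurable_inner_H hE hrun s (by have := ht.2; lia))
  set W : ℕ → Ω → ENNReal := fun t ω => roundSup M p (fun t => x t ω) (fun t => θ t ω)
    (fun t => H t ω) t (r t ω) with hWdef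
  have hA : ∀ t ∈ Set.Icc 1 T, Measurable[𝓖 t] fun ω => p.S * ‖x t ω‖ := fun t ht =>
    (measurable_norm.comp (hE.meas_x t ht)).const_mul _
  have hw : ∀ t ∈ Set.Icc 1 T,
      Measurable[𝓖 t] fun ω => roundWeight M p (fun t => x t ω) (fun t => H t ω) t :=
    fun t ht => measurable_roundWeight_of (hwidth t ht)
  have hσ : ∀ t ∈ Set.Icc 1 T,
      Measurable[𝓖 t] fun ω => roundWidth (fun t => x t ω) (fun t => H t ω) t ^ 2 :=
    fun t ht => by simp only [sq]; exact (hwidth t ht).mul (hwidth t ht)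
  have hz₁ : ∀ t ∈ Set.Icc 1 T, Measurable[𝓖 t] fun ω => (inner ℝ (x t ω) M.θstar : ℝ) :=
    fun t ht => (hE.meas_x t ht).inner measurable_const
  have hz₀ : ∀ t ∈ Set.Icc 1 T, Measurable[𝓖 t] fun ω => (inner ℝ (x t ω) (θ t ω) : ℝ) :=
    fun t ht => (hE.meas_x t ht).inner (hE.meas_θ t ⟨ht.1, by have := ht.2; lia⟩)
  have hWm : ∀ t ∈ Set.Icc 1 T, Measurable[𝓖 (t + 1)] (W t) := by
    intro t ht
    have hle := 𝓖.mono (by lia : t ≤ t + 1)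
    simp only [hWdef, roundSup]
    exact measurable_stepSup_comp hm hslope (M.disp t) p.η ((hA t ht).mono hle le_rfl)
      ((hw t ht).mono hle le_rfl) ((hσ t ht).mono hle le_rfl) ((hz₁ t ht).mono hle le_rfl)
      ((hz₀ t ht).mono hle le_rfl) (hE.meas_r t ht)
  have hstep : ∀ t ∈ Set.Icc 1 T, ∀ φ : Ω → ENNReal, Measurable[𝓖 t] φ →
      ∫⁻ ω, φ ω * W t ω ∂P ≤ ∫⁻ ω, φ ω ∂P := by
    intro t ht φ hφ
    have hlaw : ∀ B : Set ℝ, MeasurableSet B →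
        P[(r t ⁻¹' B).indicator (fun _ => (1 : ℝ)) | 𝓖 t] =ᵐ[P] fun ω =>
          (expLaw (M.ν (M.τ t)) M.m (M.disp t) (inner ℝ (x t ω) M.θstar)).real B :=
      hE.reward_law t ht
    have hle := fun ω => (hrun ω).lintegral_roundSup_le ht
    have hr : Measurable (r t) := (hE.meas_r t ht).mono (𝓖.le _) le_rfl
    simp only [hWdef, roundSup] at hle ⊢
    exact lintegral_mul_stepSup_le (𝓖.le t) (isProbabilityMeasure_expLaw hd hV ht) hm hslope
      (hA t ht) (hw t ht) (hσ t ht) (hz₀ t ht) (hz₁ t ht) hr hlaw hle hφ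
  obtain ⟨A, hAm, hAP, hAW⟩ := exists_measurableSet_prod_lt hWm hstep hp.δ_pos
  obtain ⟨N, hN, hNm, hN0⟩ := exists_measurable_superset_of_null (ae_iff.1 hE.budget)
  refine ⟨A \ N, hAm.diff hNm, ?_, fun ω hω => ⟨fun t ht => ?_, ?_⟩⟩
  · rw [measureReal_def, measure_sdiff_null hN0, ← measureReal_def]
    exact hAP
  · have h1 := hAW ω hω.1 t ht
    have hmem : ∀ s ∈ Finset.Icc 1 t, s ∈ Set.Icc 1 T := fun s hs => by
      rw [Finset.mem_Icc] at hs; exact ⟨hs.1, hs.2.trans ht⟩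
    have h2 : ENNReal.ofReal (Real.exp (∑ s ∈ Finset.Icc 1 t, roundLog M p (fun t => x t ω)
        (fun t => θ t ω) (fun t => r t ω) (fun t => H t ω) s (inner ℝ (x s ω) (θ (s + 1) ω))))
        ≤ ∏ s ∈ Finset.Icc 1 t, W s ω := by
      rw [Real.exp_sum, ENNReal.ofReal_prod_of_nonneg fun _ _ => (Real.exp_pos _).le]
      exact Finset.prod_le_prod' fun s hs => (hrun ω).roundLog_le_roundSup (hmem s hs)
    have h3 := (ENNReal.ofReal_lt_ofReal_iff (one_div_pos.2 hp.δ_pos)).1 (h2.trans_lt h1)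
    exact (Real.le_log_iff_exp_le (one_div_pos.2 hp.δ_pos)).2 h3.le
  · by_contra hcon
    exact hω.2 (hN hcon)

end Event

/-! ### Regret of a run -/

lemma sub_le_of_slope_le {m : ℝ → ℝ} (hm' : Differentiable ℝ (link m)) {l u a b K : ℝ}
    (hK : ∀ z ∈ Set.Icc l u, slope m z ≤ K) (ha : a ∈ Set.Icc l u) (hb : b ∈ Set.Icc l u)
    (hab : a ≤ b) : link m b - link m a ≤ K * (b - a) :=
  (convex_Icc l u).image_sub_le_mul_sub_of_deriv_le hm'.continuous.continuousOn
    hm'.differentiableOn (fun z hz => hK z (interior_subset hz)) a ha b hb hab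

lemma le_mul_log_one_add {v V : ℝ} (h0 : 0 ≤ v) (hV : v ≤ V) : v ≤ (1 + V) * Real.log (1 + v) := by
  have h1 : 0 < 1 + v := by linarith
  have h2 := Real.one_sub_inv_le_log_of_pos h1
  have h3 : v = (1 + v) * (1 - (1 + v)⁻¹) := by field_simp; ring
  have h4 : 0 ≤ 1 - (1 + v)⁻¹ := by
    rw [sub_nonneg]; exact inv_le_one_of_one_le₀ (by linarith)
  calc v = (1 + v) * (1 - (1 + v)⁻¹) := h3
    _ ≤ (1 + V) * Real.log (1 + v) := by
      have : 0 ≤ 1 + V := by linarith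
      gcongr

namespace RunData

variable {d : ℕ} {M : GLM d} {p : Params} {T : ℕ} {X : ℕ → Set (Vec d)}
  {x θ xs : ℕ → Vec d} {r c : ℕ → ℝ} {H : ℕ → Vec d →L[ℝ] Vec d}
  (h : RunData M p T X x θ r c H)

include h

lemma kappa_pos : 0 < M.kappa p.S T X := inv_pos.2 h.arms.curvature_pos

/-- Optimism: the gap of the linear scores is at most twice the confidence width. -/
lemma gap_le {t : ℕ} (ht : t ∈ Set.Icc 1 T) (hopt : M.IsOptimal T X xs)
    (hconf : M.θstar ∈ p.confSet M.disp t (θ t) (H t)) {γ : ℝ}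
    (hγ : p.β d M.disp t + 2 * p.η * p.α * p.C ≤ γ) :
    inner ℝ (xs t) M.θstar - inner ℝ (x t) M.θstar ≤ 2 * γ * roundWidth x H t := by
  obtain ⟨-, ϑ, hϑ, hmax⟩ := h.run.select t ht
  have h1 := hmax (xs t) (hopt t ht).1 M.θstar hconf
  have h2 := (h.coercive' ht).abs_inner_le h.lam_pos (x t) (ϑ - θ t)
  have h3 := (h.coercive' ht).abs_inner_le h.lam_pos (x t) (M.θstar - θ t)
  have hσ : 0 ≤ roundWidth x H t := mnorm_nonneg _ _
  have h4 := mul_le_mul_of_nonneg_left (hϑ.2.trans hγ) hσ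
  have h5 := mul_le_mul_of_nonneg_left (hconf.2.trans hγ) hσ
  rw [inner_sub_right] at h2 h3
  have h6 := (abs_le.1 h2).2
  have h7 := (abs_le.1 h3).1
  change _ ≤ roundWidth x H t * _ at h6
  change -(roundWidth x H t * _) ≤ _ at h7
  linarith

/-- Both the optimal and the selected scores lie in an interval where the link is regular. -/
lemma exists_interval {t : ℕ} (ht : t ∈ Set.Icc 1 T) (hopt : M.IsOptimal T X xs) :
    ∃ A ≤ p.S, LinkBounds M.m p.L p.R A ∧ (∀ ϑ ∈ ball d p.S, inner ℝ (x t) ϑ ∈ Set.Icc (-A) A) ∧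
      inner ℝ (xs t) M.θstar ∈ Set.Icc (-A) A := by
  have hS := h.pos.S_pos
  have hxs := (hopt t ht).1
  have n1 := h.norm_le ht
  have n2 := mem_ball_iff.1 (h.arms.arms t ht hxs)
  rcases le_total ‖x t‖ ‖xs t‖ with hle | hle
  · have hle' : p.S * ‖x t‖ ≤ p.S * ‖xs t‖ := by gcongr
    exact ⟨p.S * ‖xs t‖, by nlinarith, linkBounds h.arms hS.le ht hxs,
      fun ϑ hϑ => Set.Icc_subset_Icc (neg_le_neg hle') hle' (inner_mem_Icc _ hϑ),
      inner_mem_Icc _ h.valid.θstar_mem⟩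
  · have hle' : p.S * ‖xs t‖ ≤ p.S * ‖x t‖ := by gcongr
    exact ⟨p.S * ‖x t‖, by nlinarith, h.bounds ht, fun ϑ hϑ => inner_mem_Icc _ hϑ,
      Set.Icc_subset_Icc (neg_le_neg hle') hle' (inner_mem_Icc _ h.valid.θstar_mem)⟩

/-- The regret of a single round. -/
lemma round_regret_le {t : ℕ} (ht : t ∈ Set.Icc 1 T) (hopt : M.IsOptimal T X xs)
    (hconf : M.θstar ∈ p.confSet M.disp t (θ t) (H t)) {γ : ℝ}
    (hγ : p.β d M.disp t + 2 * p.η * p.α * p.C ≤ γ) :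
    link M.m (inner ℝ (xs t) M.θstar) - link M.m (inner ℝ (x t) M.θstar)
      ≤ 2 * γ * Real.exp (3 * p.R * p.S)
          * (√(M.disp t * slope M.m (inner ℝ (xs t) M.θstar))
            * √(roundCurv M p x θ H t * roundWidth x H t ^ 2))
        + 2 * p.L * γ * M.kappa p.S T X / p.α * (roundCurv M p x θ H t * roundWidth x H t ^ 2) := by
  have hS := h.pos.S_pos
  have hR := h.pos.R_nonneg
  have hL := h.pos.L_pos
  have hα := h.pos.α_pos
  have hη := h.pos.one_le_η
  have hκ := h.kappa_pos
  have hg := h.disp_pos ht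
  have hw := h.weight_pos ht
  have hcurv := h.curv_nonneg ht
  have hσ : 0 ≤ roundWidth x H t := mnorm_nonneg _ _
  have hγ0 : 0 ≤ γ := by
    have : 0 ≤ 2 * p.η * p.α * p.C := by have := h.pos.C_nonneg; positivity
    have : 0 ≤ p.β d M.disp t := Real.sqrt_nonneg _
    linarith
  have hgap := h.gap_le ht hopt hconf hγ
  obtain ⟨A, hAS, hb, hmem, hmems⟩ := h.exists_interval ht hopt
  set σ := roundWidth x H t
  set zs := inner ℝ (xs t) M.θstar
  set z := inner ℝ (x t) M.θstar
  have hz : z ∈ Set.Icc (-A) A := hmem _ h.valid.θstar_mem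
  have hz' := hmem _ (h.θ_mem (t + 1) ⟨by lia, by have := ht.2; lia⟩)
  have hslope' := inv_kappa_le_slope h.arms ht (h.mem_arms ht)
    (h.θ_mem (t + 1) ⟨by lia, by have := ht.2; lia⟩)
  set v := roundCurv M p x θ H t * σ ^ 2 with hv
  have hv0 : 0 ≤ v := by positivity
  have hs0 := hb.nonneg _ hmems
  have t1 : 0 ≤ 2 * γ * Real.exp (3 * p.R * p.S) * (√(M.disp t * slope M.m zs) * √v) := by
    positivity
  have t2 : 0 ≤ 2 * p.L * γ * M.kappa p.S T X / p.α * v := by positivity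
  rcases le_total zs z with hle | hle
  · have hmono : link M.m zs ≤ link M.m z := by
      have hm : MonotoneOn (link M.m) (Set.Icc (-A) A) :=
        monotoneOn_of_deriv_nonneg (convex_Icc _ _) h.valid.diff_link.continuous.continuousOn
          h.valid.diff_link.differentiableOn fun y hy => hb.nonneg y (interior_subset hy)
      exact hm hmems hz hle
    linarith
  have hexp : ∀ y ∈ Set.Icc (-A) A, ∀ y' ∈ Set.Icc (-A) A,
      slope M.m y ≤ slope M.m y' * Real.exp (2 * p.R * p.S) := by
    intro y hy y' hy'
    refine (le_mul_exp_of_abs_deriv_le h.valid.diff_slope hb.self_concordant hy' hy).trans ?_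
    have := hb.nonneg y' hy'
    have h3 : |y - y'| ≤ 2 * p.S := by
      rw [abs_le]; constructor <;> linarith [hy.1, hy.2, hy'.1, hy'.2]
    have h4 : p.R * |y - y'| ≤ 2 * p.R * p.S := by nlinarith
    gcongr
  rcases (weight_le_one (α := p.α) (g := M.disp t) (H t) (x t)).eq_or_lt with hw1 | hw1
  · have h1 : link M.m zs - link M.m z
        ≤ slope M.m zs * Real.exp (2 * p.R * p.S) * (2 * γ * σ) :=
      (sub_le_of_slope_le h.valid.diff_link (fun y hy => hexp y hy _ hmems) hz hmems hle).trans
        (by gcongr)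
    have h2 : slope M.m zs * σ
        ≤ √(M.disp t * slope M.m zs) * (Real.exp (p.R * p.S) * √v) := by
      have e1 : Real.exp (p.R * p.S) = √(Real.exp (2 * p.R * p.S)) := by
        rw [show 2 * p.R * p.S = p.R * p.S + p.R * p.S by ring, Real.exp_add,
          Real.sqrt_mul_self (Real.exp_pos _).le]
      rw [e1, ← Real.sqrt_mul (Real.exp_pos _).le, ← Real.sqrt_mul (by positivity)]
      apply Real.le_sqrt_of_sq_le
      have hw1' : roundWeight M p x H t = 1 := hw1
      have h3 := hexp _ hmems _ hz'
      calc (slope M.m zs * σ) ^ 2 = slope M.m zs * slope M.m zs * σ ^ 2 := by ring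
        _ ≤ slope M.m zs * (slope M.m (inner ℝ (x t) (θ (t + 1)))
            * Real.exp (2 * p.R * p.S)) * σ ^ 2 := by gcongr
        _ = M.disp t * slope M.m zs * (Real.exp (2 * p.R * p.S) * v) := by
            rw [hv, roundCurv, hw1']; field_simp
    have e3 : Real.exp (3 * p.R * p.S) = Real.exp (2 * p.R * p.S) * Real.exp (p.R * p.S) := by
      rw [← Real.exp_add]; ring_nf
    have h4 := mul_le_mul_of_nonneg_left h2
      (by positivity : 0 ≤ 2 * γ * Real.exp (2 * p.R * p.S))
    rw [e3] at t1 ⊢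
    linarith
  · have h1 : link M.m zs - link M.m z ≤ p.L * (2 * γ * σ) :=
      (sub_le_of_slope_le h.valid.diff_link hb.le hz hmems hle).trans (by gcongr)
    have h2 : roundWeight M p x H t * σ = p.α * M.disp t :=
      weight_mul_of_lt_one hα hg _ _ hw1
    have h3 : σ ≤ M.kappa p.S T X / p.α * v := by
      have e1 : σ = roundWeight M p x H t / M.disp t * σ ^ 2 / p.α := by
        have : roundWeight M p x H t / M.disp t * σ ^ 2 / p.α
          = roundWeight M p x H t * σ * σ / (M.disp t * p.α) := by field_simp
        rw [this, h2]; field_simp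
      have e2 : 1 ≤ M.kappa p.S T X * slope M.m (inner ℝ (x t) (θ (t + 1))) := by
        calc 1 = M.kappa p.S T X * sInf (M.slopes p.S T X) := by
              rw [GLM.kappa, inv_mul_cancel₀ h.arms.curvature_pos.ne']
          _ ≤ _ := by gcongr
      calc σ = 1 * (roundWeight M p x H t / M.disp t * σ ^ 2 / p.α) := by rw [one_mul]; exact e1
        _ ≤ M.kappa p.S T X * slope M.m (inner ℝ (x t) (θ (t + 1)))
            * (roundWeight M p x H t / M.disp t * σ ^ 2 / p.α) := by gcongr
        _ = _ := by rw [hv, roundCurv]; ring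
    have h4 := mul_le_mul_of_nonneg_left h3 (by positivity : 0 ≤ 2 * p.L * γ)
    have e4 : 2 * p.L * γ * (M.kappa p.S T X / p.α * v)
        = 2 * p.L * γ * M.kappa p.S T X / p.α * v := by ring
    linarith

lemma sum_curv_le {g₀ V : ℝ} (hg₀ : 0 < g₀) (hg : ∀ t ∈ Set.Icc 1 T, g₀ ≤ M.disp t)
    (hV : p.L / (g₀ * p.lam d) ≤ V) :
    ∑ t ∈ Finset.Icc 1 T, roundCurv M p x θ H t * roundWidth x H t ^ 2
      ≤ (1 + V) * (d * Real.log (1 + ∑ s ∈ Finset.Icc 1 T, p.L / (p.lam d * M.disp s))) := by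
  have hl := h.lam_pos
  have hL := h.pos.L_pos
  have hV0 : 0 ≤ V := le_trans (by positivity) hV
  refine le_trans ?_ (mul_le_mul_of_nonneg_left (h.sum_log_le le_rfl) (by linarith))
  rw [Finset.mul_sum]
  refine Finset.sum_le_sum fun t ht => ?_
  have ht' : t ∈ Set.Icc 1 T := by simpa using ht
  refine le_mul_log_one_add (mul_nonneg (h.curv_nonneg ht') (sq_nonneg _)) (le_trans ?_ hV)
  have h1 := h.curv_le ht'
  have h2 := h.width_sq_le ht'
  have h3 := hg t ht'
  calc roundCurv M p x θ H t * roundWidth x H t ^ 2 ≤ p.L / M.disp t * (1 / p.lam d) := by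
        have := h.disp_pos ht'
        gcongr
    _ ≤ p.L / g₀ * (1 / p.lam d) := by gcongr
    _ = _ := by field_simp

/-- The regret of a run whose confidence sets contain the true parameter. -/
theorem regret_le (hopt : M.IsOptimal T X xs)
    (hconf : ∀ t ≤ T, M.θstar ∈ p.confSet M.disp (t + 1) (θ (t + 1)) (H (t + 1))) {γ Q : ℝ}
    (hγ : p.β d M.disp (T + 1) + 2 * p.η * p.α * p.C ≤ γ)
    (hQ : ∑ t ∈ Finset.Icc 1 T, roundCurv M p x θ H t * roundWidth x H t ^ 2 ≤ Q) :
    M.regret T xs x ≤ 2 * γ * Real.exp (3 * p.R * p.S) * (√(∑ t ∈ Finset.Icc 1 T,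
          M.disp t * slope M.m (inner ℝ (xs t) M.θstar)) * √Q)
        + 2 * p.L * γ * M.kappa p.S T X / p.α * Q := by
  have hL := h.pos.L_pos
  have hα := h.pos.α_pos
  have hη := h.pos.one_le_η
  have hκ := h.kappa_pos
  have hγ0 : 0 ≤ γ := by
    have : 0 ≤ 2 * p.η * p.α * p.C := by have := h.pos.C_nonneg; positivity
    have : 0 ≤ p.β d M.disp (T + 1) := Real.sqrt_nonneg _
    linarith
  have hmem : ∀ t ∈ Finset.Icc 1 T, t ∈ Set.Icc 1 T := fun t ht => by simpa using ht
  have hslope : ∀ t ∈ Finset.Icc 1 T, 0 ≤ slope M.m (inner ℝ (xs t) M.θstar) := fun t ht =>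
    (linkBounds h.arms h.pos.S_pos.le (hmem t ht) (hopt t (hmem t ht)).1).nonneg _
      (inner_mem_Icc _ h.valid.θstar_mem)
  unfold GLM.regret
  rw [← Finset.sum_sub_distrib]
  have hγ' : ∀ t ∈ Finset.Icc 1 T, p.β d M.disp t + 2 * p.η * p.α * p.C ≤ γ := fun t ht => by
    have := h.pos.β_mono h.one_le_d (γ := M.disp) (s := t) (t := T + 1)
      (by have := (hmem t ht).2; lia) fun u hu => by
        rw [Finset.mem_Ico] at hu; exact h.disp_pos ⟨hu.1, by lia⟩
    linarith
  have hconf' : ∀ t ∈ Finset.Icc 1 T, M.θstar ∈ p.confSet M.disp t (θ t) (H t) := fun t ht => by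
    obtain ⟨s, rfl⟩ : ∃ s, t = s + 1 := ⟨t - 1, by have := (hmem t ht).1; lia⟩
    exact hconf s (by have := (hmem _ ht).2; lia)
  refine (Finset.sum_le_sum fun t ht =>
    h.round_regret_le (hmem t ht) hopt (hconf' t ht) (hγ' t ht)).trans ?_
  rw [Finset.sum_add_distrib, ← Finset.mul_sum, ← Finset.mul_sum]
  have hCS := Real.sum_mul_le_sqrt_mul_sqrt (Finset.Icc 1 T)
    (fun t => √(M.disp t * slope M.m (inner ℝ (xs t) M.θstar)))
    (fun t => √(roundCurv M p x θ H t * roundWidth x H t ^ 2))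
  rw [Finset.sum_congr rfl fun t ht => Real.sq_sqrt
      (mul_nonneg (h.disp_pos (hmem t ht)).le (hslope t ht)),
    Finset.sum_congr rfl fun t ht => Real.sq_sqrt
      (mul_nonneg (h.curv_nonneg (hmem t ht)) (sq_nonneg (roundWidth x H t)))] at hCS
  have hCS' := hCS.trans (mul_le_mul_of_nonneg_left (Real.sqrt_le_sqrt hQ) (Real.sqrt_nonneg _))
  gcongr

end RunData

/-! ### Growth of the algorithmic constants -/

lemma log_one_add_le {V B u ℓ : ℝ} (hV : 0 ≤ V) (hB : 1 ≤ B) (hu0 : 0 ≤ u) (hu : u ≤ B * V)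
    (hℓ : 1 + Real.log B ≤ ℓ) : Real.log (1 + u) ≤ (1 + Real.log (1 + V)) * ℓ := by
  have h1 : Real.log (1 + u) ≤ Real.log (B * (1 + V)) := by
    apply Real.log_le_log (by linarith)
    nlinarith
  rw [Real.log_mul (by linarith) (by linarith)] at h1
  have h2 : 0 ≤ Real.log (1 + V) := Real.log_nonneg (by linarith)
  have h3 : 0 ≤ Real.log B := Real.log_nonneg hB
  nlinarith [mul_nonneg h2 h3]

namespace Params.Pos

variable {p : Params} (hp : p.Pos) {d : ℕ} {a b : ℝ}

include hp

lemma lam_le (hd : 1 ≤ d) (hα : p.α ≤ b * (√(d : ℝ) / max p.C 1)) (hb : 0 < b) :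
    p.lam d ≤ (14 * p.η * p.R ^ 2 + 36 * p.η ^ 2 * b ^ 2 * p.R ^ 2 * p.S ^ 2 * p.L ^ 2
      + 1 / (4 * p.S ^ 2)) * d := by
  have hη := hp.one_le_η
  have hS := hp.S_pos
  have hα0 := hp.α_pos
  have hC : 1 ≤ max p.C 1 := le_max_right _ _
  have h1 : p.α ≤ b * √(d : ℝ) := hα.trans (by
    gcongr; exact div_le_self (Real.sqrt_nonneg _) hC)
  have h2 : p.α ^ 2 ≤ b ^ 2 * d := by
    calc p.α ^ 2 ≤ (b * √(d : ℝ)) ^ 2 := by gcongr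
      _ = b ^ 2 * d := by rw [mul_pow, Real.sq_sqrt (by positivity)]
  have e1 : 0 ≤ 14 * d * p.η * p.R ^ 2 := by positivity
  have e2 : 36 * p.η ^ 2 * p.α ^ 2 * p.R ^ 2 * p.S ^ 2 * p.L ^ 2
      ≤ 36 * p.η ^ 2 * (b ^ 2 * d) * p.R ^ 2 * p.S ^ 2 * p.L ^ 2 := by gcongr
  have e3 : (0 : ℝ) ≤ d / (4 * p.S ^ 2) := by positivity
  have e4 : 0 ≤ 36 * p.η ^ 2 * (b ^ 2 * d) * p.R ^ 2 * p.S ^ 2 * p.L ^ 2 := by positivity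
  have e5 : 1 / (4 * p.S ^ 2) * d = d / (4 * p.S ^ 2) := by ring
  rw [add_mul, add_mul, e5]
  unfold Params.lam
  refine max_le (max_le ?_ ?_) ?_ <;> linarith

lemma α_mul_C_le (hα : p.α ≤ b * (√(d : ℝ) / max p.C 1)) (hb : 0 < b) :
    p.α * p.C ≤ b * √(d : ℝ) := by
  have hC := hp.C_nonneg
  have hm : 0 < max p.C 1 := lt_of_lt_of_le one_pos (le_max_right _ _)
  calc p.α * p.C ≤ b * (√(d : ℝ) / max p.C 1) * max p.C 1 := by
        gcongr; exact le_max_left _ _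
    _ = b * √(d : ℝ) := by field_simp

end Params.Pos

/-- Bound on `L / (g₀ λ)`. -/
def potBound (S L g₀ : ℝ) : ℝ := 4 * S ^ 2 * L / g₀

/-- Logarithmic growth constant of the elliptical potential. -/
def logBound (S L g₀ : ℝ) : ℝ := 1 + Real.log (1 + potBound S L g₀)

/-- Growth constant of the confidence radius. -/
def radiusBound (S L R g₀ b : ℝ) : ℝ :=
  √(2 * (1 + R * S) + (6 * (1 + R * S) ^ 2 + (1 + R * S)) * logBound S L g₀
    + 4 * (14 * (1 + R * S) * R ^ 2 + 36 * (1 + R * S) ^ 2 * b ^ 2 * R ^ 2 * S ^ 2 * L ^ 2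
      + 1 / (4 * S ^ 2)) * S ^ 2) + 2 * (1 + R * S) * b

section Radius

variable {S L R g₀ b : ℝ} (hS : 0 < S) (hL : 0 < L) (hg₀ : 0 < g₀)

include hS hL hg₀

lemma potBound_pos : 0 < potBound S L g₀ := by unfold potBound; positivity

lemma one_le_logBound : 1 ≤ logBound S L g₀ := by
  have := Real.log_nonneg (x := 1 + potBound S L g₀) (by linarith [potBound_pos hS hL hg₀])
  unfold logBound; linarith

end Radius

namespace RunData

variable {d : ℕ} {M : GLM d} {p : Params} {T : ℕ} {X : ℕ → Set (Vec d)}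
  {x θ xs : ℕ → Vec d} {r c : ℕ → ℝ} {H : ℕ → Vec d →L[ℝ] Vec d}
  (h : RunData M p T X x θ r c H) {g₀ a b : ℝ}

include h

lemma div_lam_le (hg₀ : 0 < g₀) : p.L / (g₀ * p.lam d) ≤ potBound p.S p.L g₀ := by
  have hS := h.pos.S_pos
  have hL := h.pos.L_pos
  have hd : (1 : ℝ) ≤ d := by exact_mod_cast h.one_le_d
  have h1 : (d : ℝ) / (4 * p.S ^ 2) ≤ p.lam d := le_max_right _ _
  have h2 : 1 / (4 * p.S ^ 2) ≤ p.lam d := le_trans (by gcongr) h1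
  calc p.L / (g₀ * p.lam d) ≤ p.L / (g₀ * (1 / (4 * p.S ^ 2))) := by gcongr
    _ = potBound p.S p.L g₀ := by unfold potBound; field_simp

lemma log_potential_le (hT : 1 ≤ T) (hg₀ : 0 < g₀) (hg : ∀ t ∈ Set.Icc 1 T, g₀ ≤ M.disp t) :
    Real.log (1 + ∑ s ∈ Finset.Icc 1 T, p.L / (p.lam d * M.disp s))
      ≤ logBound p.S p.L g₀ * (1 + Real.log (T / p.δ)) := by
  have hl := h.lam_pos
  have hL := h.pos.L_pos
  have hδ := h.pos.δ_pos
  have hT' : (1 : ℝ) ≤ T := by exact_mod_cast hT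
  have hterm : ∀ s ∈ Finset.Icc 1 T, p.L / (p.lam d * M.disp s) ≤ potBound p.S p.L g₀ := by
    intro s hs
    have h1 := hg s (by simpa using hs)
    refine le_trans ?_ (h.div_lam_le hg₀)
    rw [mul_comm g₀]
    gcongr
  refine log_one_add_le (B := T) (potBound_pos h.pos.S_pos hL hg₀).le hT' ?_ ?_ ?_
  · exact Finset.sum_nonneg fun s hs => by
      have := h.disp_pos (t := s) (by simpa using hs)
      positivity
  · refine (Finset.sum_le_card_nsmul _ _ _ hterm).trans ?_
    simp
  · have : (T : ℝ) ≤ T / p.δ := by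
      rw [le_div_iff₀ hδ]; nlinarith [h.pos.δ_lt]
    gcongr

lemma radius_le (hT : 1 ≤ T) (hg₀ : 0 < g₀) (hg : ∀ t ∈ Set.Icc 1 T, g₀ ≤ M.disp t) (hb : 0 < b)
    (hα : p.α ≤ b * (√(d : ℝ) / max p.C 1)) :
    p.β d M.disp (T + 1) + 2 * p.η * p.α * p.C
      ≤ radiusBound p.S p.L p.R g₀ b * (√(d : ℝ) * √(1 + Real.log (T / p.δ))) := by
  have hη := h.pos.one_le_η
  have hδ := h.pos.δ_pos
  have hS := h.pos.S_pos
  have hd : (1 : ℝ) ≤ d := by exact_mod_cast h.one_le_d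
  have hT' : (1 : ℝ) ≤ T := by exact_mod_cast hT
  have hlog : Real.log (1 / p.δ) ≤ Real.log (T / p.δ) := by gcongr
  have hlog0 := h.pos.log_inv_δ_pos
  have hpot := h.log_potential_le hT hg₀ hg
  have hlam := h.pos.lam_le h.one_le_d hα hb
  have hαC := h.pos.α_mul_C_le hα hb
  have hK := one_le_logBound hS h.pos.L_pos hg₀
  set ℓ := 1 + Real.log (T / p.δ) with hℓ
  have hℓ1 : 1 ≤ ℓ := by linarith
  set Kl := logBound p.S p.L g₀
  set Kr := 14 * p.η * p.R ^ 2 + 36 * p.η ^ 2 * b ^ 2 * p.R ^ 2 * p.S ^ 2 * p.L ^ 2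
      + 1 / (4 * p.S ^ 2) with hKr
  have hKr0 : 0 ≤ Kr := by positivity
  have hIco : Finset.Ico 1 (T + 1) = Finset.Icc 1 T := by ext; simp
  have hβ : p.β d M.disp (T + 1)
      ≤ √(2 * p.η + (6 * p.η ^ 2 + p.η) * Kl + 4 * Kr * p.S ^ 2) * (√(d : ℝ) * √ℓ) := by
    rw [← Real.sqrt_mul (by positivity), ← Real.sqrt_mul (by positivity)]
    unfold Params.β
    rw [hIco]
    apply Real.sqrt_le_sqrt
    have hdl : 1 * 1 ≤ d * ℓ := by gcongr
    have e1 : 2 * p.η * Real.log (1 / p.δ) ≤ 2 * p.η * (d * ℓ) := by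
      have : Real.log (1 / p.δ) ≤ d * ℓ := by nlinarith
      gcongr
    have e2 : d * (6 * p.η ^ 2 + p.η)
        * Real.log (1 + ∑ s ∈ Finset.Icc 1 T, p.L / (p.lam d * M.disp s))
        ≤ d * (6 * p.η ^ 2 + p.η) * (Kl * ℓ) := by gcongr
    have e3 : 4 * p.lam d * p.S ^ 2 ≤ 4 * (Kr * (d * ℓ)) * p.S ^ 2 := by
      have : Kr * d ≤ Kr * (d * ℓ) := by gcongr; nlinarith
      have := hlam.trans this
      gcongr
    linarith
  have hcorr : 2 * p.η * p.α * p.C ≤ 2 * p.η * b * (√(d : ℝ) * √ℓ) := by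
    have h1 : 1 ≤ √ℓ := Real.one_le_sqrt.2 hℓ1
    calc 2 * p.η * p.α * p.C = 2 * p.η * (p.α * p.C) := by ring
      _ ≤ 2 * p.η * (b * √(d : ℝ)) := by gcongr
      _ = 2 * p.η * b * (√(d : ℝ) * 1) := by ring
      _ ≤ _ := by gcongr
  have e : radiusBound p.S p.L p.R g₀ b
      = √(2 * p.η + (6 * p.η ^ 2 + p.η) * Kl + 4 * Kr * p.S ^ 2) + 2 * p.η * b := rfl
  rw [e, add_mul]
  exact add_le_add hβ hcorr

end RunData

/-- The constant in the regret bound. -/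
def regretConst (S L R g₀ a b : ℝ) : ℝ :=
  2 * Real.exp (3 * R * S) * radiusBound S L R g₀ b
      * √((1 + potBound S L g₀) * logBound S L g₀)
    + 2 * L * radiusBound S L R g₀ b * (1 + potBound S L g₀) * logBound S L g₀ / a
      * (1 + 1 / g₀)

lemma radiusBound_pos {S L R g₀ b : ℝ} (hS : 0 < S) (hR : 0 ≤ R) (hb : 0 < b) :
    0 < radiusBound S L R g₀ b := by
  unfold radiusBound
  positivity

lemma regretConst_pos {S L R g₀ a b : ℝ} (hS : 0 < S) (hL : 0 < L) (hR : 0 ≤ R) (hg₀ : 0 < g₀)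
    (ha : 0 < a) (hb : 0 < b) : 0 < regretConst S L R g₀ a b := by
  have h1 := radiusBound_pos (L := L) (g₀ := g₀) hS hR hb
  have h2 := potBound_pos hS hL hg₀
  have h3 := one_le_logBound hS hL hg₀
  unfold regretConst
  positivity

lemma disp_le_gmax {d T : ℕ} (M : GLM d) {t : ℕ} (ht : t ∈ Set.Icc 1 T) : M.disp t ≤ M.gmax T :=
  le_csSup ((Set.finite_Icc 1 T).image _).bddAbove ⟨t, ht, rfl⟩

theorem RunData.regret_le_regretConst {d : ℕ} {M : GLM d} {p : Params} {T : ℕ}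
    {X : ℕ → Set (Vec d)} {x θ xs : ℕ → Vec d} {r c : ℕ → ℝ} {H : ℕ → Vec d →L[ℝ] Vec d}
    (h : RunData M p T X x θ r c H) {g₀ a b : ℝ} (hT : 1 ≤ T) (hg₀ : 0 < g₀)
    (hg : ∀ t ∈ Set.Icc 1 T, g₀ ≤ M.disp t) (ha : 0 < a) (hb : 0 < b)
    (hα₁ : a * (√(d : ℝ) / max p.C 1) ≤ p.α) (hα₂ : p.α ≤ b * (√(d : ℝ) / max p.C 1))
    (hopt : M.IsOptimal T X xs)
    (hconf : ∀ t ≤ T, M.θstar ∈ p.confSet M.disp (t + 1) (θ (t + 1)) (H (t + 1))) :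
    M.regret T xs x ≤ regretConst p.S p.L p.R g₀ a b * (1 + Real.log (T / p.δ)) ^ 2
      * (d * √(∑ t ∈ Finset.Icc 1 T, M.disp t * slope M.m (inner ℝ (xs t) M.θstar))
        + ((d : ℝ) ^ 2 * M.gmax T + d * p.C) * M.kappa p.S T X) := by
  have hS := h.pos.S_pos
  have hL := h.pos.L_pos
  have hR := h.pos.R_nonneg
  have hα := h.pos.α_pos
  have hδ := h.pos.δ_pos
  have hC := h.pos.C_nonneg
  have hκ := h.kappa_pos
  have hd : (1 : ℝ) ≤ d := by exact_mod_cast h.one_le_d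
  have hT' : (1 : ℝ) ≤ T := by exact_mod_cast hT
  have hlog0 : 0 ≤ Real.log (T / p.δ) := by
    apply Real.log_nonneg
    rw [le_div_iff₀ hδ]; linarith [h.pos.δ_lt]
  have hrad := h.radius_le hT hg₀ hg hb hα₂
  have hpot := h.log_potential_le hT hg₀ hg
  have hV := potBound_pos hS hL hg₀
  have hK := one_le_logBound hS hL hg₀
  have hB := radiusBound_pos (L := p.L) (g₀ := g₀) hS hR hb
  have hsum := h.sum_curv_le hg₀ hg (h.div_lam_le hg₀)
  have hgmax : g₀ ≤ M.gmax T := (hg 1 ⟨le_rfl, hT⟩).trans (disp_le_gmax M ⟨le_rfl, hT⟩)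
  unfold regretConst
  set ℓ := 1 + Real.log (T / p.δ) with hℓ
  have hℓ1 : 1 ≤ ℓ := by linarith
  set V := potBound p.S p.L g₀
  set Kl := logBound p.S p.L g₀
  set B := radiusBound p.S p.L p.R g₀ b
  set G := ∑ t ∈ Finset.Icc 1 T, M.disp t * slope M.m (inner ℝ (xs t) M.θstar)
  set κ := M.kappa p.S T X
  have hQ : ∑ t ∈ Finset.Icc 1 T, roundCurv M p x θ H t * roundWidth x H t ^ 2
      ≤ (1 + V) * Kl * (d * ℓ) := by
    refine hsum.trans ?_
    calc (1 + V) * (d * Real.log (1 + ∑ s ∈ Finset.Icc 1 T, p.L / (p.lam d * M.disp s)))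
        ≤ (1 + V) * (d * (Kl * ℓ)) := by gcongr
      _ = _ := by ring
  have hmain := h.regret_le hopt hconf hrad hQ
  set E := Real.exp (3 * p.R * p.S)
  have hmC : 0 < max p.C 1 := lt_of_lt_of_le one_pos (le_max_right _ _)
  have hsd : 0 < √(d : ℝ) := Real.sqrt_pos.2 (by linarith)
  have hsℓ : 0 < √ℓ := Real.sqrt_pos.2 (by linarith)
  have hsd2 : √(d : ℝ) ^ 2 = d := Real.sq_sqrt (by linarith)
  have hsℓ2 : √ℓ ^ 2 = ℓ := Real.sq_sqrt (by linarith)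
  have first : 2 * (B * (√(d : ℝ) * √ℓ)) * E * (√G * √((1 + V) * Kl * (d * ℓ)))
      ≤ 2 * E * B * √((1 + V) * Kl) * ℓ ^ 2 * (d * √G) := by
    rw [Real.sqrt_mul (by positivity), Real.sqrt_mul (by linarith : (0 : ℝ) ≤ d)]
    calc 2 * (B * (√(d : ℝ) * √ℓ)) * E * (√G * (√((1 + V) * Kl) * (√(d : ℝ) * √ℓ)))
        = 2 * E * B * √((1 + V) * Kl) * √ℓ ^ 2 * (√(d : ℝ) ^ 2 * √G) := by ring
      _ = 2 * E * B * √((1 + V) * Kl) * ℓ * (d * √G) := by rw [hsd2, hsℓ2]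
      _ ≤ 2 * E * B * √((1 + V) * Kl) * ℓ ^ 2 * (d * √G) := by
        gcongr; exact le_self_pow₀ hℓ1 two_ne_zero
  have hinv : √(d : ℝ) / p.α ≤ max p.C 1 / a := by
    rw [div_le_div_iff₀ hα ha]
    have := mul_le_mul_of_nonneg_right hα₁ hmC.le
    rw [show a * (√(d : ℝ) / max p.C 1) * max p.C 1 = a * √(d : ℝ) by field_simp] at this
    linarith
  have hdC : d * max p.C 1 ≤ (1 + 1 / g₀) * ((d : ℝ) ^ 2 * M.gmax T + d * p.C) := by
    have h1 : max p.C 1 ≤ p.C + 1 := max_le (by linarith) (by linarith)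
    have h2 : (d : ℝ) ≤ 1 / g₀ * (d ^ 2 * M.gmax T) := by
      calc (d : ℝ) ≤ d ^ 2 := le_self_pow₀ hd two_ne_zero
        _ = 1 / g₀ * (d ^ 2 * g₀) := by field_simp
        _ ≤ _ := by gcongr
    have h3 : 0 ≤ 1 / g₀ * (d * p.C) := by positivity
    have h4 : 0 ≤ (d : ℝ) ^ 2 * M.gmax T := by
      have : 0 ≤ M.gmax T := by linarith
      positivity
    have h5 : d * max p.C 1 ≤ d * (p.C + 1) := by gcongr
    linarith
  have second : 2 * p.L * (B * (√(d : ℝ) * √ℓ)) * κ / p.α * ((1 + V) * Kl * (d * ℓ))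
      ≤ 2 * p.L * B * (1 + V) * Kl / a * (1 + 1 / g₀) * ℓ ^ 2
        * (((d : ℝ) ^ 2 * M.gmax T + d * p.C) * κ) := by
    have hsℓle : √ℓ ≤ ℓ := by
      exact (le_self_pow₀ (Real.one_le_sqrt.2 hℓ1) two_ne_zero).trans hsℓ2.le
    calc 2 * p.L * (B * (√(d : ℝ) * √ℓ)) * κ / p.α * ((1 + V) * Kl * (d * ℓ))
        = 2 * p.L * B * (1 + V) * Kl * κ * (√ℓ * ℓ) * d * (√(d : ℝ) / p.α) := by ring
      _ ≤ 2 * p.L * B * (1 + V) * Kl * κ * (ℓ * ℓ) * d * (max p.C 1 / a) := by gcongr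
      _ = 2 * p.L * B * (1 + V) * Kl * κ / a * ℓ ^ 2 * (d * max p.C 1) := by ring
      _ ≤ 2 * p.L * B * (1 + V) * Kl * κ / a * ℓ ^ 2
          * ((1 + 1 / g₀) * ((d : ℝ) ^ 2 * M.gmax T + d * p.C)) := by gcongr
      _ = _ := by ring
  have hgm : 0 ≤ M.gmax T := by linarith
  refine (hmain.trans (add_le_add first second)).trans ?_
  set U := (d : ℝ) * √G
  set Y := ((d : ℝ) ^ 2 * M.gmax T + d * p.C) * κ
  have hU : 0 ≤ U := by positivity
  have hY : 0 ≤ Y := by positivity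
  set k₁ := 2 * E * B * √((1 + V) * Kl)
  set k₂ := 2 * p.L * B * (1 + V) * Kl / a * (1 + 1 / g₀)
  have hk₁ : 0 ≤ k₁ := by positivity
  have hk₂ : 0 ≤ k₂ := by positivity
  have c1 : 0 ≤ k₁ * ℓ ^ 2 * Y := by positivity
  have c2 : 0 ≤ k₂ * ℓ ^ 2 * U := by positivity
  have e : (k₁ + k₂) * ℓ ^ 2 * (U + Y)
      = k₁ * ℓ ^ 2 * U + k₂ * ℓ ^ 2 * Y + k₁ * ℓ ^ 2 * Y + k₂ * ℓ ^ 2 * U := by ring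
  rw [e]
  linarith

end HCW

end

theorem theorem6 :
    ∃ k : ℕ, ∀ S L R g₀ a b : ℝ, 0 < S → 0 < L → 0 ≤ R → 0 < g₀ → 0 < a → 0 < b →
    ∃ K : ℝ, 0 < K ∧
    ∀ (d T : ℕ), 1 ≤ d → 1 ≤ T →
    ∀ (M : HCW.GLM d), M.Valid S T → (∀ t ∈ Set.Icc 1 T, g₀ ≤ M.disp t) →
    ∀ (δ C α : ℝ), 0 < δ → δ < 1 → 0 ≤ C →
      a * (√(d : ℝ) / max C 1) ≤ α → α ≤ b * (√(d : ℝ) / max C 1) →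
    ∀ (Ω : Type*) (mΩ : MeasurableSpace Ω) (P : MeasureTheory.Measure Ω),
      MeasureTheory.IsProbabilityMeasure P →
    ∀ (𝓖 : MeasureTheory.Filtration ℕ mΩ)
      (X : ℕ → Ω → Set (HCW.Vec d)) (xs x θ : ℕ → Ω → HCW.Vec d) (r c : ℕ → Ω → ℝ)
      (H : ℕ → Ω → HCW.Vec d →L[ℝ] HCW.Vec d),
      (∀ ω, M.ValidArms S L R T (fun t => X t ω)) →
      (∀ ω, M.IsOptimal T (fun t => X t ω) (fun t => xs t ω)) →
      HCW.IsEnvironment M P 𝓖 T C x θ r c →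
      (∀ ω, HCW.IsRun M { S := S, L := L, R := R, δ := δ, α := α, C := C } T
        (fun t => X t ω) (fun t => x t ω) (fun t => r t ω + c t ω) (fun t => θ t ω)
        (fun t => H t ω)) →
    ∃ A : Set Ω, MeasurableSet A ∧ 1 - δ ≤ P.real A ∧ ∀ ω ∈ A,
      M.regret T (fun t => xs t ω) (fun t => x t ω) ≤
        K * (1 + Real.log (T / δ)) ^ k *
          (d * √(∑ t ∈ Finset.Icc 1 T,
              M.disp t * HCW.slope M.m (inner ℝ (xs t ω) M.θstar))
            + ((d : ℝ) ^ 2 * M.gmax T + d * C) * M.kappa S T (fun t => X t ω)) := by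
  refine ⟨2, fun S L R g₀ a b hS hL hR hg₀ ha hb =>
    ⟨HCW.regretConst S L R g₀ a b, HCW.regretConst_pos hS hL hR hg₀ ha hb, ?_⟩⟩
  intro d T hd hT M hV hg δ C α hδ hδ1 hC hα₁ hα₂ Ω mΩ P hP 𝓖 X xs x θ r c H hA hopt hE hrun
  have hd' : (0 : ℝ) < d := by exact_mod_cast hd
  have hmC : 0 < max C 1 := lt_of_lt_of_le one_pos (le_max_right _ _)
  have hα : 0 < α := lt_of_lt_of_le (by positivity) hα₁
  have hp : HCW.Params.Pos { S := S, L := L, R := R, δ := δ, α := α, C := C } :=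
    ⟨hS, hL, hR, hδ, hδ1, hα, hC⟩
  have hdata := fun ω => HCW.RunData.mk (c := fun t => c t ω) (r := fun t => r t ω)
    hd hV (hA ω) hp (hrun ω)
  obtain ⟨A, hAm, hAP, hAω⟩ := HCW.exists_event hd hV hp hE hdata
  refine ⟨A, hAm, hAP, fun ω hω => ?_⟩
  obtain ⟨hlog, hbudget⟩ := hAω ω hω
  exact (hdata ω).regret_le_regretConst hT hg₀ hg ha hb hα₁ hα₂ (hopt ω)
    ((hdata ω).mem_confSet hlog hbudget)
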